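/- Let $\Gamma_8=\pi_1(S^3\setminus K_8)=\langle m,n \mid mw=wn\rangle$, with $w=nm^{-1}n^{-1}m$, be the figure-eight knot group, and let $\rho_{\rm hyp}:\Gamma_8\to {\rm SO}^0(3,1)\subset{\rm SO}(3,1)$ be its hyperbolic representation, i.e. the holonomy of the complete finite-volume hyperbolic structure on $S^3\setminus K_8$ (the faithful representation whose image is a lattice; it is unique up to conjugation by isometries of real hyperbolic 3-space). For $u=e^{i\alpha}\in{\rm U}(1)$ put $$M_u=\begin{pmatrix}1&0&1&u/2-1\\0&1&1&u/2\\0&0&1&(u+1)/2\\0&0&0&1\end{pmatrix},\qquad N_u=\begin{pmatrix}1&0&0&0\\2(1+u^{-1})&1&0&0\\2&1&1&0\\1&1&0&1\end{pmatrix}.$$ Then for every $u\in{\rm U}(1)$ there is a representation $\rho_u:\Gamma_8\to{\rm SL}(4,\mathbb{C})$ with $\rho_u(m)=M_u$ and $\rho_u(n)=N_u$, and: 1. The family $(\rho_u)$ is a 1-parameter family of deformations of $\rho_{\rm hyp}$: $\rho_u(\gamma)$ depends continuously on $u$ for every $\gamma\in\Gamma_8$, $\rho_1$ is conjugate in ${\rm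 SL}(4,\mathbb{C})$ to $\rho_{\rm hyp}$, and $\rho_u$, $\rho_v$ are not conjugate in ${\rm SL}(4,\mathbb{C})$ when $u\neq v$. 2. If $|\alpha|<2\pi/3$, then $\rho_u$ is conjugate in ${\rm SL}(4,\mathbb{C})$ to a representation into ${\rm SU}(3,1)$, and every such representation $\sigma:\Gamma_8\to{\rm SU}(3,1)$ is parabolic-preserving: for every $\gamma\in\Gamma_8$, $\sigma(\gamma)$ is parabolic (resp. boundary elliptic) whenever $\rho_{\rm hyp}(\gamma)\in{\rm SO}(3,1)\subset{\rm SU}(3,1)$ is. 3. If $2\pi/3<|\alpha|<\pi$, then $\rho_u$ is conjugate in ${\rm SL}(4,\mathbb{C})$ to a representation into ${\rm SU}(2,2)$. 4. The image of $\rho_u$ is a discrete subgroup of ${\rm SL}(4,\mathbb{C})$ for $u=\pm1,\ \pm i,\ e^{\pm i\pi/3},\ e^{\pm 2i\pi/3}$. Here an element of ${\rm SU}(3,1)$ is parabolic if it has no fixed point in complex hyperbolic 3-space ${\rm H}^3_{\mathbb C}$ and exactly one on its boundary at infinity, and boundary elliptic if it acts on ${\rm H}^3_{\mathbb C}$ as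 a non-identity isometry with a fixed point in ${\rm H}^3_{\mathbb C}$ and a fixed point on the boundary at infinity. -/

import Mathlib

open Matrix MeasureTheory
open scoped LinearAlgebra.Projectivization

noncomputable section

namespace FigureEight

/-! ### The figure-eight knot group -/

/-- The two generators of the figure-eight knot group (both are meridians of the knot). -/
inductive Gen
  | m
  | n

/-- The word `w = [n, m⁻¹] = n m⁻¹ n⁻¹ m` in the free group on the two generators. -/
def wordW : FreeGroup Gen :=
  FreeGroup.of Gen.n * (FreeGroup.of Gen.m)⁻¹ * (FreeGroup.of Gen.n)⁻¹ * FreeGroup.of Gen.m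

/-- The single relator `m w (w n)⁻¹`. -/
def relators : Set (FreeGroup Gen) :=
  {FreeGroup.of Gen.m * wordW * (wordW * FreeGroup.of Gen.n)⁻¹}

/-- The figure-eight knot group `Γ₈ = π₁(S³ ∖ K₈) = ⟨m, n | m w = w n⟩`, `w = [n, m⁻¹]`. -/
abbrev KnotGroup : Type := PresentedGroup relators

/-- The generator `m` of the figure-eight knot group. -/
def genM : KnotGroup := PresentedGroup.of Gen.m

/-- The generator `n` of the figure-eight knot group. -/
def genN : KnotGroup := PresentedGroup.of Gen.n

/-! ### The groups SO(3,1), SU(3,1) and SU(2,2) -/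

/-- `SL(4, 𝕜)`, with the topology induced from the space of matrices. -/
abbrev SL4 (𝕜 : Type) [RCLike 𝕜] : Type := Matrix.SpecialLinearGroup (Fin 4) 𝕜

/-- The subgroup of `SL(4, 𝕜)` preserving the sesquilinear form `(x, y) ↦ x* J y`. -/
def specialIsometries {𝕜 : Type} [RCLike 𝕜] (J : Matrix (Fin 4) (Fin 4) 𝕜) :
    Subgroup (SL4 𝕜) where
  carrier := {A | (A : Matrix (Fin 4) (Fin 4) 𝕜)ᴴ * J * (A : Matrix (Fin 4) (Fin 4) 𝕜) = J}
  one_mem' := by simp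
  mul_mem' := by
    intro A B (hA : A.1ᴴ * J * A.1 = J) (hB : B.1ᴴ * J * B.1 = J)
    change (A.1 * B.1)ᴴ * J * (A.1 * B.1) = J
    calc (A.1 * B.1)ᴴ * J * (A.1 * B.1) = B.1ᴴ * (A.1ᴴ * J * A.1) * B.1 := by
          simp only [conjTranspose_mul, Matrix.mul_assoc]
      _ = J := by rw [hA, hB]
  inv_mem' := by
    intro A (hA : A.1ᴴ * J * A.1 = J)
    change (A⁻¹).1ᴴ * J * (A⁻¹).1 = J
    have h : A.1 * (A⁻¹).1 = 1 := congrArg Subtype.val (mul_inv_cancel A)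
    calc (A⁻¹).1ᴴ * J * (A⁻¹).1 = (A⁻¹).1ᴴ * (A.1ᴴ * J * A.1) * (A⁻¹).1 := by rw [hA]
      _ = (A.1 * (A⁻¹).1)ᴴ * J * (A.1 * (A⁻¹).1) := by
          simp only [conjTranspose_mul, Matrix.mul_assoc]
      _ = J := by rw [h, conjTranspose_one, Matrix.one_mul, Matrix.mul_one]

/-- `SO(3,1)`: the real matrices of determinant one preserving `x₀² + x₁² + x₂² - x₃²`. -/
def SO31 : Subgroup (SL4 ℝ) := specialIsometries (diagonal ![1, 1, 1, -1])

/-- `SU(3,1)`: the complex matrices of determinant one preserving the Hermitian form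
`|z₀|² + |z₁|² + |z₂|² - |z₃|²`. -/
def SU31 : Subgroup (SL4 ℂ) := specialIsometries (diagonal ![1, 1, 1, -1])

/-- `SU(2,2)`: the complex matrices of determinant one preserving the Hermitian form
`|z₀|² + |z₁|² - |z₂|² - |z₃|²`. -/
def SU22 : Subgroup (SL4 ℂ) := specialIsometries (diagonal ![1, 1, -1, -1])

/-- The inclusion `SL(4, ℝ) → SL(4, ℂ)`. -/
def complexify : SL4 ℝ →* SL4 ℂ := SpecialLinearGroup.map Complex.ofRealHom

lemma complexify_mem {A : SL4 ℝ} (hA : A ∈ SO31) : complexify A ∈ SU31 := by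
  have h : (A : Matrix (Fin 4) (Fin 4) ℝ)ᴴ * diagonal ![1, 1, 1, -1] *
      (A : Matrix (Fin 4) (Fin 4) ℝ) = diagonal ![1, 1, 1, -1] := hA
  change ((A : Matrix (Fin 4) (Fin 4) ℝ).map Complex.ofRealHom)ᴴ * diagonal ![1, 1, 1, -1] *
      ((A : Matrix (Fin 4) (Fin 4) ℝ).map Complex.ofRealHom) = diagonal ![1, 1, 1, -1]
  have hJ : (diagonal ![1, 1, 1, -1] : Matrix (Fin 4) (Fin 4) ℂ) =
      (diagonal ![1, 1, 1, -1] : Matrix (Fin 4) (Fin 4) ℝ).map Complex.ofRealHom := by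
    ext i j
    fin_cases i <;> fin_cases j <;> simp [diagonal]
  have hT : ((A : Matrix (Fin 4) (Fin 4) ℝ).map Complex.ofRealHom)ᴴ =
      ((A : Matrix (Fin 4) (Fin 4) ℝ)ᴴ).map Complex.ofRealHom := by
    ext i j
    simp
  rw [hJ, hT, ← Matrix.map_mul, ← Matrix.map_mul, h]

/-- The inclusion `SO(3,1) → SU(3,1)`. -/
def SO31toSU31 : SO31 →* SU31 :=
  (complexify.comp SO31.subtype).codRestrict SU31 (fun A => complexify_mem A.2)

/-! ### Complex hyperbolic space and the types of its isometries -/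

/-- The Hermitian square `|z₀|² + |z₁|² + |z₂|² - |z₃|²`. -/
def hermSq (z : Fin 4 → ℂ) : ℝ := ‖z 0‖ ^ 2 + ‖z 1‖ ^ 2 + ‖z 2‖ ^ 2 - ‖z 3‖ ^ 2

/-- Complex hyperbolic 3-space: the negative lines in `ℂ^{3,1}`
(the sign of `hermSq` does not depend on the representative of a line). -/
def hyperbolicSpace : Set (ℙ ℂ (Fin 4 → ℂ)) := {p | hermSq p.rep < 0}

/-- The boundary at infinity of complex hyperbolic 3-space: the null lines. -/
def hyperbolicBoundary : Set (ℙ ℂ (Fin 4 → ℂ)) := {p | hermSq p.rep = 0}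

/-- `A` is parabolic: it has no fixed point in complex hyperbolic space and exactly one on the
boundary at infinity. -/
def IsParabolic (A : SU31) : Prop :=
  (∀ p ∈ hyperbolicSpace, (A : SL4 ℂ) • p ≠ p) ∧
    ∃! p, p ∈ hyperbolicBoundary ∧ (A : SL4 ℂ) • p = p

/-- `A` is boundary elliptic: it acts as a non-identity isometry with a fixed point in complex
hyperbolic space and a fixed point on the boundary at infinity. -/
def IsBoundaryElliptic (A : SU31) : Prop :=
  (∃ p : ℙ ℂ (Fin 4 → ℂ), (A : SL4 ℂ) • p ≠ p) ∧
    (∃ p ∈ hyperbolicSpace, (A : SL4 ℂ) • p = p) ∧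
      ∃ p ∈ hyperbolicBoundary, (A : SL4 ℂ) • p = p

/-- `σ` is parabolic-preserving, relative to the reference representation `σ₀` (by which `Γ` is
regarded as a group of isometries): `σ γ` is parabolic (resp. boundary elliptic) whenever `σ₀ γ`
is. -/
def IsParabolicPreserving {Γ : Type} [Group Γ] (σ₀ σ : Γ →* SU31) : Prop :=
  ∀ γ, (IsParabolic (σ₀ γ) → IsParabolic (σ γ)) ∧
    (IsBoundaryElliptic (σ₀ γ) → IsBoundaryElliptic (σ γ))

/-! ### Hyperbolic representations -/

/-- The point of the hyperboloid model
`H³ = {(x₀, x₁, x₂, t) | x₀² + x₁² + x₂² - t² = -1, t > 0}` above `x ∈ ℝ³`. -/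
def hyperboloidPoint (x : Fin 3 → ℝ) : Fin 4 → ℝ :=
  ![x 0, x 1, x 2, √(1 + x 0 ^ 2 + x 1 ^ 2 + x 2 ^ 2)]

/-- The hyperbolic volume of (the part of the hyperboloid above) a set `S ⊆ ℝ³`:
the hyperbolic volume element is `dx₀ dx₁ dx₂ / t`. -/
def hyperbolicVolume (S : Set (Fin 3 → ℝ)) : ENNReal :=
  ∫⁻ x in S, ENNReal.ofReal (1 / √(1 + x 0 ^ 2 + x 1 ^ 2 + x 2 ^ 2))

/-- `ρ : Γ₈ → SO(3,1)` is a hyperbolic representation, that is, the holonomy of a complete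
hyperbolic structure of finite volume: it takes its values in `SO⁰(3,1) = Isom⁺(H³)`
(it preserves the sheet `t > 0`), is faithful, and its image is a lattice, i.e. it is discrete and
a set of finite hyperbolic volume meets all of its orbits in `H³`.
By Mostow-Prasad rigidity such a `ρ` is unique up to conjugation by isometries of `H³`. -/
structure IsHyperbolicRep (ρ : KnotGroup →* SO31) : Prop where
  sheet : ∀ γ, 0 < ((ρ γ : SL4 ℝ) : Matrix (Fin 4) (Fin 4) ℝ) 3 3
  faithful : Function.Injective ρ
  discrete : DiscreteTopology ρ.range
  finite_covolume : ∃ S : Set (Fin 3 → ℝ), MeasurableSet S ∧ hyperbolicVolume S < ⊤ ∧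
    ∀ x : Fin 3 → ℝ, ∃ γ, ∃ y ∈ S,
      ((ρ γ : SL4 ℝ) : Matrix (Fin 4) (Fin 4) ℝ) *ᵥ hyperboloidPoint y = hyperboloidPoint x

/-! ### The explicit matrices -/

/-- The matrix `M_u`. -/
def matM (u : Circle) : Matrix (Fin 4) (Fin 4) ℂ :=
  !![1, 0, 1, (u : ℂ) / 2 - 1;
     0, 1, 1, (u : ℂ) / 2;
     0, 0, 1, ((u : ℂ) + 1) / 2;
     0, 0, 0, 1]

/-- The matrix `N_u`; for `u` of modulus one, `u⁻¹` is the complex conjugate of `u`. -/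
def matN (u : Circle) : Matrix (Fin 4) (Fin 4) ℂ :=
  !![1, 0, 0, 0;
     2 * (1 + (u : ℂ)⁻¹), 1, 0, 0;
     2, 1, 1, 0;
     1, 1, 0, 1]

/-- Two homomorphisms into a group `G` are conjugate in `G`. -/
def AreConjugate {Γ G : Type} [Group Γ] [Group G] (ρ₁ ρ₂ : Γ →* G) : Prop :=
  ∃ g : G, ∀ γ, ρ₂ γ = g * ρ₁ γ * g⁻¹

end FigureEight

end

noncomputable section

namespace FigureEight

/-! ### Homomorphisms out of the figure-eight knot group -/

/-! After a change of basis independent of `u`, the matrices `M_u` and `N_u` have entries in `ℤ[u,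
u⁻¹]`; this is `intRep`. The knot relation is a matrix identity there, and continuity is visible on
the generators. The trace of the image of `mn` is `6 + u`, which separates the conjugacy classes. If
`u` lies in the Gaussian or Eisenstein integers, all entries in the integral basis do too, and a
nonzero element of either ring has norm at least one; this gives discreteness.

At `u = 1` the representation preserves a real form of signature (3,1) and is the action of the
classical representation `slRep` into `SL(2, ℂ)` on Hermitian matrices (`intHerm_intRep`). That it
is the hyperbolic representation is proved by hand. Faithfulness (`intRep_one_injective`) comes from
the tessellation by regular ideal tetrahedra. The Coxeter group with all `m_ij = 3` acts on labelled
tetrahedra by crossing faces, because circuits around edges close up by the knot relation. An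
element of the kernel yields a Coxeter element acting as a permutation matrix, and positivity of
roots (`tetRep_nonneg`) forces that element to be trivial. Finite covolume follows from a reduction
argument: unit isometric spheres centred at all Eisenstein integers cover the plane with room to
spare (`exists_isometricSphere`), so every orbit climbs to a definite height, and peripheral
translations then bring it into a cusp region of finite volume.

For `u ≠ -1` there is an explicit invariant Hermitian form: an antidiagonal plane spanned by f₁, f₄,
orthogonal to a plane with Gram determinant `(1 + 2 cos α) / (2 + 2 cos α)`. When `1 + 2 cos α ≠ 0`
the first plane has signature (1,1), so the sign of the determinant decides between SU(3,1) and
SU(2,2), with the transition at `|α| = 2π/3`.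

For parabolic preservation, a parabolic `ρ_hyp(γ)` has trace `±2` in `SL(2, ℂ)`. Euclidean descent
moves its Eisenstein fixed point to infinity, so that a conjugate of `γ⁴` is a nontrivial peripheral
element. All eigenvectors of such an element in the integral basis lie in the span of f₁, f₂, f₃,
which is orthogonal to the null vector f₁ for every invariant form; f₁ is then the only fixed point
in the closed ball. The boundary elliptic clause is vacuous: an elliptic element would have integral
trace of absolute value at most 2, hence be torsion or parabolic, and the knot group is torsion-free
because it embeds in `F₂ ⋊ ℤ`. -/

/-- The word `w` evaluated at `m = a`, `n = b`. -/
def wordAt {G : Type*} [Group G] (a b : G) : G := b * a⁻¹ * b⁻¹ * a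

/-- The homomorphism with prescribed values on the two meridians. -/
def liftHom {G : Type*} [Group G] (a b : G) (h : a * wordAt a b = wordAt a b * b) :
    KnotGroup →* G :=
  PresentedGroup.toGroup (f := fun | Gen.m => a | Gen.n => b) (by
    intro r hr
    rw [relators, Set.mem_singleton_iff] at hr
    subst hr
    simp only [wordW, map_mul, map_inv, FreeGroup.lift_apply_of]
    exact mul_inv_eq_one.mpr h)

section
variable {G : Type*} [Group G] {a b : G} {h : a * wordAt a b = wordAt a b * b}

@[simp] lemma liftHom_genM : liftHom a b h genM = a := PresentedGroup.toGroup.of _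

@[simp] lemma liftHom_genN : liftHom a b h genN = b := PresentedGroup.toGroup.of _

end

lemma genM_mul_word : genM * wordAt genM genN = wordAt genM genN * genN := by
  have h : (PresentedGroup.mk relators) (FreeGroup.of Gen.m * wordW *
      (wordW * FreeGroup.of Gen.n)⁻¹) = 1 :=
    PresentedGroup.one_of_mem (Set.mem_singleton _)
  rw [map_mul, map_inv, mul_inv_eq_one] at h
  simp only [wordW, map_mul, map_inv] at h
  exact h

lemma knotGroup_closure : Subgroup.closure ({genM, genN} : Set KnotGroup) = ⊤ := by
  rw [eq_top_iff, ← PresentedGroup.closure_range_of, Subgroup.closure_le]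
  rintro _ ⟨g, rfl⟩
  cases g
  · exact Subgroup.subset_closure (Or.inl rfl)
  · exact Subgroup.subset_closure (Or.inr rfl)

lemma subgroup_eq_top (S : Subgroup KnotGroup) (hm : genM ∈ S) (hn : genN ∈ S) (γ : KnotGroup) :
    γ ∈ S := by
  have : Subgroup.closure ({genM, genN} : Set KnotGroup) ≤ S := by
    rw [Subgroup.closure_le]
    rintro _ (rfl | rfl) <;> assumption
  exact this (knotGroup_closure ▸ Subgroup.mem_top γ)

lemma knotGroup_hom_ext {G : Type*} [Group G] {f g : KnotGroup →* G}
    (hm : f genM = g genM) (hn : f genN = g genN) : f = g := by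
  exact MonoidHom.ext fun γ => subgroup_eq_top (f.eqLocus g) hm hn γ

/-- The longitude of the knot commuting with the meridian `m`. -/
def longitude : KnotGroup := wordAt genM genN * (genM * genN⁻¹ * genM⁻¹ * genN)

/-! ### The family of representations in an integral basis -/

section
variable {R : Type*} [CommRing R] (u : Rˣ)

/-- The image of `m` in the integral basis. -/
def intM : Matrix.SpecialLinearGroup (Fin 4) R :=
  ⟨!![1, 0, 1, (u : R); 0, 1, 0, 1; 0, 0, 1, u + 1; 0, 0, 0, 1], by
    simp [det_succ_row_zero, Fin.sum_univ_succ]⟩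

/-- The image of `n` in the integral basis. -/
def intN : Matrix.SpecialLinearGroup (Fin 4) R :=
  ⟨!![1, 0, 0, 0; 1 + (↑u⁻¹ : R), 1, 0, 0; 1, 0, 1, 0; 1, 1, 0, 1], by
    simp [det_succ_row_zero, Fin.sum_univ_succ]⟩

lemma coe_intM_inv : (((intM u)⁻¹ : Matrix.SpecialLinearGroup (Fin 4) R) : Matrix (Fin 4) (Fin 4) R) =
    !![1, 0, -1, 1; 0, 1, 0, -1; 0, 0, 1, -1 - (u : R); 0, 0, 0, 1] := by
  have : (intM u : Matrix (Fin 4) (Fin 4) R) *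
      !![1, 0, -1, 1; 0, 1, 0, -1; 0, 0, 1, -1 - (u : R); 0, 0, 0, 1] = 1 := by
    ext i j
    fin_cases i <;> fin_cases j <;> simp [intM, mul_apply, Fin.sum_univ_four] <;> ring
  calc _ = ((intM u)⁻¹ : Matrix.SpecialLinearGroup (Fin 4) R).1 * ((intM u).1 * _) := by
        rw [this, mul_one]
    _ = _ := by rw [← mul_assoc, ← Matrix.SpecialLinearGroup.coe_mul, inv_mul_cancel,
                  Matrix.SpecialLinearGroup.coe_one, one_mul]

lemma coe_intN_inv : (((intN u)⁻¹ : Matrix.SpecialLinearGroup (Fin 4) R) : Matrix (Fin 4) (Fin 4) R) =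
    !![1, 0, 0, 0; -1 - (↑u⁻¹ : R), 1, 0, 0; -1, 0, 1, 0; (↑u⁻¹ : R), -1, 0, 1] := by
  have : (intN u : Matrix (Fin 4) (Fin 4) R) *
      !![1, 0, 0, 0; -1 - (↑u⁻¹ : R), 1, 0, 0; -1, 0, 1, 0; (↑u⁻¹ : R), -1, 0, 1]
      = 1 := by
    ext i j
    fin_cases i <;> fin_cases j <;> simp [intN, mul_apply, Fin.sum_univ_four]
    ring
  calc _ = ((intN u)⁻¹ : Matrix.SpecialLinearGroup (Fin 4) R).1 * ((intN u).1 * _) := by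
        rw [this, mul_one]
    _ = _ := by rw [← mul_assoc, ← Matrix.SpecialLinearGroup.coe_mul, inv_mul_cancel,
                  Matrix.SpecialLinearGroup.coe_one, one_mul]

lemma coe_wordAt_int :
    (wordAt (intM u) (intN u)).1 =
      !![(↑u⁻¹ : R) + 2, -1, (↑u⁻¹ : R) + 1, u;
        (↑u⁻¹ : R) ^ 2 + (↑u⁻¹ : R) + 1, -(↑u⁻¹ : R) + 1,
          (↑u⁻¹ : R) ^ 2, 0;
        0, u, 0, 0; 1, 0, 0, 0] := by
  have hu : (u : R) * (↑u⁻¹ : R) = 1 := u.mul_inv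
  simp only [wordAt, Matrix.SpecialLinearGroup.coe_mul, coe_intM_inv, coe_intN_inv]
  simp only [intM, intN]
  generalize (↑u⁻¹ : R) = v at *
  ext i j
  fin_cases i <;> fin_cases j <;> simp [mul_apply, Fin.sum_univ_four] <;> grind

lemma int_relation : intM u * wordAt (intM u) (intN u) = wordAt (intM u) (intN u) * intN u := by
  have hu : (u : R) * (↑u⁻¹ : R) = 1 := u.mul_inv
  apply Subtype.ext
  simp only [Matrix.SpecialLinearGroup.coe_mul, coe_wordAt_int]
  simp only [intM, intN]
  generalize (↑u⁻¹ : R) = v at *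
  ext i j
  fin_cases i <;> fin_cases j <;> simp [mul_apply, Fin.sum_univ_four] <;> grind

/-- The representation `ρ_u`, written in a basis in which its entries are in `ℤ[u, u⁻¹]`. -/
def intRep : KnotGroup →* Matrix.SpecialLinearGroup (Fin 4) R := liftHom _ _ (int_relation u)

@[simp] lemma intRep_genM : intRep u genM = intM u := liftHom_genM

@[simp] lemma intRep_genN : intRep u genN = intN u := liftHom_genN

/-- Base change is what transfers integrality: a representation over `ℤ` or over a quadratic ring is
pushed forward to `ℝ` or `ℂ`, so its entries stay in the image of the small ring. -/
lemma map_comp_intRep {S : Type*} [CommRing S] (f : R →+* S) :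
    (Matrix.SpecialLinearGroup.map f).comp (intRep u) = intRep (Units.map (f : R →* S) u) := by
  apply knotGroup_hom_ext
  · ext i j
    simp only [MonoidHom.comp_apply, intRep_genM]
    change f ((intM u).1 i j) = _
    fin_cases i <;> fin_cases j <;> simp [intM]
  · ext i j
    simp only [MonoidHom.comp_apply, intRep_genN]
    change f ((intN u).1 i j) = _
    fin_cases i <;> fin_cases j <;> simp [intN]

/-- Like the meridian, the longitude is upper triangular in the integral basis, with diagonal `u,
u⁻³, u, u`. The peripheral subgroup therefore preserves the line of f₁, and its eigenvectors can be
controlled through the last rows. -/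
lemma coe_longitude :
    (intRep u longitude : Matrix (Fin 4) (Fin 4) R) =
      !![(u : R), (↑u⁻¹ : R) ^ 2 + (↑u⁻¹ : R) + 1 + u, -(↑u⁻¹ : R) ^ 2 - 1,
          (↑u⁻¹ : R) ^ 2 + 2 * (↑u⁻¹ : R) + 4 + 5 * u;
        0, (↑u⁻¹ : R) ^ 3,
          -(↑u⁻¹ : R) ^ 3 + (↑u⁻¹ : R) ^ 2 - (↑u⁻¹ : R) + 1,
          (↑u⁻¹ : R) ^ 3 + (↑u⁻¹ : R) ^ 2 + 2 * (↑u⁻¹ : R) + 1 + u;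
        0, 0, u, 0; 0, 0, 0, u] := by
  have hu : (u : R) * (↑u⁻¹ : R) = 1 := u.mul_inv
  have : intRep u longitude =
      wordAt (intM u) (intN u) * (intM u * ((intN u)⁻¹ * ((intM u)⁻¹ * intN u))) := by
    simp [longitude, wordAt, mul_assoc]
  rw [this, Matrix.SpecialLinearGroup.coe_mul, coe_wordAt_int]
  simp only [Matrix.SpecialLinearGroup.coe_mul, coe_intM_inv, coe_intN_inv]
  simp only [intM, intN]
  generalize (↑u⁻¹ : R) = v at *
  ext i j
  fin_cases i <;> fin_cases j <;> simp [mul_apply, Fin.sum_univ_four] <;> grind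

end

/-! ### Conjugation by matrices of arbitrary determinant -/

section
variable {K : Type} [RCLike K]

/-- Conjugation `A ↦ P A Q` where `P Q = 1`. -/
def conjHom (P Q : Matrix (Fin 4) (Fin 4) K) (h : P * Q = 1) : SL4 K →* SL4 K where
  toFun A := ⟨P * A.1 * Q, by
    rw [det_mul, det_mul, A.2, mul_one, ← det_mul, h, det_one]⟩
  map_one' := by
    apply Subtype.ext
    simp [h]
  map_mul' A B := by
    apply Subtype.ext
    have h' : Q * P = 1 := mul_eq_one_comm.mp h
    change P * (A.1 * B.1) * Q = P * A.1 * Q * (P * B.1 * Q)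
    calc P * (A.1 * B.1) * Q = P * A.1 * 1 * B.1 * Q := by simp [mul_assoc]
      _ = _ := by rw [← h']; simp only [mul_assoc]

lemma coe_conjHom (P Q : Matrix (Fin 4) (Fin 4) K) (h : P * Q = 1) (A : SL4 K) :
    (conjHom P Q h A : Matrix (Fin 4) (Fin 4) K) = P * A.1 * Q := rfl

end

lemma areConjugate_of_intertwining {Γ : Type} [Group Γ] {ρ₁ ρ₂ : Γ →* SL4 ℂ}
    (P Q : Matrix (Fin 4) (Fin 4) ℂ) (h : P * Q = 1)
    (hP : ∀ γ, P * (ρ₁ γ).1 = (ρ₂ γ).1 * P) : AreConjugate ρ₁ ρ₂ := by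
  have hdet : P.det * Q.det = 1 := by rw [← det_mul, h, det_one]
  have hP0 : P.det ≠ 0 := left_ne_zero_of_mul_eq_one hdet
  -- Scaling by a fourth root of the inverse determinant moves the intertwiner into `SL(4, ℂ)`
  -- without changing the conjugation.
  obtain ⟨c, hc⟩ := IsAlgClosed.exists_pow_nat_eq (P.det)⁻¹ (n := 4) (by norm_num)
  have hg : (c • P).det = 1 := by
    rw [det_smul, Fintype.card_fin, hc, inv_mul_cancel₀ hP0]
  refine ⟨(⟨c • P, hg⟩ : Matrix.SpecialLinearGroup (Fin 4) ℂ), fun γ =>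
    eq_mul_inv_of_mul_eq (Subtype.ext ?_)⟩
  change (ρ₂ γ).1 * (c • P) = (c • P) * (ρ₁ γ).1
  rw [Matrix.mul_smul, Matrix.smul_mul, hP]

lemma AreConjugate.symm {Γ G : Type} [Group Γ] [Group G] {ρ₁ ρ₂ : Γ →* G}
    (h : AreConjugate ρ₁ ρ₂) : AreConjugate ρ₂ ρ₁ := by
  obtain ⟨g, hg⟩ := h
  exact ⟨g⁻¹, fun γ => by rw [hg]; group⟩

lemma AreConjugate.trans {Γ G : Type} [Group Γ] [Group G] {ρ₁ ρ₂ ρ₃ : Γ →* G}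
    (h : AreConjugate ρ₁ ρ₂) (h' : AreConjugate ρ₂ ρ₃) : AreConjugate ρ₁ ρ₃ := by
  obtain ⟨g, hg⟩ := h
  obtain ⟨g', hg'⟩ := h'
  exact ⟨g' * g, fun γ => by rw [hg', hg]; group⟩

/-! ### A discreteness criterion -/

/-- A subgroup of `SL(4, 𝕜)` is discrete as soon as, after conjugation, its entries lie in an
additive group whose nonzero elements have norm at least one. -/
lemma discreteTopology_of_entries {K : Type} [RCLike K] (G : Subgroup (SL4 K))
    (P Q : Matrix (Fin 4) (Fin 4) K) (h : P * Q = 1) (S : Set K)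
    (hS : ∀ x ∈ S, ∀ y ∈ S, ‖x - y‖ < 1 → x = y)
    (hG : ∀ A ∈ G, ∀ i j, (P * A.1 * Q) i j ∈ S) : DiscreteTopology G := by
  have h' : Q * P = 1 := mul_eq_one_comm.mp h
  have hcont : ∀ i j, Continuous fun A : G => (P * A.1.1 * Q) i j := by
    intro i j
    have h1 : Continuous fun A : G => A.1.1 :=
      (Continuous.comp continuous_subtype_val continuous_subtype_val)
    have h2 : Continuous fun A : G => P * A.1.1 * Q :=
      (continuous_const.matrix_mul h1).matrix_mul continuous_const
    exact h2.matrix_elem i j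
  refine discreteTopology_of_isOpen_singleton_one ?_
  have : ({1} : Set G) = ⋂ i, ⋂ j, {A : G | ‖(P * A.1.1 * Q) i j - (P * (1 : SL4 K).1 * Q) i j‖ < 1} := by
    ext A
    simp only [Set.mem_singleton_iff, Set.mem_iInter, Set.mem_ofPred_eq]
    constructor
    · rintro rfl i j
      simp
    · intro hA
      have hE : P * A.1.1 * Q = P * (1 : SL4 K).1 * Q := by
        ext i j
        exact hS _ (hG _ A.2 i j) _ (hG _ G.one_mem i j) (hA i j)
      have : Q * (P * A.1.1 * Q) * P = Q * (P * (1 : SL4 K).1 * Q) * P := by rw [hE]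
      have key : ∀ B : Matrix (Fin 4) (Fin 4) K, Q * (P * B * Q) * P = B := fun B => by
        calc Q * (P * B * Q) * P = (Q * P) * B * (Q * P) := by simp only [mul_assoc]
          _ = B := by rw [h', one_mul, mul_one]
      rw [key, key] at this
      exact Subtype.ext (Subtype.ext this)
  rw [this]
  refine isOpen_iInter_of_finite fun i => isOpen_iInter_of_finite fun j => ?_
  exact isOpen_lt (((hcont i j).sub continuous_const).norm) continuous_const

/-! ### The reflection group of the regular ideal tetrahedron -/

/-- The Coxeter matrix of the regular ideal tetrahedron: all dihedral angles are `π / 3`. -/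
def tetMatrix : CoxeterMatrix (Fin 4) where
  M := Matrix.of fun i j => if i = j then 1 else 3
  isSymm := by decide
  diagonal := by decide
  off_diagonal := fun i j h => by simp [h]

/-- The Coxeter group generated by the reflections in the faces of the regular ideal
tetrahedron. -/
abbrev TetGroup : Type := tetMatrix.Group

/-- The Coxeter system of the regular ideal tetrahedron. -/
abbrev tetSystem : CoxeterSystem tetMatrix TetGroup := tetMatrix.toCoxeterSystem

/-- The reflection in the `i`-th face, in the basis of the vertices of the tetrahedron. -/
def faceReflection (i : Fin 4) : Matrix (Fin 4) (Fin 4) ℤ :=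
  Matrix.of fun k l => if l = i then (if k = i then -1 else 1) else if k = l then 1 else 0

lemma tetMatrix_self (i : Fin 4) : tetMatrix i i = 1 := tetMatrix.diagonal i

lemma tetMatrix_of_ne {i j : Fin 4} (h : i ≠ j) : tetMatrix i j = 3 := if_neg h

lemma faceReflection_liftable : tetMatrix.IsLiftable faceReflection := by
  intro i j
  by_cases h : i = j
  · subst h
    rw [tetMatrix_self, pow_one]
    revert i
    decide
  · rw [tetMatrix_of_ne h, pow_succ, pow_two]
    revert i j
    decide

/-- The linear representation of the reflection group of the regular ideal tetrahedron. -/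
def tetRep : TetGroup →* Matrix (Fin 4) (Fin 4) ℤ :=
  tetSystem.lift ⟨faceReflection, faceReflection_liftable⟩

lemma tetRep_simple (i : Fin 4) : tetRep (tetSystem.simple i) = faceReflection i :=
  tetSystem.lift_apply_simple faceReflection_liftable i

/-- The row `s` of `tetRep w` is the coordinate vector of the root `w⁻¹ α_s`. Here `α_t` changes
sign; for the other rows, in the next lemma, `α_s` becomes `α_s + α_t`, as in the geometric
representation with `m_st = 3`. -/
lemma tetRep_simple_mul_self (t : Fin 4) (w : TetGroup) (k : Fin 4) :
    tetRep (tetSystem.simple t * w) t k = -tetRep w t k := by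
  rw [map_mul, tetRep_simple, mul_apply]
  fin_cases t <;> simp [faceReflection, Fin.sum_univ_four]

lemma tetRep_simple_mul_of_ne {s t : Fin 4} (h : s ≠ t) (w : TetGroup) (k : Fin 4) :
    tetRep (tetSystem.simple t * w) s k = tetRep w s k + tetRep w t k := by
  rw [map_mul, tetRep_simple, mul_apply]
  fin_cases s <;> fin_cases t <;> first | exact absurd rfl h | skip
  all_goals simp [faceReflection, Fin.sum_univ_four]
  all_goals ring

lemma tet_braid {s t : Fin 4} (h : s ≠ t) :
    tetSystem.simple s * tetSystem.simple t * tetSystem.simple s =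
      tetSystem.simple t * tetSystem.simple s * tetSystem.simple t := by
  have h3 := tetSystem.simple_mul_simple_pow s t
  rw [tetMatrix_of_ne h, pow_succ, pow_two] at h3
  have hs := tetSystem.inv_simple s
  have ht := tetSystem.inv_simple t
  calc _ = (tetSystem.simple t * tetSystem.simple s * tetSystem.simple t)⁻¹ := by
        rw [eq_inv_iff_mul_eq_one, ← h3]
        simp only [mul_assoc]
    _ = _ := by rw [_root_.mul_inv_rev, _root_.mul_inv_rev, hs, ht, mul_assoc]

/-- A root is positive as soon as the corresponding reflection is not a descent. -/
lemma tetRep_nonneg (n : ℕ) : ∀ w : TetGroup, tetSystem.length w = n →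
    ∀ s, ¬tetSystem.IsLeftDescent w s → ∀ k, 0 ≤ tetRep w s k := by
  induction n using Nat.strong_induction_on with
  | _ n ih =>
    intro w hw s hs k
    by_cases h1 : w = 1
    · subst h1
      rw [map_one, one_apply]
      split_ifs <;> norm_num
    obtain ⟨t, ht⟩ := tetSystem.exists_leftDescent_of_ne_one h1
    have hst : s ≠ t := fun h => hs (h ▸ ht)
    have hw' : w = tetSystem.simple t * (tetSystem.simple t * w) :=
      (tetSystem.simple_mul_simple_cancel_left _).symm
    have hl' : tetSystem.length (tetSystem.simple t * w) + 1 = n :=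
      hw ▸ tetSystem.isLeftDescent_iff.mp ht
    have hd' : ¬tetSystem.IsLeftDescent (tetSystem.simple t * w) t :=
      tetSystem.isLeftDescent_iff_not_isLeftDescent_mul.mp ht
    generalize tetSystem.simple t * w = v at *
    have hn : 0 ≤ tetRep v t k := ih _ (by omega) v rfl t hd' k
    -- If `s` is a descent of `v`, then `w = t s x`, and the two row formulas collapse the row `s`
    -- of `w` to the row `t` of `x`. Induction applies once `t` is known not to be a descent of `x`.
    by_cases hvs : tetSystem.IsLeftDescent v s
    · have hv' : v = tetSystem.simple s * (tetSystem.simple s * v) :=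
      (tetSystem.simple_mul_simple_cancel_left _).symm
      have hl'' := tetSystem.isLeftDescent_iff.mp hvs
      generalize tetSystem.simple s * v = x at *
      have hxt : ¬tetSystem.IsLeftDescent x t := by
        intro hx
        have hx' : x = tetSystem.simple t * (tetSystem.simple t * x) :=
      (tetSystem.simple_mul_simple_cancel_left _).symm
        have hlx := tetSystem.isLeftDescent_iff.mp hx
        generalize tetSystem.simple t * x = y at *
        -- If `x = t y`, the braid relation turns `w = t s t y` into `s t s y`, so `s w = t s y` has
        -- length at most that of `y` plus two, less than the length of `w`. This contradicts `hs`.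
        have : tetSystem.simple s * w = tetSystem.simple t * (tetSystem.simple s * y) := by
          rw [hw', hv', hx']
          have hb := tet_braid hst
          calc _ = tetSystem.simple s * (tetSystem.simple t * tetSystem.simple s *
                tetSystem.simple t) * y := by simp only [mul_assoc]
            _ = _ := by
              rw [← hb]
              simp only [← mul_assoc, tetSystem.simple_mul_simple_self, one_mul]
        have h2 := tetSystem.not_isLeftDescent_iff.mp hs
        rw [this] at h2
        have h3 := tetSystem.length_mul_le (tetSystem.simple t) (tetSystem.simple s * y)
        have h4 := tetSystem.length_mul_le (tetSystem.simple s) y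
        rw [tetSystem.length_simple] at h3 h4
        omega
      have := ih _ (by omega) x rfl t hxt k
      rw [hw', tetRep_simple_mul_of_ne hst, hv', tetRep_simple_mul_self,
        tetRep_simple_mul_of_ne hst.symm]
      linarith
    · rw [hw', tetRep_simple_mul_of_ne hst]
      exact add_nonneg (ih _ (by omega) v rfl s hvs k) hn

/-- An element of the reflection group which permutes the vertices of the tetrahedron is
trivial. -/
lemma eq_one_of_tetRep_eq_perm (w : TetGroup) (σ : Equiv.Perm (Fin 4))
    (h : ∀ k i, tetRep w k i = if k = σ i then 1 else 0) : w = 1 := by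
  by_contra h1
  obtain ⟨t, ht⟩ := tetSystem.exists_leftDescent_of_ne_one h1
  have hd := tetSystem.isLeftDescent_iff_not_isLeftDescent_mul.mp ht
  -- Since `t` is a descent, the row `t` of `w` is the negative of a nonnegative row; a permutation
  -- matrix has an entry 1 there.
  have hn := tetRep_nonneg _ _ rfl t hd (σ.symm t)
  have hw' : w = tetSystem.simple t * (tetSystem.simple t * w) :=
      (tetSystem.simple_mul_simple_cancel_left _).symm
  have := h t (σ.symm t)
  rw [hw', tetRep_simple_mul_self] at this
  simp only [Equiv.apply_symm_apply, if_true] at this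
  linarith

/-! ### The tessellation by regular ideal tetrahedra -/

/-- The element of the knot group leading from the `j`-th base tetrahedron across its face `f`. -/
def faceElt : Fin 2 → Fin 4 → KnotGroup :=
  ![![genN * genM * genN⁻¹, genM, 1, genM * genN⁻¹],
    ![genN * genM⁻¹, genN * genM⁻¹ * genN⁻¹, 1, genM⁻¹]]

/-- The identification of the vertices across the face `f` of the `j`-th base tetrahedron. -/
def facePerm : Fin 2 → Fin 4 → Equiv.Perm (Fin 4) :=
  ![![⟨![1, 2, 0, 3], ![2, 0, 1, 3], by decide, by decide⟩,
      ⟨![0, 3, 1, 2], ![0, 2, 3, 1], by decide, by decide⟩,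
      1,
      ⟨![3, 2, 1, 0], ![3, 2, 1, 0], by decide, by decide⟩],
    ![⟨![3, 2, 1, 0], ![3, 2, 1, 0], by decide, by decide⟩,
      ⟨![2, 0, 1, 3], ![1, 2, 0, 3], by decide, by decide⟩,
      1,
      ⟨![0, 2, 3, 1], ![0, 3, 1, 2], by decide, by decide⟩]]

/-- The tetrahedra of the tessellation, with a labelling of their vertices. -/
abbrev Cell : Type := KnotGroup × Fin 2 × Equiv.Perm (Fin 4)

/-- Crossing the face opposite to the vertex labelled `i`. -/
def cross (i : Fin 4) (y : Cell) : Cell :=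
  (y.1 * faceElt y.2.1 (y.2.2 i), y.2.1 + 1, facePerm y.2.1 (y.2.2 i) * y.2.2)

lemma faceElt_mul_faceElt (j : Fin 2) (f : Fin 4) :
    faceElt j f * faceElt (j + 1) (facePerm j f f) = 1 := by
  fin_cases j <;> fin_cases f <;> simp [faceElt, facePerm, mul_assoc]

lemma facePerm_mul_facePerm (j : Fin 2) (f : Fin 4) :
    facePerm (j + 1) (facePerm j f f) * facePerm j f = 1 := by
  revert j f
  decide

lemma cross_cross (i : Fin 4) (y : Cell) : cross i (cross i y) = y := by
  obtain ⟨γ, j, σ⟩ := y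
  refine Prod.ext ?_ (Prod.ext ?_ ?_)
  · simp only [cross, Equiv.Perm.mul_apply]
    rw [mul_assoc, faceElt_mul_faceElt, mul_one]
  · change j + 1 + 1 = j
    revert j
    decide
  · simp only [cross, Equiv.Perm.mul_apply]
    rw [← mul_assoc, facePerm_mul_facePerm, one_mul]

/-- Two crossings around an edge, in terms of the local labels of the faces. -/
def edgeElt (j : Fin 2) (f f' : Fin 4) : KnotGroup :=
  faceElt j f * faceElt (j + 1) (facePerm j f f')

/-- The relabelling along two crossings around an edge. -/
def edgePerm (j : Fin 2) (f f' : Fin 4) : Equiv.Perm (Fin 4) :=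
  facePerm (j + 1) (facePerm j f f') * facePerm j f

lemma edgePerm_cycle (j : Fin 2) (f f' : Fin 4) (h : f ≠ f') (p q r : Equiv.Perm (Fin 4))
    (hp : p = edgePerm j f f') (hq : q = edgePerm j (p f) (p f'))
    (hr : r = edgePerm j (q (p f)) (q (p f'))) : r * q * p = 1 := by
  subst hp hq hr
  revert j f f'
  decide

lemma mul_rotate_ten {G : Type*} [Group G] {a b c d e f g h i j : G}
    (H : a * (b * (c * (d * (e * (f * (g * (h * (i * j)))))))) = 1) :
    b * (c * (d * (e * (f * (g * (h * (i * (j * a)))))))) = 1 := by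
  have := eq_inv_of_mul_eq_one_right H
  calc _ = (b * (c * (d * (e * (f * (g * (h * (i * j)))))))) * a := by simp only [mul_assoc]
    _ = 1 := by rw [this, inv_mul_cancel]

/-- Six tetrahedra with dihedral angle `π / 3` fit around each edge, and the circuit spells the knot
relator. Up to free cancellation, the products obtained are the ten cyclic rotations of the relator
(`r0` to `r9`) and of its inverse (`s0` to `s9`). -/
lemma edgeElt_cycle (j : Fin 2) (f f' : Fin 4) (h : f ≠ f') (p q : Equiv.Perm (Fin 4))
    (hp : p = edgePerm j f f') (hq : q = edgePerm j (p f) (p f')) :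
    edgeElt j f f' * edgeElt j (p f) (p f') * edgeElt j (q (p f)) (q (p f')) = 1 := by
  subst hp hq
  have r0 := mul_inv_eq_one.mpr genM_mul_word
  have s0 := mul_inv_eq_one.mpr genM_mul_word.symm
  simp only [wordAt, _root_.mul_inv_rev, inv_inv, mul_assoc] at r0 s0
  have r1 := mul_rotate_ten r0
  have r2 := mul_rotate_ten r1
  have r3 := mul_rotate_ten r2
  have r4 := mul_rotate_ten r3
  have r5 := mul_rotate_ten r4
  have r6 := mul_rotate_ten r5
  have r7 := mul_rotate_ten r6
  have r8 := mul_rotate_ten r7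
  have r9 := mul_rotate_ten r8
  have s1 := mul_rotate_ten s0
  have s2 := mul_rotate_ten s1
  have s3 := mul_rotate_ten s2
  have s4 := mul_rotate_ten s3
  have s5 := mul_rotate_ten s4
  have s6 := mul_rotate_ten s5
  have s7 := mul_rotate_ten s6
  have s8 := mul_rotate_ten s7
  have s9 := mul_rotate_ten s8
  fin_cases j <;> fin_cases f <;> fin_cases f' <;> first | exact absurd rfl h | skip
  all_goals simp [edgeElt, edgePerm, facePerm, faceElt, mul_assoc]
  all_goals assumption

/-- Two crossings around an edge. -/
lemma cross_cross_eq (i k : Fin 4) (γ : KnotGroup) (j : Fin 2) (σ : Equiv.Perm (Fin 4)) :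
    cross k (cross i (γ, j, σ)) =
      (γ * edgeElt j (σ i) (σ k), j, edgePerm j (σ i) (σ k) * σ) := by
  refine Prod.ext ?_ (Prod.ext ?_ ?_)
  · simp only [cross, edgeElt, Equiv.Perm.mul_apply, mul_assoc]
  · change j + 1 + 1 = j
    revert j
    decide
  · simp only [cross, edgePerm, Equiv.Perm.mul_apply, mul_assoc]

lemma cross_cycle (i k : Fin 4) (h : i ≠ k) (y : Cell) :
    cross k (cross i (cross k (cross i (cross k (cross i y))))) = y := by
  obtain ⟨γ, j, σ⟩ := y
  simp only [cross_cross_eq, Equiv.Perm.mul_apply]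
  have hf : σ i ≠ σ k := fun e => h (σ.injective e)
  refine Prod.ext ?_ (Prod.ext rfl ?_)
  · simp only
    rw [mul_assoc, mul_assoc, ← mul_assoc (edgeElt _ _ _),
      edgeElt_cycle j _ _ hf _ _ rfl rfl, mul_one]
  · simp only
    rw [← mul_assoc, ← mul_assoc, edgePerm_cycle j _ _ hf _ _ _ rfl rfl rfl, one_mul]

/-- The instructions "cross the face labelled `i`" are read from the moving cell, so words act from
the right; hence the opposite monoid. The two cases are the involution and edge conditions of the
Coxeter presentation. -/
lemma cross_liftable :
    tetMatrix.IsLiftable (fun i => (MulOpposite.op (cross i) : (Function.End Cell)ᵐᵒᵖ)) := by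
  intro i k
  by_cases h : i = k
  · subst h
    rw [tetMatrix_self, pow_one]
    apply MulOpposite.unop_injective
    funext y
    exact cross_cross i y
  · rw [tetMatrix_of_ne h, pow_succ, pow_two]
    apply MulOpposite.unop_injective
    funext y
    exact cross_cycle i k h y

/-- The right action of the reflection group on the cells. -/
def cellAction : TetGroup →* (Function.End Cell)ᵐᵒᵖ := tetSystem.lift ⟨_, cross_liftable⟩

lemma cellAction_simple (i : Fin 4) (y : Cell) :
    (cellAction (tetSystem.simple i)).unop y = cross i y := by
  rw [cellAction, tetSystem.lift_apply_simple cross_liftable i]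
  rfl

lemma cellAction_one (y : Cell) : (cellAction 1).unop y = y := by
  rw [map_one]
  rfl

lemma cellAction_mul (w v : TetGroup) (y : Cell) :
    (cellAction (w * v)).unop y = (cellAction v).unop ((cellAction w).unop y) := by
  rw [map_mul]
  rfl

/-- The vertices of the two base tetrahedra, as the columns of a matrix. -/
def baseVertices : Fin 2 → Matrix (Fin 4) (Fin 4) ℤ :=
  ![!![1, 0, 1, 1; 0, 0, 1, 2; 0, 0, 2, 1; 0, 1, 1, 1],
    !![1, 0, 1, 1; 0, 0, 1, 2; 0, 0, -1, 1; 0, 1, 1, 1]]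

/-- This finite check ties the combinatorics to the geometry: the mirror image of a base tetrahedron
in a face is the translate of the other one by the face element, with its vertices relabelled. -/
lemma base_reflection (j : Fin 2) (f : Fin 4) :
    baseVertices j * faceReflection f =
      (intRep (1 : ℤˣ) (faceElt j f)).1 * (baseVertices (j + 1)).submatrix id (facePerm j f) := by
  fin_cases j <;> fin_cases f <;>
    simp only [faceElt, map_mul, map_inv, map_one, intRep_genM, intRep_genN,
      Matrix.SpecialLinearGroup.coe_mul,
      Matrix.SpecialLinearGroup.coe_one, Fin.mk_zero, Fin.mk_one, Fin.reduceFinMk, intM, intN,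
      cons_val, cons_val_zero, cons_val_one] <;>
    decide

/-- The vertices of a cell. -/
def cellVertices (y : Cell) : Matrix (Fin 4) (Fin 4) ℤ :=
  (intRep (1 : ℤˣ) y.1).1 * (baseVertices y.2.1).submatrix id y.2.2

lemma cellVertices_cross (i : Fin 4) (y : Cell) :
    cellVertices (cross i y) = cellVertices y * faceReflection i := by
  obtain ⟨γ, j, σ⟩ := y
  have h1 : faceReflection i = (faceReflection (σ i)).submatrix σ σ := by
    ext a b
    simp [faceReflection]
  have h2 : (baseVertices j).submatrix id σ * faceReflection i =
      (baseVertices j * faceReflection (σ i)).submatrix id σ := by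
    rw [h1, ← submatrix_mul_equiv _ _ id σ σ]
  simp only [cellVertices, cross, map_mul, Matrix.SpecialLinearGroup.coe_mul]
  rw [mul_assoc, mul_assoc, h2, base_reflection]
  congr 1

lemma cellVertices_action (w : TetGroup) (y : Cell) :
    cellVertices ((cellAction w).unop y) = cellVertices y * tetRep w := by
  induction w using tetSystem.simple_induction_right generalizing y with
  | one => rw [cellAction_one, map_one, mul_one]
  | mul_simple_right w i ih =>
    rw [cellAction_mul, cellAction_simple, cellVertices_cross, ih, map_mul, tetRep_simple,
      mul_assoc]

/-- `γ` is reached by paths of cells. -/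
def Reachable (γ : KnotGroup) : Prop :=
  ∀ δ σ, ∃ (w : TetGroup) (τ : Equiv.Perm (Fin 4)),
    (cellAction w).unop (δ, 0, σ) = (δ * γ, 0, τ)

lemma Reachable.mul {a b : KnotGroup} (ha : Reachable a) (hb : Reachable b) :
    Reachable (a * b) := by
  intro δ σ
  obtain ⟨w, τ, h⟩ := ha δ σ
  obtain ⟨w', τ', h'⟩ := hb (δ * a) τ
  exact ⟨w * w', τ', by rw [cellAction_mul, h, h', mul_assoc]⟩

lemma reachable_faces (f f' : Fin 4) : Reachable (faceElt 0 f * faceElt 1 f') := by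
  intro δ σ
  refine ⟨tetSystem.simple (σ.symm f) *
    tetSystem.simple ((facePerm 0 f * σ).symm f'), facePerm 1 f' * (facePerm 0 f * σ), ?_⟩
  rw [cellAction_mul, cellAction_simple, cellAction_simple]
  simp only [cross, Equiv.apply_symm_apply, zero_add, mul_assoc]
  rfl

lemma reachable_all (γ : KnotGroup) : Reachable γ := by
  have hm : Reachable genM := by simpa [faceElt] using reachable_faces 1 2
  have hm' : Reachable genM⁻¹ := by simpa [faceElt] using reachable_faces 2 3
  have hn : Reachable genN := by
    have h : Reachable (genN * genM⁻¹) := by simpa [faceElt] using reachable_faces 2 0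
    simpa using h.mul hm
  have hn' : Reachable genN⁻¹ := by
    have h : Reachable (genM * genN⁻¹) := by simpa [faceElt] using reachable_faces 3 2
    simpa using hm'.mul h
  let S : Subgroup KnotGroup :=
    { carrier := {γ | Reachable γ ∧ Reachable γ⁻¹}
      one_mem' := by
        have : Reachable 1 := fun δ σ => ⟨1, σ, by rw [cellAction_one, mul_one]⟩
        exact ⟨this, by simpa using this⟩
      mul_mem' := fun ha hb => ⟨ha.1.mul hb.1, by
        rw [_root_.mul_inv_rev]
        exact hb.2.mul ha.2⟩
      inv_mem' := fun ha => ⟨ha.2, by simpa using ha.1⟩ }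
  exact (subgroup_eq_top S ⟨hm, hm'⟩ ⟨hn, hn'⟩ γ).1

/-- The representation of the figure-eight knot group with parameter `u = 1` is faithful. -/
theorem intRep_one_injective : Function.Injective (intRep (1 : ℤˣ)) := by
  rw [injective_iff_map_eq_one]
  intro γ hγ
  obtain ⟨w, τ, h⟩ := reachable_all γ 1 1
  rw [one_mul] at h
  have hD := cellVertices_action w (1, 0, 1)
  rw [h] at hD
  simp only [cellVertices, hγ, map_one, Matrix.SpecialLinearGroup.coe_one, one_mul] at hD
  -- The vertex matrix is not invertible over `ℤ`, so it is cancelled over `ℚ`.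
  have hinv : ∃ Q : Matrix (Fin 4) (Fin 4) ℚ,
      Q * (baseVertices 0).map (Int.castRingHom ℚ) = 1 := by
    refine ⟨!![1, -1 / 3, -1 / 3, 0; 0, -1 / 3, -1 / 3, 1; 0, -1 / 3, 2 / 3, 0;
      0, 2 / 3, -1 / 3, 0], ?_⟩
    ext i j
    fin_cases i <;> fin_cases j <;>
      simp [baseVertices, mul_apply, Fin.sum_univ_four] <;> norm_num
  have hτ : (baseVertices 0).submatrix id τ =
      baseVertices 0 * (Matrix.of fun k i => if k = τ i then 1 else 0) := by
    ext a b
    simp [mul_apply]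
  have hone : (baseVertices 0).submatrix id (1 : Equiv.Perm (Fin 4)) = baseVertices 0 := rfl
  rw [hτ, hone] at hD
  obtain ⟨Q, hQ⟩ := hinv
  have hcancel : (Matrix.of fun k i => if k = τ i then (1 : ℤ) else 0) = tetRep w := by
    have h2 := congrArg (fun X => Q * X.map (Int.castRingHom ℚ)) hD
    simp only [Matrix.map_mul, ← mul_assoc, hQ, one_mul] at h2
    exact Matrix.map_injective (RingHom.injective_int (Int.castRingHom ℚ)) h2
  -- The path from the base cell to its translate by `γ` has as its matrix a mere permutation of the
  -- vertices. It is thus the trivial path, and the two cells coincide, including their group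
  -- component.
  have hw : w = 1 := eq_one_of_tetRep_eq_perm w τ fun k i => by rw [← hcancel]; rfl
  rw [hw, cellAction_one] at h
  exact (congrArg Prod.fst h).symm

/-! ### The figure-eight knot group is torsion-free -/

/-- The free group of rank two, the fundamental group of the fibre of the knot complement. -/
abbrev FiberGroup : Type := FreeGroup (Fin 2)

/-- The endomorphism of the free group with given values on the generators. -/
def fiberHom {G : Type} [Group G] (a b : G) : FiberGroup →* G := FreeGroup.lift ![a, b]

@[simp] lemma fiberHom_zero {G : Type} [Group G] (a b : G) :
    fiberHom a b (FreeGroup.of 0) = a := by simp [fiberHom]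

@[simp] lemma fiberHom_one {G : Type} [Group G] (a b : G) :
    fiberHom a b (FreeGroup.of 1) = b := by simp [fiberHom]

lemma fiberHom_ext {G : Type} [Group G] {f g : FiberGroup →* G}
    (h0 : f (FreeGroup.of 0) = g (FreeGroup.of 0))
    (h1 : f (FreeGroup.of 1) = g (FreeGroup.of 1)) : f = g := by
  ext i
  fin_cases i
  · exact h0
  · exact h1

/-- The monodromy of the fibration of the figure-eight knot complement. -/
def monodromy : MulAut FiberGroup :=
  MonoidHom.toMulEquiv
    (fiberHom (FreeGroup.of 1)
      (FreeGroup.of 1 * (FreeGroup.of 0)⁻¹ * FreeGroup.of 1 * FreeGroup.of 1))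
    (fiberHom (FreeGroup.of 0 * FreeGroup.of 0 * (FreeGroup.of 1)⁻¹ * FreeGroup.of 0)
      (FreeGroup.of 0))
    (by
      apply fiberHom_ext <;> simp [mul_assoc])
    (by
      apply fiberHom_ext <;> simp [mul_assoc])

lemma monodromy_zero : monodromy (FreeGroup.of 0) = FreeGroup.of 1 := by
  rw [monodromy, MonoidHom.toMulEquiv_apply]
  exact fiberHom_zero _ _

lemma monodromy_one : monodromy (FreeGroup.of 1) =
    FreeGroup.of 1 * (FreeGroup.of 0)⁻¹ * FreeGroup.of 1 * FreeGroup.of 1 := by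
  rw [monodromy, MonoidHom.toMulEquiv_apply]
  exact fiberHom_one _ _

/-- The mapping torus of the monodromy. -/
abbrev MappingTorus : Type := FiberGroup ⋊[zpowersHom (MulAut FiberGroup) monodromy]
  Multiplicative ℤ

/-- The generator of the base of the mapping torus. -/
def torusBase : MappingTorus := SemidirectProduct.inr (Multiplicative.ofAdd 1)

/-- The inclusion of the fibre. -/
def torusFiber (x : FiberGroup) : MappingTorus := SemidirectProduct.inl x

lemma torusBase_conj (x : FiberGroup) :
    torusBase * torusFiber x = torusFiber (monodromy x) * torusBase := by
  have := SemidirectProduct.inl_aut (φ := zpowersHom (MulAut FiberGroup) monodromy)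
    (Multiplicative.ofAdd 1) x
  rw [zpowersHom_apply, toAdd_ofAdd, zpow_one, map_inv] at this
  rw [torusFiber, torusFiber, this, torusBase]
  group

/-- With `t` the base generator, `m = t` and `n = b t`, both sides reduce to `b a⁻¹ b t`: the knot
relation is the monodromy formula for the second fibre generator. -/
lemma torus_relation : torusBase * wordAt torusBase (torusFiber (FreeGroup.of 1) * torusBase) =
    wordAt torusBase (torusFiber (FreeGroup.of 1) * torusBase) *
      (torusFiber (FreeGroup.of 1) * torusBase) := by
  have h0 := torusBase_conj (FreeGroup.of 0)
  have h1 := torusBase_conj (FreeGroup.of 1)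
  have e : ∀ x y, torusFiber (x * y) = torusFiber x * torusFiber y := fun x y => map_mul _ x y
  have e' : ∀ x, torusFiber x⁻¹ = (torusFiber x)⁻¹ := fun x => map_inv _ x
  rw [monodromy_zero] at h0
  rw [monodromy_one] at h1
  simp only [e, e'] at h1
  generalize torusFiber (FreeGroup.of 0) = a at *
  generalize torusFiber (FreeGroup.of 1) = b at *
  generalize torusBase = t at *
  have hb : b = t * a * t⁻¹ := eq_mul_inv_of_mul_eq h0.symm
  have h2 : t * b * t⁻¹ = b * a⁻¹ * b * b := mul_inv_eq_of_eq_mul h1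
  have hL : t * wordAt t (b * t) = (t * b * t⁻¹) * b⁻¹ * t := by
    simp only [wordAt]
    group
  have hR : wordAt t (b * t) * (b * t) = b * (t⁻¹ * b * t)⁻¹ * b * t := by
    simp only [wordAt]
    group
  have ha : t⁻¹ * b * t = a := by
    rw [hb]
    group
  rw [hL, hR, ha, h2]
  group

/-- The homomorphism from the knot group to the mapping torus. -/
def toTorus : KnotGroup →* MappingTorus := liftHom _ _ torus_relation

/-- The knot relation in fibred form: with `a = m⁻¹ n` and `b = n m⁻¹`, conjugation by `m` sends `b`
to `b a⁻¹ b b`, while it sends `a` to `b` automatically. -/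
lemma word_conj : genM * (genN * genM⁻¹) * genM⁻¹ =
    (genN * genM⁻¹) * (genM⁻¹ * genN)⁻¹ * (genN * genM⁻¹) * (genN * genM⁻¹) := by
  have h := genM_mul_word
  simp only [wordAt] at h
  calc genM * (genN * genM⁻¹) * genM⁻¹
      = genM * (genN * genM⁻¹ * genN⁻¹ * genM) * genM⁻¹ * genN * genM⁻¹ := by group
    _ = _ := by
      rw [h]
      group

/-- The homomorphism from the mapping torus to the knot group. -/
def ofTorus : MappingTorus →* KnotGroup :=
  SemidirectProduct.lift (fiberHom (genM⁻¹ * genN) (genN * genM⁻¹)) (zpowersHom _ genM) (by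
    have key : (fiberHom (genM⁻¹ * genN) (genN * genM⁻¹)).comp monodromy.toMonoidHom =
        (MulAut.conj genM).toMonoidHom.comp (fiberHom (genM⁻¹ * genN) (genN * genM⁻¹)) := by
      apply fiberHom_ext
      · simp only [MonoidHom.comp_apply, MulEquiv.toMonoidHom_eq_coe, MonoidHom.coe_coe,
          monodromy_zero, fiberHom_zero, fiberHom_one, MulAut.conj_apply]
        group
      · simp only [MonoidHom.comp_apply, MulEquiv.toMonoidHom_eq_coe, MonoidHom.coe_coe,
          monodromy_one, fiberHom_zero, fiberHom_one, MulAut.conj_apply, map_mul, map_inv]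
        rw [← word_conj]
        group
    have key' : ∀ x, fiberHom (genM⁻¹ * genN) (genN * genM⁻¹) (monodromy x) =
        genM * fiberHom (genM⁻¹ * genN) (genN * genM⁻¹) x * genM⁻¹ :=
      fun x => DFunLike.congr_fun key x
    have key'' : ∀ k : ℤ, ∀ x, fiberHom (genM⁻¹ * genN) (genN * genM⁻¹) ((monodromy ^ k) x) =
        genM ^ k * fiberHom (genM⁻¹ * genN) (genN * genM⁻¹) x * (genM ^ k)⁻¹ := by
      intro k
      induction k using Int.induction_on with
      | zero => simp
      | succ k ih =>
        intro x
        rw [_root_.zpow_add_one, MulAut.mul_apply, ih, key', _root_.zpow_add_one]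
        group
      | pred k ih =>
        intro x
        have h := key' (monodromy⁻¹ x)
        rw [MulAut.apply_inv_self] at h
        rw [_root_.zpow_sub_one, MulAut.mul_apply, ih, _root_.zpow_sub_one, h]
        group
    intro k
    ext x
    simp only [MonoidHom.comp_apply, MulEquiv.toMonoidHom_eq_coe, MonoidHom.coe_coe,
      zpowersHom_apply, MulAut.conj_apply]
    exact key'' _ _)

/-- This half of the isomorphism suffices: it embeds the knot group in the mapping torus, and
torsion-freeness passes to subgroups. -/
lemma ofTorus_toTorus (γ : KnotGroup) : ofTorus (toTorus γ) = γ := by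
  have : ofTorus.comp toTorus = MonoidHom.id KnotGroup := by
    apply knotGroup_hom_ext <;>
      simp [ofTorus, toTorus, torusBase, torusFiber]
  exact DFunLike.congr_fun this γ

/-- A torsion element dies in the quotient `ℤ`, hence lies in the fibre, which is free and so
torsion-free. -/
lemma torus_torsionFree (x : MappingTorus) (k : ℕ) (hk : k ≠ 0) (h : x ^ k = 1) : x = 1 := by
  have hr : x.right = 1 := by
    have : SemidirectProduct.rightHom x ^ k = 1 := by rw [← map_pow, h, map_one]
    exact (pow_eq_one_iff_left hk).mp this
  have hx : x = SemidirectProduct.inl x.left := by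
    ext
    · simp
    · simp [hr]
  rw [hx, ← map_pow] at h
  have := SemidirectProduct.inl_injective (h.trans (map_one _).symm)
  rw [hx, (pow_eq_one_iff_left hk).mp this, map_one]

/-- The figure-eight knot group is torsion-free. -/
theorem knotGroup_torsionFree (γ : KnotGroup) (k : ℕ) (hk : k ≠ 0) (h : γ ^ k = 1) : γ = 1 := by
  have := torus_torsionFree (toTorus γ) k hk (by rw [← map_pow, h, map_one])
  rw [← ofTorus_toTorus γ, this, map_one]

/-! ### Imaginary quadratic rings generated by a root of unity -/

/-- The ring `ℤ[τ]`, where `τ` is a root of `X² + c X + 1`. -/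
def quadRing (τ : ℂ) (c : ℤ) (h : τ * τ = -(c : ℂ) * τ - 1) : Subring ℂ where
  carrier := {z | ∃ a b : ℤ, z = a + b * τ}
  one_mem' := ⟨1, 0, by simp⟩
  zero_mem' := ⟨0, 0, by simp⟩
  add_mem' := by
    rintro _ _ ⟨a, b, rfl⟩ ⟨a', b', rfl⟩
    exact ⟨a + a', b + b', by push_cast; ring⟩
  neg_mem' := by
    rintro _ ⟨a, b, rfl⟩
    exact ⟨-a, -b, by push_cast; ring⟩
  mul_mem' := by
    rintro _ _ ⟨a, b, rfl⟩ ⟨a', b', rfl⟩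
    exact ⟨a * a' - b * b', a * b' + b * a' - c * b * b', by
      push_cast
      linear_combination (b : ℂ) * b' * h⟩

section
variable {τ : ℂ} {c : ℤ} {h : τ * τ = -(c : ℂ) * τ - 1}

lemma self_mem_quadRing : τ ∈ quadRing τ c h := ⟨0, 1, by simp⟩

lemma conj_mem_quadRing (hc : star τ = -(c : ℂ) - τ) {z : ℂ} (hz : z ∈ quadRing τ c h) :
    star z ∈ quadRing τ c h := by
  obtain ⟨a, b, rfl⟩ := hz
  exact ⟨a - b * c, -b, by simp only [star_add, star_mul', star_intCast, hc]; push_cast; ring⟩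

/-- The conjugate of `τ` is the other root of `X² + c X + 1`, so the squared modulus of `a + b τ` is
the integral form `a² - c a b + b²`. Its integrality drives discreteness, the height bound and the
Euclidean descent. -/
lemma normSq_quadRing (hc : star τ = -(c : ℂ) - τ) {z : ℂ} (hz : z ∈ quadRing τ c h) :
    ∃ k : ℕ, ‖z‖ ^ 2 = k := by
  obtain ⟨a, b, rfl⟩ := hz
  have h1 : ((‖(a + b * τ : ℂ)‖ ^ 2 : ℝ) : ℂ) = ((a ^ 2 - c * a * b + b ^ 2 : ℤ) : ℂ) := by
    rw [Complex.ofReal_pow, ← Complex.mul_conj']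
    change _ * star (a + b * τ : ℂ) = _
    simp only [star_add, star_mul', star_intCast, hc]
    push_cast
    linear_combination -(b : ℂ) ^ 2 * h
  have h2 : ‖(a + b * τ : ℂ)‖ ^ 2 = ((a ^ 2 - c * a * b + b ^ 2 : ℤ) : ℝ) := by
    exact_mod_cast h1
  have h3 : 0 ≤ a ^ 2 - c * a * b + b ^ 2 := by
    have : (0 : ℝ) ≤ ((a ^ 2 - c * a * b + b ^ 2 : ℤ) : ℝ) := h2 ▸ sq_nonneg _
    exact_mod_cast this
  refine ⟨(a ^ 2 - c * a * b + b ^ 2).toNat, h2.trans ?_⟩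
  rw [← Int.cast_natCast, Int.toNat_of_nonneg h3]

lemma one_le_norm_quadRing (hc : star τ = -(c : ℂ) - τ) {z : ℂ} (hz : z ∈ quadRing τ c h)
    (h0 : z ≠ 0) : 1 ≤ ‖z‖ := by
  obtain ⟨k, hk⟩ := normSq_quadRing hc hz
  have hpos : 0 < ‖z‖ ^ 2 := by positivity
  rw [hk] at hpos
  have : (1 : ℝ) ≤ k := by exact_mod_cast (Nat.cast_pos.mp hpos)
  rw [← hk] at this
  exact (one_le_sq_iff₀ (norm_nonneg z)).mp this

end

/-! ### The Eisenstein integers -/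

/-- The primitive cube root of unity `e^{2πi/3}`. -/
def omega : ℂ := ⟨-1 / 2, √3 / 2⟩

lemma omega_sq : omega * omega = -((1 : ℤ) : ℂ) * omega - 1 := by
  have h3 : √3 * √3 = 3 := Real.mul_self_sqrt (by norm_num)
  apply Complex.ext
  · simp [omega]
    nlinarith
  · simp [omega]
    ring

lemma star_omega : star omega = -((1 : ℤ) : ℂ) - omega := by
  apply Complex.ext
  · simp [omega]
    norm_num
  · simp [omega]

/-- The ring of Eisenstein integers. -/
abbrev eisenstein : Subring ℂ := quadRing omega 1 omega_sq

lemma omega_mul_self : omega * omega = -omega - 1 := by simpa using omega_sq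

lemma star_omega' : star omega = -1 - omega := by simpa using star_omega

lemma conj_omega : (starRingEnd ℂ) omega = -1 - omega := star_omega'

lemma norm_omega : ‖omega‖ = 1 := by
  have : ((‖omega‖ ^ 2 : ℝ) : ℂ) = 1 := by
    rw [Complex.ofReal_pow, ← Complex.mul_conj', conj_omega]
    linear_combination -omega_mul_self
  have h : ‖omega‖ ^ 2 = 1 := by exact_mod_cast this
  exact (pow_eq_one_iff_of_nonneg (norm_nonneg _) two_ne_zero).mp h

lemma norm_one_add_omega : ‖1 + omega‖ = 1 := by
  have : 1 + omega = -star omega := by rw [star_omega']; ring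
  rw [this, norm_neg, norm_star, norm_omega]

/-- Every complex number is at distance less than one from an Eisenstein integer. -/
lemma exists_eisenstein_near (z : ℂ) :
    ∃ x y : ℤ, ‖z - (x + y * omega)‖ ^ 2 ≤ 7 / 16 := by
  have h3 : √3 * √3 = 3 := Real.mul_self_sqrt (by norm_num)
  have h3pos : 0 < √3 := Real.sqrt_pos.mpr (by norm_num)
  -- Rounding first the `ω`-coordinate and then the real part leaves an error of at most `(1/2)² +
  -- (3/4)(1/2)² = 7/16`.
  set y : ℤ := round (2 * z.im / √3) with hy
  set x : ℤ := round (z.re + y / 2) with hx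
  refine ⟨x, y, ?_⟩
  have h1 : |2 * z.im / √3 - y| ≤ 1 / 2 := abs_sub_round _
  have h2 : |z.re + y / 2 - x| ≤ 1 / 2 := abs_sub_round _
  have him : z.im - y * (√3 / 2) = (√3 / 2) * (2 * z.im / √3 - y) := by
    field_simp
  have hn : ‖z - (x + y * omega)‖ ^ 2 =
      (z.re + y / 2 - x) ^ 2 + (z.im - y * (√3 / 2)) ^ 2 := by
    rw [Complex.sq_norm, Complex.normSq_apply]
    simp [omega]
    ring
  rw [hn, him]
  have e1 : (z.re + y / 2 - x) ^ 2 ≤ (1 / 2) ^ 2 := sq_le_sq' (abs_le.mp h2).1 (abs_le.mp h2).2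
  have e2 : (2 * z.im / √3 - y) ^ 2 ≤ (1 / 2) ^ 2 := sq_le_sq' (abs_le.mp h1).1 (abs_le.mp h1).2
  calc _ = (z.re + y / 2 - x) ^ 2 + (√3 * √3) / 4 * (2 * z.im / √3 - y) ^ 2 := by ring
    _ ≤ 7 / 16 := by rw [h3]; linarith

/-! ### The representation into `SL(2, ℂ)` -/

/-- The group `SL(2, ℂ)`. -/
abbrev SL2 : Type := Matrix.SpecialLinearGroup (Fin 2) ℂ

/-- The image of the meridian `m` in `SL(2, ℂ)`. -/
def slM : SL2 := ⟨!![1, 1; 0, 1], by simp [det_fin_two]⟩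

/-- The image of the meridian `n` in `SL(2, ℂ)`. -/
def slN : SL2 := ⟨!![1, 0; -omega, 1], by simp [det_fin_two]⟩

lemma coe_slM_inv : (slM⁻¹).1 = !![1, -1; 0, 1] := by
  rw [Matrix.SpecialLinearGroup.coe_inv]
  simp [slM, adjugate_fin_two]

lemma coe_slN_inv : (slN⁻¹).1 = !![1, 0; omega, 1] := by
  rw [Matrix.SpecialLinearGroup.coe_inv]
  simp [slN, adjugate_fin_two]

lemma sl_relation : slM * wordAt slM slN = wordAt slM slN * slN := by
  apply Subtype.ext
  simp only [wordAt, Matrix.SpecialLinearGroup.coe_mul, coe_slM_inv, coe_slN_inv]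
  have h := omega_mul_self
  simp only [slM, slN]
  ext i j
  fin_cases i <;> fin_cases j <;> simp [mul_apply, Fin.sum_univ_two] <;> grind

/-- The discrete faithful representation of the knot group into `SL(2, ℂ)`. -/
def slRep : KnotGroup →* SL2 := liftHom _ _ sl_relation

@[simp] lemma slRep_genM : slRep genM = slM := liftHom_genM

@[simp] lemma slRep_genN : slRep genN = slN := liftHom_genN

lemma slRep_mem_eisenstein (γ : KnotGroup) (i j : Fin 2) : (slRep γ).1 i j ∈ eisenstein := by
  let S : Subgroup KnotGroup :=
    { carrier := {γ | ∀ i j, (slRep γ).1 i j ∈ eisenstein}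
      one_mem' := by
        intro i j
        rw [map_one, Matrix.SpecialLinearGroup.coe_one, one_apply]
        split_ifs
        · exact one_mem _
        · exact zero_mem _
      mul_mem' := by
        intro a b ha hb i j
        rw [map_mul, Matrix.SpecialLinearGroup.coe_mul, mul_apply]
        exact sum_mem fun k _ => mul_mem (ha _ _) (hb _ _)
      inv_mem' := by
        intro a ha i j
        rw [map_inv, Matrix.SpecialLinearGroup.coe_inv, adjugate_fin_two]
        fin_cases i <;> fin_cases j <;> simp <;> exact ha _ _ }
  refine subgroup_eq_top S ?_ ?_ γ i j
  · intro i j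
    rw [slRep_genM]
    fin_cases i <;> fin_cases j <;> simp [slM, one_mem, zero_mem]
  · intro i j
    rw [slRep_genN]
    fin_cases i <;> fin_cases j <;> simp [slN, one_mem, zero_mem, self_mem_quadRing]

/-- `A` acts on the Riemann sphere as the translation by `τ`. -/
def IsTranslation (A : SL2) (τ : ℂ) : Prop := ∃ s : ℂ, s * s = 1 ∧ A.1 = !![s, s * τ; 0, s]

lemma IsTranslation.mul {A B : SL2} {τ τ' : ℂ} (hA : IsTranslation A τ)
    (hB : IsTranslation B τ') : IsTranslation (A * B) (τ + τ') := by
  obtain ⟨s, hs, hA⟩ := hA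
  obtain ⟨t, ht, hB⟩ := hB
  refine ⟨s * t, by linear_combination t * t * hs + ht, ?_⟩
  rw [Matrix.SpecialLinearGroup.coe_mul, hA, hB]
  ext i j
  fin_cases i <;> fin_cases j <;> simp [mul_apply, Fin.sum_univ_two]
  ring

lemma IsTranslation.inv {A : SL2} {τ : ℂ} (hA : IsTranslation A τ) : IsTranslation A⁻¹ (-τ) := by
  obtain ⟨s, hs, hA⟩ := hA
  refine ⟨s, hs, ?_⟩
  rw [Matrix.SpecialLinearGroup.coe_inv, hA, adjugate_fin_two]
  simp

lemma isTranslation_one : IsTranslation 1 0 :=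
  ⟨1, one_mul 1, by rw [Matrix.SpecialLinearGroup.coe_one, one_fin_two]; simp⟩

lemma IsTranslation.zpow {A : SL2} {τ : ℂ} (hA : IsTranslation A τ) (k : ℤ) :
    IsTranslation (A ^ k) (k * τ) := by
  induction k using Int.induction_on with
  | zero => simpa using isTranslation_one
  | succ k ih =>
    rw [_root_.zpow_add_one]
    convert ih.mul hA using 1
    push_cast
    ring
  | pred k ih =>
    rw [_root_.zpow_sub_one]
    convert ih.mul hA.inv using 1
    push_cast
    ring

lemma isTranslation_genM : IsTranslation (slRep genM) 1 :=
  ⟨1, one_mul 1, by rw [slRep_genM]; simp [slM]⟩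

/-- The translation length is `2 + 4ω = 2√3 i`. The longitude lifts to `SL(2, ℂ)` with sign `-1`,
which is why `IsTranslation` allows a sign. -/
lemma isTranslation_longitude : IsTranslation (slRep longitude) (2 + 4 * omega) := by
  refine ⟨-1, by norm_num, ?_⟩
  simp only [longitude, wordAt, map_mul, map_inv, slRep_genM, slRep_genN,
    Matrix.SpecialLinearGroup.coe_mul, coe_slM_inv, coe_slN_inv]
  have h := omega_mul_self
  simp only [slM, slN]
  ext i j
  fin_cases i <;> fin_cases j <;> simp [mul_apply, Fin.sum_univ_two] <;> grind

lemma isTranslation_peripheral (a b : ℤ) :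
    IsTranslation (slRep (genM ^ a * longitude ^ b)) (a + b * (2 + 4 * omega)) := by
  rw [map_mul, map_zpow, map_zpow]
  simpa using (isTranslation_genM.zpow a).mul (isTranslation_longitude.zpow b)

/-- The isometric sphere of some element of the knot group is a unit disc centred at `q`. -/
def IsFullCenter (q : ℂ) : Prop :=
  ∃ γ, ‖(slRep γ).1 1 0‖ = 1 ∧ (slRep γ).1 1 1 = -((slRep γ).1 1 0 * q)

lemma IsFullCenter.sub {q τ : ℂ} (hq : IsFullCenter q) {δ : KnotGroup}
    (hδ : IsTranslation (slRep δ) τ) : IsFullCenter (q - τ) := by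
  obtain ⟨γ, h1, h2⟩ := hq
  obtain ⟨s, hs, hA⟩ := hδ
  have hs1 : ‖s‖ = 1 := by
    have : ‖s‖ ^ 2 = 1 := by rw [pow_two, ← norm_mul, hs, norm_one]
    exact (pow_eq_one_iff_of_nonneg (norm_nonneg _) two_ne_zero).mp this
  have e0 : (slRep (γ * δ)).1 1 0 = (slRep γ).1 1 0 * s := by
    rw [map_mul, Matrix.SpecialLinearGroup.coe_mul, hA]
    simp [mul_apply, Fin.sum_univ_two]
  have e1 : (slRep (γ * δ)).1 1 1 = (slRep γ).1 1 0 * (s * τ) + (slRep γ).1 1 1 * s := by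
    rw [map_mul, Matrix.SpecialLinearGroup.coe_mul, hA]
    simp [mul_apply, Fin.sum_univ_two]
  refine ⟨γ * δ, ?_, ?_⟩
  · rw [e0, norm_mul, h1, hs1, one_mul]
  · rw [e1, e0, h2]
    ring

/-- Peripheral translations by `1` and `2 + 4ω` reduce an Eisenstein centre to one whose
`ω`-coordinate is determined modulo 4. Each of the four classes is realized by a short word with
lower-left entry a unit. -/
lemma isFullCenter_base (r : ℤ) (h1 : -1 ≤ r) (h2 : r ≤ 2) :
    ∃ x : ℤ, IsFullCenter (x + r * omega) := by
  have h := omega_mul_self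
  have hr : r = -1 ∨ r = 0 ∨ r = 1 ∨ r = 2 := by omega
  rcases hr with rfl | rfl | rfl | rfl
  · refine ⟨-1, genN, ?_, ?_⟩
    · simp [slN, norm_omega]
    · simp [slN]
      grind
  · have e : (slRep (genN * genM⁻¹ * genN⁻¹)).1 = !![1 - omega, -1; -(1 + omega), 1 + omega] := by
      simp only [map_mul, map_inv, slRep_genM, slRep_genN,
        Matrix.SpecialLinearGroup.coe_mul, coe_slM_inv, coe_slN_inv]
      simp only [slN]
      ext i j
      fin_cases i <;> fin_cases j <;> simp [mul_apply, Fin.sum_univ_two] <;> grind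
    refine ⟨1, genN * genM⁻¹ * genN⁻¹, ?_, ?_⟩
    · rw [e]
      simp only [of_apply, cons_val', cons_val_zero, cons_val_one, cons_val_fin_one, norm_neg,
        norm_one_add_omega]
    · rw [e]
      simp
  · refine ⟨1, genN⁻¹, ?_, ?_⟩
    · rw [map_inv, slRep_genN, coe_slN_inv]
      simp [norm_omega]
    · rw [map_inv, slRep_genN, coe_slN_inv]
      simp
      grind
  · have e : (slRep (genN * genM * genN⁻¹)).1 = !![1 + omega, 1; 1 + omega, 1 - omega] := by
      simp only [map_mul, map_inv, slRep_genM, slRep_genN,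
        Matrix.SpecialLinearGroup.coe_mul, coe_slN_inv]
      simp only [slM, slN]
      ext i j
      fin_cases i <;> fin_cases j <;> simp [mul_apply, Fin.sum_univ_two] <;> grind
    refine ⟨1, genN * genM * genN⁻¹, ?_, ?_⟩
    · rw [e]
      simp [norm_one_add_omega]
    · rw [e]
      simp
      grind

lemma isFullCenter_eisenstein (x y : ℤ) : IsFullCenter (x + y * omega) := by
  -- The representative of `y` modulo 4 in `[-1, 2]` is used. A power of the longitude restores `y`,
  -- and a power of `m` corrects the real shift, which includes 2 per longitude.
  obtain ⟨x', hx'⟩ := isFullCenter_base (y - 4 * ((y + 1) / 4)) (by omega) (by omega)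
  have := hx'.sub (isTranslation_peripheral (x' - x + 2 * ((y + 1) / 4)) (-((y + 1) / 4)))
  convert this using 1
  push_cast
  ring

/-- Every point of the complex plane is well inside the isometric sphere of an element of the
knot group. -/
lemma exists_isometricSphere (z : ℂ) :
    ∃ γ, ‖(slRep γ).1 1 0‖ = 1 ∧ ‖(slRep γ).1 1 0 * z + (slRep γ).1 1 1‖ ^ 2 ≤ 7 / 16 := by
  obtain ⟨x, y, hxy⟩ := exists_eisenstein_near z
  obtain ⟨γ, h1, h2⟩ := isFullCenter_eisenstein x y
  refine ⟨γ, h1, ?_⟩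
  have : (slRep γ).1 1 0 * z + (slRep γ).1 1 1 =
      (slRep γ).1 1 0 * (z - (x + y * omega)) := by
    rw [h2]
    ring
  rw [this, norm_mul, h1, one_mul]
  exact hxy

/-! ### Invariant forms and unitary representations -/

section
variable {K : Type} [RCLike K]

lemma mem_specialIsometries {J : Matrix (Fin 4) (Fin 4) K} {A : SL4 K} :
    A ∈ specialIsometries J ↔ A.1ᴴ * J * A.1 = J := Iff.rfl

lemma intRep_mem_specialIsometries {u : Kˣ} {H : Matrix (Fin 4) (Fin 4) K}
    (hM : intM u ∈ specialIsometries H) (hN : intN u ∈ specialIsometries H) (γ : KnotGroup) :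
    intRep u γ ∈ specialIsometries H :=
  subgroup_eq_top ((specialIsometries H).comap (intRep u))
    (by rw [Subgroup.mem_comap, intRep_genM]; exact hM)
    (by rw [Subgroup.mem_comap, intRep_genN]; exact hN) γ

lemma conjHom_mem_specialIsometries {H J P Q : Matrix (Fin 4) (Fin 4) K} (h : P * Q = 1)
    (hJ : J = Qᴴ * H * Q) {A : SL4 K} (hA : A ∈ specialIsometries H) :
    conjHom P Q h A ∈ specialIsometries J := by
  have h' : Q * P = 1 := mul_eq_one_comm.mp h
  have h'' : Pᴴ * Qᴴ = 1 := by rw [← conjTranspose_mul, h', conjTranspose_one]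
  rw [mem_specialIsometries] at *
  rw [coe_conjHom, hJ]
  calc (P * A.1 * Q)ᴴ * (Qᴴ * H * Q) * (P * A.1 * Q)
      = Qᴴ * A.1ᴴ * (Pᴴ * Qᴴ) * H * (Q * P) * A.1 * Q := by
        simp only [conjTranspose_mul, mul_assoc]
    _ = Qᴴ * (A.1ᴴ * H * A.1) * Q := by rw [h', h'', mul_one, mul_one]; simp only [mul_assoc]
    _ = Qᴴ * H * Q := by rw [hA]

/-- The representation of the knot group by isometries of the form `J`, obtained from an invariant
form `H = Qᴴ⁻¹ J Q⁻¹`. -/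
def unitaryRep (u : Kˣ) {H J : Matrix (Fin 4) (Fin 4) K} (P Q : Matrix (Fin 4) (Fin 4) K)
    (h : P * Q = 1) (hJ : J = Qᴴ * H * Q) (hM : intM u ∈ specialIsometries H)
    (hN : intN u ∈ specialIsometries H) : KnotGroup →* specialIsometries J :=
  ((conjHom P Q h).comp (intRep u)).codRestrict _ fun γ =>
    conjHom_mem_specialIsometries h hJ (intRep_mem_specialIsometries hM hN γ)

lemma coe_unitaryRep (u : Kˣ) {H J : Matrix (Fin 4) (Fin 4) K} (P Q : Matrix (Fin 4) (Fin 4) K)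
    (h : P * Q = 1) (hJ : J = Qᴴ * H * Q) (hM : intM u ∈ specialIsometries H)
    (hN : intN u ∈ specialIsometries H) (γ : KnotGroup) :
    (unitaryRep u P Q h hJ hM hN γ).1.1 = P * (intRep u γ).1 * Q := rfl

end

/-! ### The hyperbolic representation -/

/-- The invariant quadratic form of the representation with parameter `u = 1`. -/
def hypForm : Matrix (Fin 4) (Fin 4) ℝ :=
  !![0, 0, 0, -1 / 2; 0, 1 / 3, -1 / 6, 0; 0, -1 / 6, 1 / 3, 0; -1 / 2, 0, 0, 0]

/-- The change of basis from the standard Lorentzian basis to the integral basis. -/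
def hypP : Matrix (Fin 4) (Fin 4) ℝ :=
  !![0, 0, 1, 1; 1, √3, 0, 0; 2, 0, 0, 0; 0, 0, -1, 1]

/-- The inverse of `hypP`. -/
def hypQ : Matrix (Fin 4) (Fin 4) ℝ :=
  !![0, 0, 1 / 2, 0; 0, √3 / 3, -√3 / 6, 0; 1 / 2, 0, 0, -1 / 2; 1 / 2, 0, 0, 1 / 2]

lemma sqrt_three_mul_self : √3 * √3 = 3 := Real.mul_self_sqrt (by norm_num)

lemma hypP_mul_hypQ : hypP * hypQ = 1 := by
  have h3 := sqrt_three_mul_self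
  ext i j
  fin_cases i <;> fin_cases j <;> simp [hypP, hypQ, mul_apply, Fin.sum_univ_four] <;> grind

lemma hypQ_mul_hypP : hypQ * hypP = 1 := mul_eq_one_comm.mp hypP_mul_hypQ

lemma hypForm_eq : diagonal ![1, 1, 1, -1] = hypPᴴ * hypForm * hypP := by
  have h3 := sqrt_three_mul_self
  ext i j
  fin_cases i <;> fin_cases j <;>
    simp [hypP, hypForm, mul_apply, Fin.sum_univ_four, diagonal] <;> grind

lemma intM_mem_hypForm : intM (1 : ℝˣ) ∈ specialIsometries hypForm := by
  rw [mem_specialIsometries]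
  ext i j
  fin_cases i <;> fin_cases j <;>
    simp [hypForm, intM, mul_apply, Fin.sum_univ_four] <;> norm_num

lemma intN_mem_hypForm : intN (1 : ℝˣ) ∈ specialIsometries hypForm := by
  rw [mem_specialIsometries]
  ext i j
  fin_cases i <;> fin_cases j <;>
    simp [hypForm, intN, mul_apply, Fin.sum_univ_four] <;> norm_num

/-- The hyperbolic representation of the figure-eight knot group. -/
def hypRep : KnotGroup →* SO31 :=
  unitaryRep (1 : ℝˣ) hypQ hypP hypQ_mul_hypP hypForm_eq intM_mem_hypForm intN_mem_hypForm

lemma coe_hypRep (γ : KnotGroup) : (hypRep γ).1.1 = hypQ * (intRep (1 : ℝˣ) γ).1 * hypP := rfl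

lemma coe_intRep_one_real (γ : KnotGroup) :
    (intRep (1 : ℝˣ) γ).1 = (intRep (1 : ℤˣ) γ).1.map (Int.castRingHom ℝ) := by
  have := DFunLike.congr_fun (map_comp_intRep (1 : ℤˣ) (Int.castRingHom ℝ)) γ
  rw [map_one] at this
  rw [← this]
  rfl

lemma coe_intRep_one_complex (γ : KnotGroup) :
    (intRep (1 : ℂˣ) γ).1 = (intRep (1 : ℝˣ) γ).1.map Complex.ofRealHom := by
  have := DFunLike.congr_fun (map_comp_intRep (1 : ℝˣ) Complex.ofRealHom) γ
  rw [map_one] at this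
  rw [← this]
  rfl

lemma intRep_real_injective : Function.Injective (intRep (1 : ℝˣ)) := by
  intro γ δ h
  apply intRep_one_injective
  apply Subtype.ext
  apply Matrix.map_injective (RingHom.injective_int (Int.castRingHom ℝ))
  have := congrArg Subtype.val h
  rwa [coe_intRep_one_real, coe_intRep_one_real] at this

lemma intRep_eq_of_hypRep (γ : KnotGroup) :
    (intRep (1 : ℝˣ) γ).1 = hypP * (hypRep γ).1.1 * hypQ := by
  rw [coe_hypRep]
  calc (intRep (1 : ℝˣ) γ).1 = (hypP * hypQ) * (intRep (1 : ℝˣ) γ).1 * (hypP * hypQ) := by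
        rw [hypP_mul_hypQ, one_mul, mul_one]
    _ = _ := by simp only [mul_assoc]

lemma hypRep_injective : Function.Injective hypRep := by
  intro γ δ h
  apply intRep_real_injective
  apply Subtype.ext
  rw [intRep_eq_of_hypRep, intRep_eq_of_hypRep, h]

lemma hypRep_discrete_map : DiscreteTopology (hypRep.range.map SO31.subtype) := by
  refine discreteTopology_of_entries _ hypP hypQ hypP_mul_hypQ
    (Set.range (Int.castRingHom ℝ)) ?_ ?_
  · rintro _ ⟨a, rfl⟩ _ ⟨b, rfl⟩ h
    have h1 : |a - b| < 1 := by
      have : ((|a - b| : ℤ) : ℝ) < 1 := by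
        push_cast
        simpa using h
      exact_mod_cast this
    have : a - b = 0 := Int.abs_lt_one_iff.mp h1
    rw [sub_eq_zero.mp this]
  · rintro _ ⟨_, ⟨γ, rfl⟩, rfl⟩ i j
    change (hypP * (hypRep γ).1.1 * hypQ) i j ∈ _
    rw [← intRep_eq_of_hypRep, coe_intRep_one_real]
    exact ⟨_, rfl⟩

lemma hypRep_discrete : DiscreteTopology hypRep.range := by
  have := hypRep_discrete_map
  let f : hypRep.range → hypRep.range.map SO31.subtype :=
    fun x => ⟨x.1.1, ⟨x.1, x.2, rfl⟩⟩
  have hf : Continuous f := by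
    refine Continuous.subtype_mk ?_ _
    exact continuous_subtype_val.comp continuous_subtype_val
  have hinj : Function.Injective f := by
    intro x y h
    exact Subtype.ext (Subtype.ext (congrArg (fun z => z.1) h))
  exact DiscreteTopology.of_continuous_injective hf hinj

/-! ### The action on Hermitian matrices -/

/-- The identification of `ℂ⁴`, in the integral basis, with the complex `2 × 2` matrices. -/
def intHerm (y : Fin 4 → ℂ) : Matrix (Fin 2) (Fin 2) ℂ :=
  !![y 0, y 2 / 2 + (1 + 2 * omega) / 3 * (y 1 - y 2 / 2);
     y 2 / 2 - (1 + 2 * omega) / 3 * (y 1 - y 2 / 2), y 3]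

/-- The identification of `ℂ⁴`, in the standard basis, with the complex `2 × 2` matrices; it maps
`ℝ⁴` onto the Hermitian matrices. -/
def herm (x : Fin 4 → ℂ) : Matrix (Fin 2) (Fin 2) ℂ :=
  !![x 3 + x 2, x 0 + Complex.I * x 1; x 0 - Complex.I * x 1, x 3 - x 2]

lemma herm_injective : Function.Injective herm := by
  intro x y h
  have h00 := congrFun (congrFun h 0) 0
  have h01 := congrFun (congrFun h 0) 1
  have h10 := congrFun (congrFun h 1) 0
  have h11 := congrFun (congrFun h 1) 1
  simp only [herm, of_apply, cons_val', cons_val_zero, cons_val_one, cons_val_fin_one] at *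
  ext i
  fin_cases i
  · change x 0 = y 0
    linear_combination (h01 + h10) / 2
  · have : Complex.I * x 1 = Complex.I * y 1 := by linear_combination (h01 - h10) / 2
    exact mul_left_cancel₀ Complex.I_ne_zero this
  · change x 2 = y 2
    linear_combination (h00 - h11) / 2
  · change x 3 = y 3
    linear_combination (h00 + h11) / 2

lemma herm_surjective (X : Matrix (Fin 2) (Fin 2) ℂ) : ∃ x, herm x = X := by
  refine ⟨![(X 0 1 + X 1 0) / 2, -Complex.I * (X 0 1 - X 1 0) / 2, (X 0 0 - X 1 1) / 2,
    (X 0 0 + X 1 1) / 2], ?_⟩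
  have hI : Complex.I * Complex.I = -1 := Complex.I_mul_I
  ext i j
  fin_cases i <;> fin_cases j <;> simp [herm] <;> grind

lemma herm_smul (c : ℂ) (x : Fin 4 → ℂ) : herm (c • x) = c • herm x := by
  ext i j
  fin_cases i <;> fin_cases j <;> simp [herm] <;> ring

lemma herm_zero : herm 0 = 0 := by
  ext i j
  fin_cases i <;> fin_cases j <;> simp [herm]

lemma herm_eq_intHerm (x : Fin 4 → ℂ) :
    herm x = intHerm (hypP.map Complex.ofRealHom *ᵥ x) := by
  have h3 : ((√3 : ℝ) : ℂ) * ((√3 : ℝ) : ℂ) = 3 := by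
    rw [← Complex.ofReal_mul, sqrt_three_mul_self]
    norm_num
  have hw : (1 + 2 * omega) = Complex.I * ((√3 : ℝ) : ℂ) := by
    apply Complex.ext
    · simp [omega]
      norm_num
    · simp [omega]
      ring
  ext i j
  fin_cases i <;> fin_cases j <;>
    simp [herm, intHerm, hypP, mulVec, dotProduct, Fin.sum_univ_four, hw] <;> grind

/-- This is the isomorphism between `PSL(2, ℂ)` and SO⁰(3,1), complexified: the action `X ↦ g X gᴴ`
is linear in `X`, so it makes sense for all complex matrices, and only the two generators need
checking. -/
lemma intHerm_intRep (γ : KnotGroup) (y : Fin 4 → ℂ) :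
    intHerm ((intRep (1 : ℂˣ) γ).1 *ᵥ y) = (slRep γ).1 * intHerm y * (slRep γ).1ᴴ := by
  let S : Subgroup KnotGroup :=
    { carrier := {γ | ∀ y, intHerm ((intRep (1 : ℂˣ) γ).1 *ᵥ y) =
        (slRep γ).1 * intHerm y * (slRep γ).1ᴴ}
      one_mem' := by
        intro y
        simp only [map_one, Matrix.SpecialLinearGroup.coe_one, one_mulVec, conjTranspose_one,
          one_mul, mul_one]
      mul_mem' := by
        intro a b ha hb y
        simp only [map_mul, Matrix.SpecialLinearGroup.coe_mul, ← mulVec_mulVec, conjTranspose_mul]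
        rw [ha, hb]
        simp only [mul_assoc]
      inv_mem' := by
        intro a ha y
        have h1 := ha ((intRep (1 : ℂˣ) a⁻¹).1 *ᵥ y)
        rw [mulVec_mulVec, ← Matrix.SpecialLinearGroup.coe_mul, ← map_mul, mul_inv_cancel,
          map_one, Matrix.SpecialLinearGroup.coe_one, one_mulVec] at h1
        have e : (slRep a⁻¹).1 * (slRep a).1 = 1 := by
          rw [← Matrix.SpecialLinearGroup.coe_mul, ← map_mul, inv_mul_cancel, map_one,
            Matrix.SpecialLinearGroup.coe_one]
        have e' : (slRep a).1ᴴ * (slRep a⁻¹).1ᴴ = 1 := by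
          rw [← conjTranspose_mul, e, conjTranspose_one]
        rw [h1]
        generalize intHerm ((intRep (1 : ℂˣ) a⁻¹).1 *ᵥ y) = Y
        calc Y = ((slRep a⁻¹).1 * (slRep a).1) * Y * ((slRep a).1ᴴ * (slRep a⁻¹).1ᴴ) := by
              rw [e, e', one_mul, mul_one]
          _ = _ := by simp only [mul_assoc] }
  have hw := omega_mul_self
  refine subgroup_eq_top S ?_ ?_ γ y
  · intro y
    rw [intRep_genM, slRep_genM]
    ext i j
    fin_cases i <;> fin_cases j <;>
      simp [intHerm, intM, slM, mulVec, dotProduct, Fin.sum_univ_four, mul_apply,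
        Fin.sum_univ_two] <;> grind
  · intro y
    rw [intRep_genN, slRep_genN]
    ext i j
    fin_cases i <;> fin_cases j <;>
      simp [intHerm, intN, slN, mulVec, dotProduct, Fin.sum_univ_four, mul_apply,
        Fin.sum_univ_two, conj_omega] <;> grind

/-- The hyperbolic representation, as matrices over the complex numbers. -/
def hypMat (γ : KnotGroup) : Matrix (Fin 4) (Fin 4) ℂ := (hypRep γ).1.1.map Complex.ofRealHom

/-- The hyperbolic representation acts on Hermitian matrices through `SL(2, ℂ)`. -/
lemma herm_hypMat (γ : KnotGroup) (x : Fin 4 → ℂ) :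
    herm (hypMat γ *ᵥ x) = (slRep γ).1 * herm x * (slRep γ).1ᴴ := by
  rw [herm_eq_intHerm, herm_eq_intHerm, ← intHerm_intRep, hypMat, mulVec_mulVec, mulVec_mulVec,
    ← Matrix.map_mul, coe_intRep_one_complex, ← Matrix.map_mul, intRep_eq_of_hypRep,
    mul_assoc _ hypQ, hypQ_mul_hypP, mul_one]

/-- The representation into `PSL(2, ℂ)` is faithful. -/
lemma eq_one_of_isTranslation_zero {γ : KnotGroup} (h : IsTranslation (slRep γ) 0) : γ = 1 := by
  obtain ⟨s, hs, hA⟩ := h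
  have hs1 : s = 1 ∨ s = -1 := mul_self_eq_one_iff.mp hs
  have hss : s * star s = 1 := by rcases hs1 with rfl | rfl <;> simp
  have hX : ∀ X : Matrix (Fin 2) (Fin 2) ℂ, (slRep γ).1 * X * (slRep γ).1ᴴ = X := by
    intro X
    have e : (slRep γ).1 = s • 1 := by
      rw [hA]
      ext i j
      fin_cases i <;> fin_cases j <;> simp
    rw [e, conjTranspose_smul, conjTranspose_one, Matrix.smul_mul, one_mul, Matrix.mul_smul,
      mul_one, smul_smul, mul_comm, hss, one_smul]
  have hmul : ∀ x, hypMat γ *ᵥ x = x := fun x => herm_injective (by rw [herm_hypMat, hX])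
  have h1 : hypMat γ = 1 := by
    ext i j
    have := congrFun (hmul (Pi.single j 1)) i
    rw [mulVec_single_one] at this
    simpa [Pi.single_apply, one_apply] using this
  apply hypRep_injective
  rw [map_one]
  apply Subtype.ext
  apply Subtype.ext
  apply Matrix.map_injective Complex.ofRealHom.injective
  change hypMat γ = _
  rw [h1]
  change _ = (1 : Matrix (Fin 4) (Fin 4) ℝ).map _
  rw [Matrix.map_one _ (map_zero _) (map_one _)]

lemma eq_of_isTranslation {γ δ : KnotGroup} {τ : ℂ} (h : IsTranslation (slRep γ) τ)
    (h' : IsTranslation (slRep δ) τ) : γ = δ := by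
  have := h.mul h'.inv
  rw [← map_inv, ← map_mul, add_neg_cancel] at this
  exact mul_inv_eq_one.mp (eq_one_of_isTranslation_zero this)

/-! ### The action on hyperbolic space -/

lemma hypMat_mulVec_ofReal (γ : KnotGroup) (y : Fin 4 → ℝ) :
    hypMat γ *ᵥ (fun i => (y i : ℂ)) = fun i => (((hypRep γ).1.1 *ᵥ y) i : ℂ) := by
  ext i
  simp [hypMat, mulVec, dotProduct]

lemma hypRep_form (γ : KnotGroup) (y : Fin 4 → ℝ) :
    ((hypRep γ).1.1 *ᵥ y) 0 ^ 2 + ((hypRep γ).1.1 *ᵥ y) 1 ^ 2 + ((hypRep γ).1.1 *ᵥ y) 2 ^ 2 -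
      ((hypRep γ).1.1 *ᵥ y) 3 ^ 2 = y 0 ^ 2 + y 1 ^ 2 + y 2 ^ 2 - y 3 ^ 2 := by
  have key : ∀ x : Fin 4 → ℝ, x ⬝ᵥ (diagonal ![1, 1, 1, -1] *ᵥ x) =
      x 0 ^ 2 + x 1 ^ 2 + x 2 ^ 2 - x 3 ^ 2 := by
    intro x
    simp [dotProduct, Fin.sum_univ_four, mulVec_diagonal]
    ring
  have hA : (hypRep γ).1.1ᴴ * diagonal ![1, 1, 1, -1] * (hypRep γ).1.1 =
    diagonal ![1, 1, 1, -1] := (hypRep γ).2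
  rw [← key, ← key]
  nth_rewrite 2 [← hA]
  rw [← mulVec_mulVec, ← mulVec_mulVec, conjTranspose_eq_transpose_of_trivial,
    dotProduct_mulVec y, vecMul_transpose]

/-- The base point `(0, 0, 0, 1)` corresponds to the identity matrix and its image to `g gᴴ`, whose
trace is the positive sum of the squared moduli of the entries of `g`. -/
lemma hypRep_sheet (γ : KnotGroup) : 0 < (hypRep γ).1.1 3 3 := by
  have h := herm_hypMat γ (fun i => ((Pi.single 3 1 : Fin 4 → ℝ) i : ℂ))
  have h1 : herm (fun i => ((Pi.single 3 1 : Fin 4 → ℝ) i : ℂ)) = 1 := by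
    ext i j
    fin_cases i <;> fin_cases j <;> simp [herm]
  rw [hypMat_mulVec_ofReal, mulVec_single_one, h1, mul_one] at h
  have h00 := congrFun (congrFun h 0) 0
  have h11 := congrFun (congrFun h 1) 1
  simp only [herm, of_apply, cons_val', cons_val_zero, cons_val_one, cons_val_fin_one,
    mul_apply, Fin.sum_univ_two, conjTranspose_apply, col_apply] at h00 h11
  have e : ∀ z : ℂ, z * star z = ((‖z‖ ^ 2 : ℝ) : ℂ) := fun z => by
    rw [Complex.ofReal_pow]
    exact Complex.mul_conj' z
  rw [e, e] at h00 h11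
  have hs : 2 * (hypRep γ).1.1 3 3 = ‖(slRep γ).1 0 0‖ ^ 2 + ‖(slRep γ).1 0 1‖ ^ 2 +
      (‖(slRep γ).1 1 0‖ ^ 2 + ‖(slRep γ).1 1 1‖ ^ 2) := by
    have : (2 * (hypRep γ).1.1 3 3 : ℂ) = ((‖(slRep γ).1 0 0‖ ^ 2 + ‖(slRep γ).1 0 1‖ ^ 2 +
      (‖(slRep γ).1 1 0‖ ^ 2 + ‖(slRep γ).1 1 1‖ ^ 2) : ℝ) : ℂ) := by
      push_cast at *
      linear_combination h00 + h11
    exact_mod_cast this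
  have hdet : (slRep γ).1.det = 1 := (slRep γ).2
  rw [det_fin_two] at hdet
  by_contra hneg
  push Not at hneg
  have z00 : (slRep γ).1 0 0 = 0 := by
    rw [← norm_eq_zero, ← sq_eq_zero_iff]
    nlinarith [sq_nonneg ‖(slRep γ).1 0 0‖, sq_nonneg ‖(slRep γ).1 0 1‖,
      sq_nonneg ‖(slRep γ).1 1 0‖, sq_nonneg ‖(slRep γ).1 1 1‖]
  have z01 : (slRep γ).1 0 1 = 0 := by
    rw [← norm_eq_zero, ← sq_eq_zero_iff]
    nlinarith [sq_nonneg ‖(slRep γ).1 0 0‖, sq_nonneg ‖(slRep γ).1 0 1‖,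
      sq_nonneg ‖(slRep γ).1 1 0‖, sq_nonneg ‖(slRep γ).1 1 1‖]
  rw [z00, z01] at hdet
  simp at hdet

/-- The points of the hyperboloid model which lie on the upper sheet; the height over the cusp at
infinity is `1 / (t - x₂)`. -/
def OnHyperboloid (y : Fin 4 → ℝ) : Prop :=
  y 0 ^ 2 + y 1 ^ 2 + y 2 ^ 2 - y 3 ^ 2 = -1 ∧ 0 < y 3 - y 2

/-- The coordinate of the vertical projection to the boundary plane. -/
def boundaryCoord (y : Fin 4 → ℝ) : ℂ := (y 0 + Complex.I * y 1) / ((y 3 - y 2 : ℝ) : ℂ)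

/-- With `h = 1 / (y₃ - y₂)` and lower row `(c, d)` of `g`, this is the upper half-space formula `h'
= h / (|c z + d|² + |c|² h²)`, written for inverse heights. -/
lemma inv_height_mulVec (γ : KnotGroup) {y : Fin 4 → ℝ} (hy : OnHyperboloid y) :
    ((hypRep γ).1.1 *ᵥ y) 3 - ((hypRep γ).1.1 *ᵥ y) 2 =
      (y 3 - y 2) * ‖(slRep γ).1 1 0 * boundaryCoord y + (slRep γ).1 1 1‖ ^ 2 +
        ‖(slRep γ).1 1 0‖ ^ 2 / (y 3 - y 2) := by
  obtain ⟨h1, h2⟩ := hy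
  have h := herm_hypMat γ (fun i => (y i : ℂ))
  rw [hypMat_mulVec_ofReal] at h
  have h11 := congrFun (congrFun h 1) 1
  simp only [herm, of_apply, cons_val', cons_val_zero, cons_val_one, cons_val_fin_one,
    mul_apply, Fin.sum_univ_two, conjTranspose_apply] at h11
  have hd : ((y 3 : ℂ) - y 2) ≠ 0 := by
    have : ((y 3 - y 2 : ℝ) : ℂ) ≠ 0 := by exact_mod_cast h2.ne'
    simpa using this
  have h1' : (y 0 : ℂ) ^ 2 + (y 1 : ℂ) ^ 2 + (y 2 : ℂ) ^ 2 - (y 3 : ℂ) ^ 2 = -1 := by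
    exact_mod_cast h1
  have key : ((((hypRep γ).1.1 *ᵥ y) 3 - ((hypRep γ).1.1 *ᵥ y) 2 : ℝ) : ℂ) =
      (((y 3 - y 2) * ‖(slRep γ).1 1 0 * boundaryCoord y + (slRep γ).1 1 1‖ ^ 2 +
        ‖(slRep γ).1 1 0‖ ^ 2 / (y 3 - y 2) : ℝ) : ℂ) := by
    push_cast
    rw [h11, ← Complex.mul_conj', ← Complex.mul_conj', boundaryCoord]
    simp only [map_add, map_mul, map_div₀, Complex.conj_ofReal, Complex.conj_I]
    change _ = _ * (_ * (star ((slRep γ).1 1 0) * _ + star ((slRep γ).1 1 1))) +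
      _ * star ((slRep γ).1 1 0) / _
    generalize star ((slRep γ).1 1 0) = c'
    generalize star ((slRep γ).1 1 1) = e'
    push_cast
    field_simp
    have hI : Complex.I * Complex.I = -1 := Complex.I_mul_I
    generalize (slRep γ).1 1 0 = c
    generalize (slRep γ).1 1 1 = e
    generalize Complex.I = I at *
    grind
  exact_mod_cast key

lemma row_ne_zero (γ : KnotGroup) : (slRep γ).1 1 0 ≠ 0 ∨ (slRep γ).1 1 1 ≠ 0 := by
  by_contra h
  push Not at h
  have hdet : (slRep γ).1.det = 1 := (slRep γ).2
  rw [det_fin_two, h.1, h.2] at hdet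
  simp at hdet

/-- A nonzero Eisenstein entry in the lower row has modulus at least one, so heights along an orbit
are bounded above. -/
lemma inv_height_lower_bound (γ : KnotGroup) {y : Fin 4 → ℝ} (hy : OnHyperboloid y) :
    min (y 3 - y 2) (1 / (y 3 - y 2)) ≤
      ((hypRep γ).1.1 *ᵥ y) 3 - ((hypRep γ).1.1 *ᵥ y) 2 := by
  rw [inv_height_mulVec γ hy]
  have h2 := hy.2
  by_cases hc : (slRep γ).1 1 0 = 0
  · have he : (slRep γ).1 1 1 ≠ 0 := (row_ne_zero γ).resolve_left (not_not.mpr hc)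
    have := one_le_norm_quadRing star_omega (slRep_mem_eisenstein γ 1 1) he
    refine (min_le_left _ _).trans ?_
    rw [hc, zero_mul, zero_add, norm_zero]
    have h3 : 1 ≤ ‖(slRep γ).1 1 1‖ ^ 2 := one_le_pow₀ this
    simp only [ne_eq, OfNat.ofNat_ne_zero, not_false_eq_true, zero_pow, zero_div, add_zero]
    nlinarith
  · have := one_le_norm_quadRing star_omega (slRep_mem_eisenstein γ 1 0) hc
    have h3 : 1 ≤ ‖(slRep γ).1 1 0‖ ^ 2 := one_le_pow₀ this
    refine (min_le_right _ _).trans ?_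
    have h4 : 1 / (y 3 - y 2) ≤ ‖(slRep γ).1 1 0‖ ^ 2 / (y 3 - y 2) := by gcongr
    have h5 : 0 ≤ (y 3 - y 2) * ‖(slRep γ).1 1 0 * boundaryCoord y + (slRep γ).1 1 1‖ ^ 2 := by
      positivity
    linarith

lemma OnHyperboloid.mulVec (γ : KnotGroup) {y : Fin 4 → ℝ} (hy : OnHyperboloid y) :
    OnHyperboloid ((hypRep γ).1.1 *ᵥ y) := by
  refine ⟨(hypRep_form γ y).trans hy.1, lt_of_lt_of_le ?_ (inv_height_lower_bound γ hy)⟩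
  have := hy.2
  exact lt_min this (by positivity)

lemma OnHyperboloid.eq_hyperboloidPoint {y : Fin 4 → ℝ} (hy : OnHyperboloid y) :
    y = hyperboloidPoint ![y 0, y 1, y 2] := by
  obtain ⟨h1, h2⟩ := hy
  have h3 : 0 ≤ y 3 := by nlinarith [sq_nonneg (y 0), sq_nonneg (y 1)]
  have : √(1 + y 0 ^ 2 + y 1 ^ 2 + y 2 ^ 2) = y 3 := by
    rw [← Real.sqrt_sq h3]
    congr 1
    linarith
  ext i
  fin_cases i <;> simp [hyperboloidPoint, this]

lemma onHyperboloid_hyperboloidPoint (x : Fin 3 → ℝ) : OnHyperboloid (hyperboloidPoint x) := by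
  have hs : √(1 + x 0 ^ 2 + x 1 ^ 2 + x 2 ^ 2) ^ 2 = 1 + x 0 ^ 2 + x 1 ^ 2 + x 2 ^ 2 :=
    Real.sq_sqrt (by positivity)
  refine ⟨?_, ?_⟩
  · simp [hyperboloidPoint, hs]
  · change 0 < √(1 + x 0 ^ 2 + x 1 ^ 2 + x 2 ^ 2) - x 2
    rw [sub_pos]
    apply Real.lt_sqrt_of_sq_lt
    nlinarith [sq_nonneg (x 0), sq_nonneg (x 1)]

lemma hypRep_mul_mulVec (γ δ : KnotGroup) (y : Fin 4 → ℝ) :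
    (hypRep (γ * δ)).1.1 *ᵥ y = (hypRep γ).1.1 *ᵥ ((hypRep δ).1.1 *ᵥ y) := by
  rw [map_mul, mulVec_mulVec]
  rfl

/-- Every orbit reaches a definite height. -/
lemma exists_large_height {y : Fin 4 → ℝ} (hy : OnHyperboloid y) :
    ∃ γ, ((hypRep γ).1.1 *ᵥ y) 3 - ((hypRep γ).1.1 *ᵥ y) 2 ≤ 2 := by
  by_contra hcon
  push Not at hcon
  -- While the inverse height `d` exceeds 2, an isometric sphere above the point gives a new inverse
  -- height at most `(7/16) d + 1/d ≤ (7/8) d`. Repeating this would contradict the lower bound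
  -- along the orbit.
  have step : ∀ k : ℕ, ∃ γ, ((hypRep γ).1.1 *ᵥ y) 3 - ((hypRep γ).1.1 *ᵥ y) 2 ≤
      (7 / 8) ^ k * (y 3 - y 2) := by
    intro k
    induction k with
    | zero =>
      refine ⟨1, ?_⟩
      rw [map_one]
      change ((1 : Matrix (Fin 4) (Fin 4) ℝ) *ᵥ y) 3 - ((1 : Matrix (Fin 4) (Fin 4) ℝ) *ᵥ y) 2 ≤ _
      simp
    | succ k ih =>
      obtain ⟨γ, hγ⟩ := ih
      have hlow := hcon γ
      have hy' := hy.mulVec γ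
      generalize hyy : (hypRep γ).1.1 *ᵥ y = y' at *
      obtain ⟨δ, h1, h2⟩ := exists_isometricSphere (boundaryCoord y')
      refine ⟨δ * γ, ?_⟩
      rw [hypRep_mul_mulVec, hyy, inv_height_mulVec δ hy', h1, pow_succ (7 / 8 : ℝ) k]
      have hd : 1 / (y' 3 - y' 2) ≤ 7 / 16 * (y' 3 - y' 2) := by
        rw [div_le_iff₀ hy'.2]
        nlinarith
      have h3 := mul_le_mul_of_nonneg_left h2 hy'.2.le
      rw [one_pow]
      linarith
  have hpos : 0 < min (y 3 - y 2) (1 / (y 3 - y 2)) := by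
    have := hy.2
    exact lt_min this (by positivity)
  obtain ⟨k, hk⟩ := exists_pow_lt_of_lt_one (div_pos hpos hy.2) (by norm_num : (7 / 8 : ℝ) < 1)
  obtain ⟨γ, hγ⟩ := step k
  have := inv_height_lower_bound γ hy
  rw [lt_div_iff₀ hy.2] at hk
  linarith

lemma translate_mulVec {γ : KnotGroup} {τ : ℂ} (h : IsTranslation (slRep γ) τ)
    {y : Fin 4 → ℝ} (hy : OnHyperboloid y) :
    ((hypRep γ).1.1 *ᵥ y) 3 - ((hypRep γ).1.1 *ᵥ y) 2 = y 3 - y 2 ∧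
      (((hypRep γ).1.1 *ᵥ y) 0 : ℂ) + Complex.I * ((hypRep γ).1.1 *ᵥ y) 1 =
        (boundaryCoord y + τ) * ((y 3 - y 2 : ℝ) : ℂ) := by
  obtain ⟨s, hs, hA⟩ := h
  have hs1 : s = 1 ∨ s = -1 := mul_self_eq_one_iff.mp hs
  have hss : star s = s := by rcases hs1 with rfl | rfl <;> simp
  have hd : (((y 3 - y 2 : ℝ) : ℂ)) ≠ 0 := by exact_mod_cast hy.2.ne'
  have h := herm_hypMat γ (fun i => (y i : ℂ))
  rw [hypMat_mulVec_ofReal, hA] at h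
  have h11 := congrFun (congrFun h 1) 1
  have h01 := congrFun (congrFun h 0) 1
  simp only [herm, of_apply, cons_val', cons_val_zero, cons_val_one, cons_val_fin_one,
    mul_apply, Fin.sum_univ_two, conjTranspose_apply, star_zero, hss] at h01 h11
  constructor
  · have : ((((hypRep γ).1.1 *ᵥ y) 3 - ((hypRep γ).1.1 *ᵥ y) 2 : ℝ) : ℂ) =
        ((y 3 - y 2 : ℝ) : ℂ) := by
      push_cast
      rw [h11]
      linear_combination ((y 3 : ℂ) - y 2) * hs
    exact_mod_cast this
  · have e : (boundaryCoord y + τ) * ((y 3 - y 2 : ℝ) : ℂ) =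
        y 0 + Complex.I * y 1 + τ * ((y 3 - y 2 : ℝ) : ℂ) := by
      rw [add_mul, boundaryCoord, div_mul_cancel₀ _ hd]
    rw [h01, e]
    push_cast
    linear_combination ((y 0 : ℂ) + Complex.I * y 1 + τ * (y 3 - y 2)) * hs

lemma exists_peripheral_near (z : ℂ) :
    ∃ a b : ℤ, |(z + (a + b * (2 + 4 * omega))).re| ≤ 1 ∧
      |(z + (a + b * (2 + 4 * omega))).im| ≤ 2 := by
  have h3 : √3 * √3 = 3 := sqrt_three_mul_self
  have h3pos : 0 < √3 := Real.sqrt_pos.mpr (by norm_num)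
  refine ⟨-round z.re, -round (z.im / (2 * √3)), ?_, ?_⟩
  · have : (z + ((-round z.re : ℤ) + (-round (z.im / (2 * √3)) : ℤ) * (2 + 4 * omega))).re =
        z.re - round z.re := by
      simp [omega]
      ring
    rw [this]
    exact (abs_sub_round _).trans (by norm_num)
  · have : (z + ((-round z.re : ℤ) + (-round (z.im / (2 * √3)) : ℤ) * (2 + 4 * omega))).im =
        (2 * √3) * (z.im / (2 * √3) - round (z.im / (2 * √3))) := by
      simp [omega]
      field_simp
      ring
    rw [this, abs_mul, abs_of_pos (by positivity)]
    have h1 := abs_sub_round (z.im / (2 * √3))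
    have h2 : √3 ≤ 2 := by nlinarith
    nlinarith

/-- A union of boxes which contains a fundamental domain. -/
def cuspRegion : Set (Fin 3 → ℝ) :=
  ⋃ k : ℕ, Set.Icc (![-(99 / ((k : ℝ) + 1)), -(99 / ((k : ℝ) + 1)), k - 1] : Fin 3 → ℝ)
    ![99 / ((k : ℝ) + 1), 99 / ((k : ℝ) + 1), k]

lemma measurableSet_cuspRegion : MeasurableSet cuspRegion :=
  MeasurableSet.iUnion fun _ => measurableSet_Icc

/-- The hyperbolic density is at most 1, so Lebesgue measure suffices; the boxes have volume `198² /
(k + 1)²`, which is summable. -/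
lemma hyperbolicVolume_cuspRegion : hyperbolicVolume cuspRegion < ⊤ := by
  have h1 : hyperbolicVolume cuspRegion ≤ volume cuspRegion := by
    calc hyperbolicVolume cuspRegion ≤ ∫⁻ _ in cuspRegion, 1 := by
          refine lintegral_mono fun x => ?_
          rw [← ENNReal.ofReal_one]
          apply ENNReal.ofReal_le_ofReal
          rw [div_le_one (by positivity)]
          apply Real.one_le_sqrt.mpr
          nlinarith [sq_nonneg (x 0), sq_nonneg (x 1), sq_nonneg (x 2)]
      _ = volume cuspRegion := by simp
  refine h1.trans_lt ((measure_iUnion_le _).trans_lt ?_)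
  have hvol : ∀ k : ℕ, volume (Set.Icc (![-(99 / ((k : ℝ) + 1)), -(99 / ((k : ℝ) + 1)), k - 1] :
      Fin 3 → ℝ) ![99 / ((k : ℝ) + 1), 99 / ((k : ℝ) + 1), k]) =
      ENNReal.ofReal (198 ^ 2 * (1 / ((k : ℝ) + 1) ^ 2)) := by
    intro k
    rw [Real.volume_Icc_pi, Fin.prod_univ_three]
    simp only [cons_val_zero, cons_val_one, cons_val]
    rw [← ENNReal.ofReal_mul (by rw [sub_neg_eq_add]; positivity), ← ENNReal.ofReal_mul (by
      rw [sub_neg_eq_add]; positivity)]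
    congr 1
    field_simp
    ring
  simp only [hvol]
  have hsum : Summable fun k : ℕ => 198 ^ 2 * (1 / ((k : ℝ) + 1) ^ 2) := by
    apply Summable.mul_left
    have := (summable_nat_add_iff 1).mpr (Real.summable_one_div_nat_pow.mpr one_lt_two)
    simpa using this
  exact hsum.tsum_ofReal_lt_top

/-- Since `(y₃ - y₂)(y₃ + y₂) = 1 + y₀² + y₁² ≤ 1 + 8 · 2² = 33`, the width `y₃ - y₂` decays like `1
/ y₂` towards the cusp. The constant 99 in the boxes is a comfortable bound. -/
lemma mem_cuspRegion {y : Fin 4 → ℝ} (hy : OnHyperboloid y) (hd : y 3 - y 2 ≤ 2)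
    (h0 : |y 0| ≤ 2 * (y 3 - y 2)) (h1 : |y 1| ≤ 2 * (y 3 - y 2)) :
    ![y 0, y 1, y 2] ∈ cuspRegion := by
  obtain ⟨hform, hpos⟩ := hy
  have hx2 : -1 ≤ y 2 := by
    by_contra hlt
    push Not at hlt
    nlinarith [sq_nonneg (y 0), sq_nonneg (y 1)]
  have hprod : (y 3 - y 2) * (y 3 + y 2) ≤ 33 := by
    have e0 := sq_le_sq' (neg_le_of_abs_le h0) (le_of_abs_le h0)
    have e1 := sq_le_sq' (neg_le_of_abs_le h1) (le_of_abs_le h1)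
    nlinarith
  have hk : ∃ k : ℕ, (k : ℝ) - 1 ≤ y 2 ∧ y 2 ≤ k ∧ 2 * (y 3 - y 2) * ((k : ℝ) + 1) ≤ 99 := by
    rcases le_total (y 2) 0 with hneg | hnn
    · exact ⟨0, by push_cast; linarith, by push_cast; linarith, by push_cast; linarith⟩
    · refine ⟨⌈y 2⌉₊, ?_, Nat.le_ceil _, ?_⟩
      · linarith [Nat.ceil_lt_add_one hnn]
      · have := (Nat.ceil_lt_add_one hnn).le
        nlinarith
  obtain ⟨k, hk1, hk2, hk3⟩ := hk
  have hbound : 2 * (y 3 - y 2) ≤ 99 / ((k : ℝ) + 1) := by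
    rw [le_div_iff₀ (by positivity)]
    exact hk3
  have b0 := abs_le.mp (h0.trans hbound)
  have b1 := abs_le.mp (h1.trans hbound)
  refine Set.mem_iUnion.mpr ⟨k, Set.mem_Icc.mpr ⟨fun i => ?_, fun i => ?_⟩⟩
  · fin_cases i
    exacts [b0.1, b1.1, hk1]
  · fin_cases i
    exacts [b0.2, b1.2, hk2]

lemma exists_mem_cuspRegion {y : Fin 4 → ℝ} (hy : OnHyperboloid y) :
    ∃ γ, ∃ x ∈ cuspRegion, (hypRep γ).1.1 *ᵥ y = hyperboloidPoint x := by
  obtain ⟨γ, hγ⟩ := exists_large_height hy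
  have hy' := hy.mulVec γ
  obtain ⟨a, b, hre, him⟩ := exists_peripheral_near (boundaryCoord ((hypRep γ).1.1 *ᵥ y))
  have ht := isTranslation_peripheral a b
  refine ⟨genM ^ a * longitude ^ b * γ, _, ?_,
    (hy.mulVec (genM ^ a * longitude ^ b * γ)).eq_hyperboloidPoint⟩
  rw [hypRep_mul_mulVec]
  obtain ⟨h1, h2⟩ := translate_mulVec ht hy'
  have hy'' := hy'.mulVec (genM ^ a * longitude ^ b)
  generalize (hypRep γ).1.1 *ᵥ y = y' at *
  generalize (hypRep (genM ^ a * longitude ^ b)).1.1 *ᵥ y' = x at *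
  generalize boundaryCoord y' + (a + b * (2 + 4 * omega)) = t at *
  rw [← h1] at h2 hγ
  have hx0 : x 0 = t.re * (x 3 - x 2) := by simpa using congrArg Complex.re h2
  have hx1 : x 1 = t.im * (x 3 - x 2) := by simpa using congrArg Complex.im h2
  refine mem_cuspRegion hy'' hγ ?_ ?_
  · rw [hx0, abs_mul, abs_of_pos hy''.2]
    nlinarith [hy''.2]
  · rw [hx1, abs_mul, abs_of_pos hy''.2]
    nlinarith [hy''.2]

lemma isHyperbolicRep_hypRep : IsHyperbolicRep hypRep where
  sheet := hypRep_sheet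
  faithful := hypRep_injective
  discrete := hypRep_discrete
  finite_covolume := by
    refine ⟨cuspRegion, measurableSet_cuspRegion, hyperbolicVolume_cuspRegion, fun x => ?_⟩
    obtain ⟨γ, y, hy, h⟩ := exists_mem_cuspRegion (onHyperboloid_hyperboloidPoint x)
    refine ⟨γ⁻¹, y, hy, ?_⟩
    rw [← h, ← hypRep_mul_mulVec, inv_mul_cancel, map_one]
    exact one_mulVec _

/-! ### The family of representations -/

/-- The change of basis from the integral basis to the standard one. -/
def basisC : Matrix (Fin 4) (Fin 4) ℂ :=
  !![1 / 2, 0, 0, 0; 1 / 2, 1, 0, 0; 0, 0, 1 / 2, 1; 0, 0, 0, 1]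

/-- The inverse of `basisC`. -/
def basisCInv : Matrix (Fin 4) (Fin 4) ℂ :=
  !![2, 0, 0, 0; -1, 1, 0, 0; 0, 0, 2, -2; 0, 0, 0, 1]

lemma basisC_mul_basisCInv : basisC * basisCInv = 1 := by
  ext i j
  fin_cases i <;> fin_cases j <;>
    simp [basisC, basisCInv, mul_apply, Fin.sum_univ_four]

lemma basisCInv_mul_basisC : basisCInv * basisC = 1 := mul_eq_one_comm.mp basisC_mul_basisCInv

/-- The representation `ρ_u`. -/
def rho (u : Circle) : KnotGroup →* SL4 ℂ :=
  (conjHom basisC basisCInv basisC_mul_basisCInv).comp (intRep (Circle.toUnits u))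

lemma coe_rho (u : Circle) (γ : KnotGroup) :
    (rho u γ).1 = basisC * (intRep (Circle.toUnits u) γ).1 * basisCInv := rfl

lemma rho_genM (u : Circle) : (rho u genM : Matrix (Fin 4) (Fin 4) ℂ) = matM u := by
  rw [coe_rho, intRep_genM]
  ext i j
  fin_cases i <;> fin_cases j <;>
    simp [basisC, basisCInv, intM, matM, mul_apply, Fin.sum_univ_four] <;> ring

lemma rho_genN (u : Circle) : (rho u genN : Matrix (Fin 4) (Fin 4) ℂ) = matN u := by
  rw [coe_rho, intRep_genN]
  ext i j
  fin_cases i <;> fin_cases j <;>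
    simp [basisC, basisCInv, intN, matN, mul_apply, Fin.sum_univ_four] <;> ring

lemma intRep_eq_of_rho (u : Circle) (γ : KnotGroup) :
    (intRep (Circle.toUnits u) γ).1 = basisCInv * (rho u γ).1 * basisC := by
  rw [coe_rho]
  calc (intRep (Circle.toUnits u) γ).1
      = (basisCInv * basisC) * (intRep (Circle.toUnits u) γ).1 * (basisCInv * basisC) := by
        rw [basisCInv_mul_basisC, one_mul, mul_one]
    _ = _ := by simp only [mul_assoc]

lemma intRep_areConjugate_rho (u : Circle) : AreConjugate (intRep (Circle.toUnits u)) (rho u) :=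
  areConjugate_of_intertwining basisC basisCInv basisC_mul_basisCInv fun γ => by
    rw [coe_rho, mul_assoc _ basisCInv, basisCInv_mul_basisC, mul_one]

lemma continuous_intRep (γ : KnotGroup) :
    Continuous fun u : Circle => intRep (Circle.toUnits u) γ := by
  let S : Subgroup KnotGroup :=
    { carrier := {γ | Continuous fun u : Circle => intRep (Circle.toUnits u) γ}
      one_mem' := by
        change Continuous fun u : Circle => intRep (Circle.toUnits u) 1
        simp only [map_one]
        exact continuous_const
      mul_mem' := by
        intro a b (ha : Continuous _) (hb : Continuous _)
        change Continuous fun u : Circle => intRep (Circle.toUnits u) (a * b)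
        simp only [map_mul]
        exact ha.mul hb
      inv_mem' := by
        intro a (ha : Continuous _)
        change Continuous fun u : Circle => intRep (Circle.toUnits u) a⁻¹
        simp only [map_inv]
        exact ha.inv }
  refine subgroup_eq_top S ?_ ?_ γ
  · change Continuous fun u : Circle => intRep (Circle.toUnits u) genM
    simp only [intRep_genM]
    refine Continuous.subtype_mk (continuous_matrix fun i j => ?_) _
    fin_cases i <;> fin_cases j <;> simp [Circle.toUnits] <;> fun_prop
  · change Continuous fun u : Circle => intRep (Circle.toUnits u) genN
    simp only [intRep_genN]
    refine Continuous.subtype_mk (continuous_matrix fun i j => ?_) _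
    have hinv : Continuous fun u : Circle => (u : ℂ)⁻¹ := by
      simp only [← Circle.coe_inv]
      fun_prop
    fin_cases i <;> fin_cases j <;> simp [Circle.toUnits] <;> fun_prop

lemma continuous_rho (γ : KnotGroup) : Continuous fun u : Circle => rho u γ := by
  refine Continuous.subtype_mk ?_ _
  exact (continuous_const.matrix_mul
    (continuous_subtype_val.comp (continuous_intRep γ))).matrix_mul continuous_const

lemma hypRep_areConjugate_rho :
    AreConjugate (complexify.comp (SO31.subtype.comp hypRep)) (rho 1) := by
  refine AreConjugate.trans ?_ (intRep_areConjugate_rho 1)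
  have h : hypP.map Complex.ofRealHom * hypQ.map Complex.ofRealHom = 1 := by
    rw [← Matrix.map_mul, hypP_mul_hypQ, Matrix.map_one _ (map_zero _) (map_one _)]
  refine areConjugate_of_intertwining _ _ h fun γ => ?_
  rw [map_one, coe_intRep_one_complex]
  change _ * (hypRep γ).1.1.map Complex.ofRealHom = _
  rw [← Matrix.map_mul, ← Matrix.map_mul, intRep_eq_of_hypRep, mul_assoc, hypQ_mul_hypP, mul_one]

lemma trace_intRep_genM_mul_genN {R : Type*} [CommRing R] (u : Rˣ) :
    (intRep u (genM * genN)).1.trace = 6 + u := by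
  rw [map_mul, intRep_genM, intRep_genN, Matrix.SpecialLinearGroup.coe_mul]
  simp [trace, Fin.sum_univ_four, intM, intN]
  ring

lemma AreConjugate.trace_eq {Γ R n : Type} [Group Γ] [CommRing R] [Fintype n] [DecidableEq n]
    {ρ₁ ρ₂ : Γ →* Matrix.SpecialLinearGroup n R} (h : AreConjugate ρ₁ ρ₂) (γ : Γ) :
    (ρ₁ γ).1.trace = (ρ₂ γ).1.trace := by
  obtain ⟨g, hg⟩ := h
  rw [hg, Matrix.SpecialLinearGroup.coe_mul, Matrix.SpecialLinearGroup.coe_mul, trace_mul_comm,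
    ← mul_assoc, ← Matrix.SpecialLinearGroup.coe_mul, inv_mul_cancel,
    Matrix.SpecialLinearGroup.coe_one, one_mul]

lemma not_areConjugate_rho {u v : Circle} (huv : u ≠ v) : ¬ AreConjugate (rho u) (rho v) := by
  intro h
  have h' := ((intRep_areConjugate_rho u).trans (h.trans (intRep_areConjugate_rho v).symm)).trace_eq
    (genM * genN)
  rw [trace_intRep_genM_mul_genN, trace_intRep_genM_mul_genN] at h'
  exact huv (Circle.ext (add_left_cancel h'))

/-! ### Discreteness -/

lemma discreteTopology_range_rho {τ : ℂ} {c : ℤ} {h : τ * τ = -(c : ℂ) * τ - 1}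
    (hc : star τ = -(c : ℂ) - τ) {u : Circle} (hu : (u : ℂ) ∈ quadRing τ c h) :
    DiscreteTopology (rho u).range := by
  have hu' : ((u⁻¹ : Circle) : ℂ) ∈ quadRing τ c h := by
    rw [Circle.coe_inv_eq_conj]
    exact conj_mem_quadRing hc hu
  -- Inverses on the circle are conjugates, so `u` is a unit of the quadratic ring and the integral
  -- representation is defined over that ring.
  let v : (quadRing τ c h)ˣ := ⟨⟨u, hu⟩, ⟨_, hu'⟩, Subtype.ext (by simp), Subtype.ext (by simp)⟩
  refine discreteTopology_of_entries _ _ _ basisCInv_mul_basisC (quadRing τ c h) ?_ ?_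
  · intro x hx y hy hxy
    by_contra hne
    exact absurd (one_le_norm_quadRing hc (sub_mem hx hy) (sub_ne_zero.mpr hne)) hxy.not_ge
  · rintro _ ⟨γ, rfl⟩ i j
    rw [← intRep_eq_of_rho]
    have e : Circle.toUnits u = Units.map ((quadRing τ c h).subtype : _ →* ℂ) v := by
      ext
      rfl
    rw [e, ← map_comp_intRep]
    exact ((intRep v γ).1 i j).2

lemma star_I : star Complex.I = -((0 : ℤ) : ℂ) - Complex.I := by
  rw [Complex.star_def]
  simp

lemma I_mul_self : Complex.I * Complex.I = -((0 : ℤ) : ℂ) * Complex.I - 1 := by simp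

lemma discreteTopology_range_rho_exp {α : ℝ} (hα : α ∈ ({0, Real.pi, Real.pi / 2,
    -(Real.pi / 2), Real.pi / 3, -(Real.pi / 3), 2 * Real.pi / 3, -(2 * Real.pi / 3)} : Set ℝ)) :
    DiscreteTopology (rho (Circle.exp α)).range := by
  have hpi : Circle.exp (Real.pi / 2) = Complex.I := by
    rw [Circle.coe_exp]
    push_cast
    exact Complex.exp_pi_div_two_mul_I
  have hpi3 : ((Circle.exp (Real.pi / 3) : Circle) : ℂ) = 1 + omega := by
    rw [Circle.coe_exp, Complex.exp_mul_I, ← Complex.ofReal_cos, ← Complex.ofReal_sin,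
      Real.cos_pi_div_three, Real.sin_pi_div_three]
    apply Complex.ext
    · simp [omega]
      norm_num
    · simp [omega]
  have h2pi3 : ((Circle.exp (2 * Real.pi / 3) : Circle) : ℂ) = omega := by
    have : 2 * Real.pi / 3 = Real.pi / 3 + Real.pi / 3 := by ring
    rw [this, Circle.exp_add, Circle.coe_mul, hpi3]
    linear_combination omega_mul_self
  have hneg : ∀ {τ : ℂ} {c : ℤ} {h : τ * τ = -(c : ℂ) * τ - 1}, star τ = -(c : ℂ) - τ → ∀ {β : ℝ},
      (Circle.exp β : ℂ) ∈ quadRing τ c h → (Circle.exp (-β) : ℂ) ∈ quadRing τ c h := by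
    intro τ c h hc β hβ
    rw [Circle.exp_neg, Circle.coe_inv_eq_conj]
    exact conj_mem_quadRing hc hβ
  have mI : (Circle.exp (Real.pi / 2) : ℂ) ∈ quadRing _ _ I_mul_self := by
    rw [hpi]
    exact self_mem_quadRing
  have m3 : (Circle.exp (Real.pi / 3) : ℂ) ∈ eisenstein := by
    rw [hpi3]
    exact add_mem (one_mem _) self_mem_quadRing
  have m23 : (Circle.exp (2 * Real.pi / 3) : ℂ) ∈ eisenstein := by
    rw [h2pi3]
    exact self_mem_quadRing
  simp only [Set.mem_insert_iff, Set.mem_singleton_iff] at hα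
  rcases hα with rfl | rfl | rfl | rfl | rfl | rfl | rfl | rfl
  · refine discreteTopology_range_rho star_omega (h := omega_sq) ?_
    rw [Circle.exp_zero, Circle.coe_one]
    exact one_mem _
  · refine discreteTopology_range_rho star_omega (h := omega_sq) ?_
    rw [Circle.coe_exp, Complex.exp_pi_mul_I]
    exact neg_mem (one_mem _)
  · exact discreteTopology_range_rho star_I mI
  · exact discreteTopology_range_rho star_I (hneg star_I mI)
  · exact discreteTopology_range_rho star_omega m3
  · exact discreteTopology_range_rho star_omega (hneg star_omega m3)
  · exact discreteTopology_range_rho star_omega m23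
  · exact discreteTopology_range_rho star_omega (hneg star_omega m23)

/-! ### The invariant Hermitian form -/

/-- The coefficient `⟨f₂, f₃⟩` of the invariant form. -/
def formE (u : Circle) : ℂ := -(1 / ((u : ℂ) + 1))

/-- The coefficient `⟨f₁, f₄⟩` of the invariant form. -/
def formK (u : Circle) : ℂ := -(((u : ℂ) ^ 2 + u + 1) / ((u : ℂ) + 1))

/-- The invariant Hermitian form of `ρ_u`, in the integral basis. -/
def invForm (u : Circle) : Matrix (Fin 4) (Fin 4) ℂ :=
  !![0, 0, 0, formK u; 0, 1, formE u, 0; 0, star (formE u), 1, 0; star (formK u), 0, 0, 0]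

section
variable {u : Circle}

lemma conj_circle (u : Circle) : (starRingEnd ℂ) (u : ℂ) = (u : ℂ)⁻¹ := by
  rw [← Circle.coe_inv_eq_conj, Circle.coe_inv]

lemma star_formE (hu : (u : ℂ) + 1 ≠ 0) : star (formE u) = -(u / ((u : ℂ) + 1)) := by
  have h0 : (u : ℂ) ≠ 0 := u.coe_ne_zero
  rw [formE]
  simp only [star_neg, Complex.star_def, map_div₀, map_add, map_one, conj_circle]
  have e : (u : ℂ)⁻¹ + 1 = (u + 1) / u := by
    field_simp
    ring
  rw [e]
  field_simp

lemma star_formK (hu : (u : ℂ) + 1 ≠ 0) :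
    star (formK u) = -(((u : ℂ) ^ 2 + u + 1) / (u * ((u : ℂ) + 1))) := by
  have h0 : (u : ℂ) ≠ 0 := u.coe_ne_zero
  rw [formK]
  simp only [star_neg, Complex.star_def, map_div₀, map_add, map_one, map_pow, conj_circle]
  have e : (u : ℂ)⁻¹ + 1 = (u + 1) / u := by
    field_simp
    ring
  rw [e]
  field_simp
  ring

lemma intM_mem_invForm (hu : (u : ℂ) + 1 ≠ 0) :
    intM (Circle.toUnits u) ∈ specialIsometries (invForm u) := by
  have h0 : (u : ℂ) ≠ 0 := u.coe_ne_zero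
  rw [mem_specialIsometries, invForm, star_formE hu, star_formK hu, formE, formK]
  ext i j
  fin_cases i <;> fin_cases j <;>
    simp [intM, mul_apply, Fin.sum_univ_four, conj_circle] <;> field_simp <;> ring

lemma intN_mem_invForm (hu : (u : ℂ) + 1 ≠ 0) :
    intN (Circle.toUnits u) ∈ specialIsometries (invForm u) := by
  have h0 : (u : ℂ) ≠ 0 := u.coe_ne_zero
  rw [mem_specialIsometries, invForm, star_formE hu, star_formK hu, formE, formK]
  ext i j
  fin_cases i <;> fin_cases j <;>
    simp [intN, mul_apply, Fin.sum_univ_four, conj_circle] <;> field_simp <;> ring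

/-- A basis which diagonalizes the invariant form. -/
def diagBasis (u : Circle) (r q : ℝ) : Matrix (Fin 4) (Fin 4) ℂ :=
  !![0, 0, q / star (formK u), q / star (formK u); 1, -formE u * r, 0, 0; 0, r, 0, 0;
    0, 0, q, -q]

/-- Gram-Schmidt on f₂, f₃ produces norms 1 and `1 - |e|²`, the latter rescaled by `r`. The
isotropic vectors f₁, f₄, once their pairing is normalized, have a sum and a difference of norms `1`
and `-1`. -/
lemma diagBasis_form {r q ε : ℝ} (hK : formK u ≠ 0) (hq : q * q = 1 / 2)
    (hr : (1 - ‖formE u‖ ^ 2) * r ^ 2 = ε) :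
    (diagBasis u r q)ᴴ * invForm u * diagBasis u r q = diagonal ![1, (ε : ℂ), 1, -1] := by
  have hq' : (q : ℂ) * q = 1 / 2 := by
    rw [← Complex.ofReal_mul, hq]
    norm_num
  have hr' : (1 - formE u * (starRingEnd ℂ) (formE u)) * (r : ℂ) ^ 2 = ε := by
    rw [Complex.mul_conj']
    exact_mod_cast hr
  have hK' : (starRingEnd ℂ) (formK u) ≠ 0 := by simpa using hK
  rw [diagBasis, invForm]
  generalize formE u = e at *
  generalize formK u = k at *
  ext i j
  fin_cases i <;> fin_cases j <;> simp [mul_apply, Fin.sum_univ_four, diagonal] <;>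
    field_simp <;> grind

lemma exists_unitaryRep {J Q : Matrix (Fin 4) (Fin 4) ℂ} (hJJ : J * J = 1)
    (hJ : J = Qᴴ * invForm u * Q) (hu : (u : ℂ) + 1 ≠ 0) :
    ∃ σ : KnotGroup →* specialIsometries J,
      AreConjugate ((specialIsometries J).subtype.comp σ) (rho u) := by
  -- As `J` is an involution, `J = Qᴴ H Q` directly supplies an inverse of `Q`.
  have h : (J * Qᴴ * invForm u) * Q = 1 := by
    rw [mul_assoc, mul_assoc, ← mul_assoc Qᴴ, ← hJ, hJJ]
  refine ⟨unitaryRep (Circle.toUnits u) _ Q h hJ (intM_mem_invForm hu) (intN_mem_invForm hu), ?_⟩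
  refine AreConjugate.trans ?_ (intRep_areConjugate_rho u)
  have h' := mul_eq_one_comm.mp h
  refine areConjugate_of_intertwining Q _ h' fun γ => ?_
  rw [MonoidHom.comp_apply, Subgroup.coe_subtype, coe_unitaryRep, ← mul_assoc, ← mul_assoc, h',
    one_mul]

end

/-! ### The signature of the invariant form as a function of the angle -/

section
variable {α : ℝ}

lemma normSq_exp_add_one (α : ℝ) : ‖(Circle.exp α : ℂ) + 1‖ ^ 2 = 2 + 2 * Real.cos α := by
  rw [← Complex.normSq_eq_norm_sq, Complex.normSq_apply, Circle.coe_exp, Complex.exp_mul_I,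
    ← Complex.ofReal_cos, ← Complex.ofReal_sin]
  simp only [Complex.add_re, Complex.mul_re, Complex.add_im, Complex.mul_im, Complex.ofReal_re,
    Complex.ofReal_im, Complex.I_re, Complex.I_im, Complex.one_re, Complex.one_im]
  nlinarith [Real.sin_sq_add_cos_sq α]

lemma formK_mul_star (hu : (Circle.exp α : ℂ) + 1 ≠ 0) :
    formK (Circle.exp α) = -((1 + 2 * Real.cos α : ℝ) : ℂ) * Circle.exp α / (Circle.exp α + 1) := by
  have h0 : (Circle.exp α : ℂ) ≠ 0 := Circle.coe_ne_zero _
  have : ((2 * Real.cos α : ℝ) : ℂ) = Circle.exp α + (Circle.exp α : ℂ)⁻¹ := by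
    rw [← Circle.coe_inv, ← Circle.exp_neg, Circle.coe_exp, Circle.coe_exp]
    push_cast
    rw [Complex.two_cos, neg_mul]
  rw [formK, Complex.ofReal_add, this]
  field_simp
  push_cast
  ring

/-- The Gram determinant of f₂, f₃ has the sign of `1 + 2 cos α`; this sign distinguishes SU(3,1)
from SU(2,2). -/
lemma one_sub_norm_formE_sq (hu : (Circle.exp α : ℂ) + 1 ≠ 0) :
    (1 - ‖formE (Circle.exp α)‖ ^ 2) * (2 + 2 * Real.cos α) = 1 + 2 * Real.cos α := by
  have h : 2 + 2 * Real.cos α ≠ 0 := by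
    rw [← normSq_exp_add_one]
    positivity
  rw [formE, norm_neg, norm_div, norm_one, div_pow, normSq_exp_add_one, sub_mul, one_pow,
    one_div, inv_mul_cancel₀ h]
  ring

lemma formK_ne_zero (hu : (Circle.exp α : ℂ) + 1 ≠ 0) (hc : 1 + 2 * Real.cos α ≠ 0) :
    formK (Circle.exp α) ≠ 0 := by
  rw [formK_mul_star hu]
  exact div_ne_zero (mul_ne_zero (neg_ne_zero.mpr (Complex.ofReal_ne_zero.mpr hc))
    (Circle.coe_ne_zero _)) hu

lemma cos_two_pi_div_three : Real.cos (2 * Real.pi / 3) = -1 / 2 := by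
  have : 2 * Real.pi / 3 = Real.pi - Real.pi / 3 := by ring
  rw [this, Real.cos_pi_sub, Real.cos_pi_div_three]
  norm_num

lemma cos_gt_of_abs_lt (h : |α| < 2 * Real.pi / 3) : 0 < 1 + 2 * Real.cos α := by
  have hpi := Real.pi_pos
  have := Real.cos_lt_cos_of_nonneg_of_le_pi (abs_nonneg α) (by linarith) h
  rw [cos_two_pi_div_three, Real.cos_abs] at this
  linarith

lemma cos_lt_of_lt_abs (h : 2 * Real.pi / 3 < |α|) (h' : |α| < Real.pi) :
    1 + 2 * Real.cos α < 0 ∧ -1 < Real.cos α := by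
  have hpi := Real.pi_pos
  have h1 := Real.cos_lt_cos_of_nonneg_of_le_pi (by positivity) h'.le h
  have h2 := Real.cos_lt_cos_of_nonneg_of_le_pi (abs_nonneg α) le_rfl h'
  rw [cos_two_pi_div_three, Real.cos_abs] at h1
  rw [Real.cos_pi, Real.cos_abs] at h2
  exact ⟨by linarith, h2⟩

lemma exp_add_one_ne_zero (h : -1 < Real.cos α) : (Circle.exp α : ℂ) + 1 ≠ 0 := by
  intro h0
  have := normSq_exp_add_one α
  rw [h0, norm_zero] at this
  linarith

lemma inv_sqrt_two_mul_self : (1 / √2) * (1 / √2) = 1 / 2 := by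
  rw [div_mul_div_comm, one_mul, Real.mul_self_sqrt (by norm_num)]

lemma exists_SU31_rep (h : |α| < 2 * Real.pi / 3) :
    ∃ σ : KnotGroup →* SU31, AreConjugate (SU31.subtype.comp σ) (rho (Circle.exp α)) := by
  have hc := cos_gt_of_abs_lt h
  have hu := exp_add_one_ne_zero (α := α) (by linarith)
  have hD := one_sub_norm_formE_sq hu
  have hDpos : 0 < 1 - ‖formE (Circle.exp α)‖ ^ 2 := by
    by_contra hneg
    push Not at hneg
    nlinarith
  have hform := diagBasis_form (r := (√(1 - ‖formE (Circle.exp α)‖ ^ 2))⁻¹) (ε := 1)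
    (formK_ne_zero hu hc.ne') inv_sqrt_two_mul_self
    (by rw [inv_pow, Real.sq_sqrt hDpos.le, mul_inv_cancel₀ hDpos.ne'])
  rw [Complex.ofReal_one] at hform
  refine exists_unitaryRep ?_ hform.symm hu
  · ext i j
    fin_cases i <;> fin_cases j <;> simp

lemma exists_SU22_rep (h : 2 * Real.pi / 3 < |α|) (h' : |α| < Real.pi) :
    ∃ σ : KnotGroup →* SU22, AreConjugate (SU22.subtype.comp σ) (rho (Circle.exp α)) := by
  obtain ⟨hc, hc'⟩ := cos_lt_of_lt_abs h h'
  have hu := exp_add_one_ne_zero hc'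
  have hD := one_sub_norm_formE_sq hu
  have hDneg : 0 < -(1 - ‖formE (Circle.exp α)‖ ^ 2) := by
    by_contra hneg
    push Not at hneg
    nlinarith
  have hform := diagBasis_form (r := (√(-(1 - ‖formE (Circle.exp α)‖ ^ 2)))⁻¹) (ε := -1)
    (formK_ne_zero hu hc.ne) inv_sqrt_two_mul_self
    (by rw [inv_pow, Real.sq_sqrt hDneg.le, ← neg_inj, ← neg_mul, neg_neg,
      mul_inv_cancel₀ hDneg.ne'])
  generalize diagBasis (Circle.exp α) _ (1 / √2) = Q at hform
  -- The diagonalization has signs `1, -1, 1, -1`; exchanging the two middle basis vectors brings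
  -- them to the order `1, 1, -1, -1`.
  refine exists_unitaryRep (Q := Q.submatrix id (Equiv.swap 1 2)) ?_ ?_ hu
  · ext i j
    fin_cases i <;> fin_cases j <;> simp
  · have e : (Q.submatrix id (Equiv.swap 1 2))ᴴ * invForm (Circle.exp α) *
        Q.submatrix id (Equiv.swap 1 2) =
        (Qᴴ * invForm (Circle.exp α) * Q).submatrix (Equiv.swap 1 2) (Equiv.swap 1 2) := rfl
    rw [e, hform]
    ext i j
    fin_cases i <;> fin_cases j <;> simp [diagonal, Equiv.swap_apply_def]

end

/-! ### Fixed points of isometries -/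

/-- Multiplication of the last coordinate by `-1`, so that the Hermitian square of `z` is
`z* J z`. -/
abbrev lorentz : Matrix (Fin 4) (Fin 4) ℂ := diagonal ![1, 1, 1, -1]

lemma hermSq_eq (z : Fin 4 → ℂ) : (hermSq z : ℂ) = star z ⬝ᵥ (lorentz *ᵥ z) := by
  have e : ∀ w : ℂ, ((‖w‖ : ℝ) : ℂ) ^ 2 = star w * w := fun w => (Complex.conj_mul' w).symm
  rw [hermSq]
  push_cast
  rw [e, e, e, e]
  simp [dotProduct, Fin.sum_univ_four, mulVec_diagonal]
  ring

lemma hermSq_smul (c : ℂ) (z : Fin 4 → ℂ) : hermSq (c • z) = ‖c‖ ^ 2 * hermSq z := by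
  simp only [hermSq, Pi.smul_apply, smul_eq_mul, norm_mul]
  ring

lemma pairing_mulVec {n : ℕ} {J H P : Matrix (Fin n) (Fin n) ℂ} (h : Pᴴ * J * P = H)
    (x y : Fin n → ℂ) : star (P *ᵥ x) ⬝ᵥ (J *ᵥ (P *ᵥ y)) = star x ⬝ᵥ (H *ᵥ y) := by
  rw [← h, star_mulVec, ← dotProduct_mulVec, mulVec_mulVec, mulVec_mulVec]

lemma hermSq_mulVec (A : SU31) (z : Fin 4 → ℂ) : hermSq (A.1.1 *ᵥ z) = hermSq z := by
  have h : A.1.1ᴴ * lorentz * A.1.1 = lorentz := A.2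
  have : (hermSq (A.1.1 *ᵥ z) : ℂ) = hermSq z := by
    rw [hermSq_eq, hermSq_eq, pairing_mulVec h]
  exact_mod_cast this

lemma smul_eq_self_iff (A : SL4 ℂ) (p : ℙ ℂ (Fin 4 → ℂ)) :
    A • p = p ↔ ∃ c : ℂ, A.1 *ᵥ p.rep = c • p.rep := by
  have hne : A.1 *ᵥ p.rep ≠ 0 := by
    intro h0
    have h1 : (A⁻¹).1 * A.1 = 1 := by
      rw [← Matrix.SpecialLinearGroup.coe_mul, inv_mul_cancel, Matrix.SpecialLinearGroup.coe_one]
    apply p.rep_nonzero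
    rw [← one_mulVec p.rep, ← h1, ← mulVec_mulVec, h0, mulVec_zero]
  have h : A • p = Projectivization.mk ℂ (A.1 *ᵥ p.rep) hne := by
    conv_lhs => rw [← p.mk_rep]
    rfl
  rw [h]
  conv_lhs => rhs; rw [← p.mk_rep]
  rw [Projectivization.mk_eq_mk_iff']
  simp only [eq_comm]

lemma smul_mk_eq_self (A : SL4 ℂ) {z : Fin 4 → ℂ} (hz : z ≠ 0) {c : ℂ}
    (h : A.1 *ᵥ z = c • z) : A • Projectivization.mk ℂ z hz = Projectivization.mk ℂ z hz := by
  rw [smul_eq_self_iff]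
  obtain ⟨a, ha⟩ := Projectivization.exists_smul_eq_mk_rep ℂ z hz
  refine ⟨c, ?_⟩
  rw [← ha, Units.smul_def, mulVec_smul, h, smul_comm]

lemma mk_mem_hyperbolicBoundary {z : Fin 4 → ℂ} (hz : z ≠ 0) (h : hermSq z = 0) :
    Projectivization.mk ℂ z hz ∈ hyperbolicBoundary := by
  obtain ⟨a, ha⟩ := Projectivization.exists_smul_eq_mk_rep ℂ z hz
  change hermSq _ = 0
  rw [← ha, Units.smul_def, hermSq_smul, h, mul_zero]

/-- In `ℂ^{3,1}`, the orthogonal complement of a null vector contains no other nonpositive line. -/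
lemma exists_smul_of_orthogonal {p w : Fin 4 → ℂ} (hp0 : p ≠ 0) (hp : hermSq p = 0)
    (hpw : star p ⬝ᵥ (lorentz *ᵥ w) = 0) (hw : hermSq w ≤ 0) : ∃ c : ℂ, w = c • p := by
  have hp3 : p 3 ≠ 0 := by
    intro h3
    apply hp0
    simp only [hermSq, h3, norm_zero] at hp
    have h0 : ‖p 0‖ ^ 2 = 0 := by nlinarith [sq_nonneg ‖p 0‖, sq_nonneg ‖p 1‖, sq_nonneg ‖p 2‖]
    have h1 : ‖p 1‖ ^ 2 = 0 := by nlinarith [sq_nonneg ‖p 0‖, sq_nonneg ‖p 1‖, sq_nonneg ‖p 2‖]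
    have h2 : ‖p 2‖ ^ 2 = 0 := by nlinarith [sq_nonneg ‖p 0‖, sq_nonneg ‖p 1‖, sq_nonneg ‖p 2‖]
    ext i
    fin_cases i
    · simpa using h0
    · simpa using h1
    · simpa using h2
    · exact h3
  -- Subtracting this multiple of `p` kills the last coordinate. By orthogonality the norm is
  -- unchanged, so the difference is a nonpositive vector in a positive definite subspace.
  set c := w 3 / p 3 with hc
  refine ⟨c, ?_⟩
  set v := w - c • p with hv
  have hv3 : v 3 = 0 := by
    simp [hv, hc, hp3]
  have hsq : (hermSq v : ℂ) = hermSq w := by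
    have h1 : star p ⬝ᵥ (lorentz *ᵥ p) = 0 := by rw [← hermSq_eq, hp, Complex.ofReal_zero]
    have h2 : star w ⬝ᵥ (lorentz *ᵥ p) = 0 := by
      have := congrArg star hpw
      rw [star_zero] at this
      rw [← this]
      simp [dotProduct, Fin.sum_univ_four, mulVec_diagonal, mul_comm]
    rw [hermSq_eq, hermSq_eq, hv, mulVec_sub, mulVec_smul, star_sub, star_smul, sub_dotProduct,
      dotProduct_sub, dotProduct_sub, smul_dotProduct, smul_dotProduct, dotProduct_smul,
      dotProduct_smul, h1, h2, hpw]
    simp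
  have hsq' : hermSq v ≤ 0 := by
    have : hermSq v = hermSq w := by exact_mod_cast hsq
    rwa [this]
  simp only [hermSq, hv3, norm_zero] at hsq'
  have h0 : ‖v 0‖ ^ 2 = 0 := by nlinarith [sq_nonneg ‖v 0‖, sq_nonneg ‖v 1‖, sq_nonneg ‖v 2‖]
  have h1 : ‖v 1‖ ^ 2 = 0 := by nlinarith [sq_nonneg ‖v 0‖, sq_nonneg ‖v 1‖, sq_nonneg ‖v 2‖]
  have h2 : ‖v 2‖ ^ 2 = 0 := by nlinarith [sq_nonneg ‖v 0‖, sq_nonneg ‖v 1‖, sq_nonneg ‖v 2‖]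
  have hv0 : v = 0 := by
    ext i
    fin_cases i
    · simpa using h0
    · simpa using h1
    · simpa using h2
    · exact hv3
  exact sub_eq_zero.mp hv0

/-- A criterion for an isometry to be parabolic, in terms of a power of it. -/
lemma isParabolic_of_pow {A : SU31} (k : ℕ) {q : Fin 4 → ℂ} (hq0 : q ≠ 0) (hq : hermSq q = 0)
    {μ : ℂ} (hAq : (A ^ k).1.1 *ᵥ q = μ • q)
    (huniq : ∀ (w : Fin 4 → ℂ) (c : ℂ), (A ^ k).1.1 *ᵥ w = c • w → hermSq w ≤ 0 →
      ∃ d : ℂ, w = d • q) : IsParabolic A := by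
  have hpow : ∀ {w : Fin 4 → ℂ} {c : ℂ}, A.1.1 *ᵥ w = c • w → ∀ k : ℕ,
      (A ^ k).1.1 *ᵥ w = c ^ k • w := by
    intro w c h k
    induction k with
    | zero =>
      rw [pow_zero, pow_zero, one_smul]
      exact one_mulVec w
    | succ k ih =>
      rw [pow_succ, pow_succ]
      change ((A ^ k).1.1 * A.1.1) *ᵥ w = _
      rw [← mulVec_mulVec, h, mulVec_smul, ih, smul_smul, mul_comm]
  constructor
  · intro p hp hfix
    obtain ⟨c, hc⟩ := (smul_eq_self_iff _ _).mp hfix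
    have hp' : hermSq p.rep < 0 := hp
    obtain ⟨d, hd⟩ := huniq _ _ (hpow hc k) hp'.le
    rw [hd, hermSq_smul, hq, mul_zero] at hp'
    exact lt_irrefl _ hp'
  -- `A` commutes with its power, so it sends the unique null eigenline of the power to itself.
  · have hcomm : (A ^ k).1.1 *ᵥ (A.1.1 *ᵥ q) = μ • (A.1.1 *ᵥ q) := by
      have : (A ^ k).1.1 * A.1.1 = A.1.1 * (A ^ k).1.1 :=
        congrArg (fun B : SU31 => B.1.1) ((pow_succ A k).symm.trans (pow_succ' A k))
      rw [mulVec_mulVec, this, ← mulVec_mulVec, hAq, mulVec_smul]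
    obtain ⟨d, hd⟩ := huniq _ _ hcomm (by rw [hermSq_mulVec, hq])
    refine ⟨Projectivization.mk ℂ q hq0, ⟨mk_mem_hyperbolicBoundary hq0 hq,
      smul_mk_eq_self _ hq0 hd⟩, ?_⟩
    rintro p ⟨hp, hfix⟩
    obtain ⟨c, hc⟩ := (smul_eq_self_iff _ _).mp hfix
    have hp' : hermSq p.rep = 0 := hp
    obtain ⟨e, he⟩ := huniq _ _ (hpow hc k) hp'.le
    rw [← p.mk_rep, Projectivization.mk_eq_mk_iff']
    exact ⟨e, he.symm⟩

/-! ### Eigenvectors of the peripheral elements -/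

/-- Powers of a Jordan block of size two, acting on row vectors; the coefficient `k` is what detects
a nonzero exponent. -/
lemma vecMul_zpow {K : Type*} [Field K] {n : ℕ} {A : Matrix.SpecialLinearGroup (Fin n) K} {μ c : K}
    (hμ : μ ≠ 0) {e r : Fin n → K} (he : e ᵥ* A.1 = μ • e) (hr : r ᵥ* A.1 = μ • r + c • e)
    (k : ℤ) : r ᵥ* (A ^ k).1 = μ ^ k • r + (k * c * μ ^ (k - 1)) • e := by
  have hinv : A.1 * (A⁻¹).1 = 1 := by
    rw [← Matrix.SpecialLinearGroup.coe_mul, mul_inv_cancel, Matrix.SpecialLinearGroup.coe_one]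
  have he' : e ᵥ* (A⁻¹).1 = μ⁻¹ • e := by
    have h := congrArg (fun v => μ⁻¹ • (v ᵥ* (A⁻¹).1)) he
    simp only [vecMul_vecMul, hinv, vecMul_one, smul_vecMul, smul_smul, inv_mul_cancel₀ hμ,
      one_smul] at h
    exact h.symm
  have hr' : r ᵥ* (A⁻¹).1 = μ⁻¹ • r - (c * μ⁻¹ * μ⁻¹) • e := by
    have h := congrArg (fun v => μ⁻¹ • (v ᵥ* (A⁻¹).1)) hr
    simp only [vecMul_vecMul, hinv, vecMul_one, smul_vecMul, add_vecMul, smul_smul, smul_add,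
      inv_mul_cancel₀ hμ, one_smul, he'] at h
    rw [h, eq_sub_iff_add_eq]
    congr 2
    ring
  induction k using Int.induction_on with
  | zero => simp
  | succ k ih =>
    rw [_root_.zpow_add_one, Matrix.SpecialLinearGroup.coe_mul, ← vecMul_vecMul, ih, add_vecMul,
      smul_vecMul, smul_vecMul, he, hr, smul_add, smul_smul, smul_smul, smul_smul, add_assoc,
      ← add_smul, zpow_add_one₀ hμ]
    congr 2
    rw [add_sub_cancel_right, mul_assoc _ _ μ, ← zpow_add_one₀ hμ, sub_add_cancel]
    push_cast
    ring
  | pred k ih =>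
    rw [_root_.zpow_sub_one, Matrix.SpecialLinearGroup.coe_mul, ← vecMul_vecMul, ih, add_vecMul,
      smul_vecMul, smul_vecMul, he', hr', smul_sub, smul_smul, smul_smul, smul_smul, sub_eq_add_neg,
      ← neg_smul, add_assoc, ← add_smul, zpow_sub_one₀ hμ]
    congr 2
    rw [zpow_sub_one₀ hμ, zpow_sub_one₀ hμ]
    push_cast
    ring

lemma vecMul_zpow_eigen {K : Type*} [Field K] {n : ℕ} {A : Matrix.SpecialLinearGroup (Fin n) K}
    {μ : K} (hμ : μ ≠ 0) {e : Fin n → K} (he : e ᵥ* A.1 = μ • e) (k : ℤ) :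
    e ᵥ* (A ^ k).1 = μ ^ k • e := by
  have := vecMul_zpow hμ (c := 0) he (by rw [he, zero_smul, add_zero]) k
  rwa [mul_zero, zero_mul, zero_smul, add_zero] at this

lemma mulVec_zpow_eigen {K : Type*} [Field K] {n : ℕ} {A : Matrix.SpecialLinearGroup (Fin n) K}
    {μ : K} (hμ : μ ≠ 0) {e : Fin n → K} (he : A.1 *ᵥ e = μ • e) (k : ℤ) :
    (A ^ k).1 *ᵥ e = μ ^ k • e := by
  have hinv : (A⁻¹).1 * A.1 = 1 := by
    rw [← Matrix.SpecialLinearGroup.coe_mul, inv_mul_cancel, Matrix.SpecialLinearGroup.coe_one]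
  have he' : (A⁻¹).1 *ᵥ e = μ⁻¹ • e := by
    have h := congrArg (fun v => μ⁻¹ • ((A⁻¹).1 *ᵥ v)) he
    simp only [mulVec_mulVec, hinv, one_mulVec, mulVec_smul, smul_smul, inv_mul_cancel₀ hμ,
      one_smul] at h
    exact h.symm
  induction k using Int.induction_on with
  | zero => simp
  | succ k ih =>
    rw [_root_.zpow_add_one, Matrix.SpecialLinearGroup.coe_mul, ← mulVec_mulVec, he, mulVec_smul,
      ih, smul_smul, zpow_add_one₀ hμ, mul_comm]
  | pred k ih =>
    rw [_root_.zpow_sub_one, Matrix.SpecialLinearGroup.coe_mul, ← mulVec_mulVec, he', mulVec_smul,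
      ih, smul_smul, zpow_sub_one₀ hμ, mul_comm]

section
variable {K : Type} [Field K] [CharZero K] {u : Kˣ}

/-- The row `e4` is a common left eigenvector, so `v 3 ≠ 0` forces the eigenvalue `u ^ b`. The row
`e3` then completes a Jordan block for the meridian and forces `a = 0`; after that the row `z` does
the same for the longitude and forces `b = 0`. -/
lemma peripheral_eigenvector_last (hu : (u : K) + 1 ≠ 0) {a b : ℤ} (hab : a ≠ 0 ∨ b ≠ 0)
    {v : Fin 4 → K} {μ : K} (hv : (intRep u (genM ^ a * longitude ^ b)).1 *ᵥ v = μ • v) :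
    v 3 = 0 := by
  have h0 : (u : K) ≠ 0 := u.ne_zero
  have hx : (u : K) * (↑u⁻¹ : K) = 1 := u.mul_inv
  let e3 : Fin 4 → K := ![0, 0, 1, 0]
  let e4 : Fin 4 → K := ![0, 0, 0, 1]
  let z : Fin 4 → K := ![u - 1, u, 0, 0]
  have hM4 : e4 ᵥ* (intM u).1 = (1 : K) • e4 := by
    ext i
    fin_cases i <;> simp [e4, intM, vecMul, dotProduct, Fin.sum_univ_four]
  have hM3 : e3 ᵥ* (intM u).1 = (1 : K) • e3 + ((u : K) + 1) • e4 := by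
    ext i
    fin_cases i <;> simp [e3, e4, intM, vecMul, dotProduct, Fin.sum_univ_four]
  have hL4 : e4 ᵥ* (intRep u longitude).1 = (u : K) • e4 := by
    rw [coe_longitude]
    ext i
    fin_cases i <;> simp [e4, vecMul, dotProduct, Fin.sum_univ_four]
  have hL3 : e3 ᵥ* (intRep u longitude).1 = (u : K) • e3 := by
    rw [coe_longitude]
    ext i
    fin_cases i <;> simp [e3, vecMul, dotProduct, Fin.sum_univ_four]
  have hLz : z ᵥ* (intRep u longitude).1 = (u : K) • z + (6 * (u : K) ^ 2) • e4 := by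
    rw [coe_longitude]
    generalize (↑u⁻¹ : K) = x at *
    ext i
    fin_cases i <;> simp [z, e4, vecMul, dotProduct, Fin.sum_univ_four] <;> grind
  have hA : (intRep u (genM ^ a * longitude ^ b)).1 =
      (intM u ^ a).1 * (intRep u longitude ^ b).1 := by
    rw [map_mul, map_zpow, map_zpow, intRep_genM, Matrix.SpecialLinearGroup.coe_mul]
  have hb0 : (u : K) ^ b ≠ 0 := zpow_ne_zero _ h0
  have key : ∀ r : Fin 4 → K, (r ᵥ* (intM u ^ a).1 ᵥ* (intRep u longitude ^ b).1) ⬝ᵥ v =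
      μ * (r ⬝ᵥ v) := by
    intro r
    rw [vecMul_vecMul, ← hA, ← dotProduct_mulVec, hv, dotProduct_smul, smul_eq_mul]
  by_contra hv3
  have k4 := key e4
  rw [vecMul_zpow_eigen one_ne_zero hM4, _root_.one_zpow, one_smul, vecMul_zpow_eigen h0 hL4,
    smul_dotProduct, smul_eq_mul] at k4
  have d4 : e4 ⬝ᵥ v = v 3 := by simp [e4, dotProduct, Fin.sum_univ_four]
  rw [d4] at k4
  have hμ : μ = (u : K) ^ b := (mul_right_cancel₀ hv3 k4).symm
  subst hμ
  have ha : a = 0 := by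
    have k3 := key e3
    rw [vecMul_zpow one_ne_zero hM4 hM3, add_vecMul, smul_vecMul, smul_vecMul,
      vecMul_zpow_eigen h0 hL4, vecMul_zpow_eigen h0 hL3, _root_.one_zpow, _root_.one_zpow, one_smul, mul_one,
      add_dotProduct, smul_dotProduct, smul_dotProduct, smul_dotProduct, d4] at k3
    simp only [smul_eq_mul, add_eq_left] at k3
    simpa [hu, hb0, hv3] using k3
  have hb : b = 0 := by
    have kz := key z
    rw [ha, zpow_zero, Matrix.SpecialLinearGroup.coe_one, vecMul_one, vecMul_zpow h0 hL4 hLz,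
      add_dotProduct, smul_dotProduct, smul_dotProduct, d4] at kz
    simp only [smul_eq_mul, add_eq_left] at kz
    have h6 : (6 : K) ≠ 0 := by norm_num
    have hb1 : (u : K) ^ (b - 1) ≠ 0 := zpow_ne_zero _ h0
    simpa [hb1, hv3] using kz
  exact hab.elim (fun h => h ha) (fun h => h hb)

lemma peripheral_mulVec_first (a b : ℤ) :
    (intRep u (genM ^ a * longitude ^ b)).1 *ᵥ Pi.single 0 1 =
      (u : K) ^ b • (Pi.single 0 1 : Fin 4 → K) := by
  have h0 : (u : K) ≠ 0 := u.ne_zero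
  have hM : (intM u).1 *ᵥ Pi.single 0 1 = (1 : K) • (Pi.single 0 1 : Fin 4 → K) := by
    ext i
    fin_cases i <;> simp [intM]
  have hL : (intRep u longitude).1 *ᵥ Pi.single 0 1 = (u : K) • (Pi.single 0 1 : Fin 4 → K) := by
    rw [coe_longitude]
    ext i
    fin_cases i <;> simp
  rw [map_mul, map_zpow, map_zpow, intRep_genM, Matrix.SpecialLinearGroup.coe_mul,
    ← mulVec_mulVec, mulVec_zpow_eigen h0 hL, mulVec_smul, mulVec_zpow_eigen one_ne_zero hM,
    _root_.one_zpow, one_smul]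

end

/-- The first basis vector spans the kernel of the restriction of every invariant form to the
first three basis vectors. -/
lemma invariant_form_first_row {u : ℂˣ} (hu : (u : ℂ) + 1 ≠ 0) {H : Matrix (Fin 4) (Fin 4) ℂ}
    (hM : intM u ∈ specialIsometries H) : H 0 0 = 0 ∧ H 0 1 = 0 ∧ H 0 2 = 0 := by
  rw [mem_specialIsometries] at hM
  have h02 := congrFun (congrFun hM 0) 2
  have h21 := congrFun (congrFun hM 2) 1
  have h03 := congrFun (congrFun hM 0) 3
  simp [intM, mul_apply, Fin.sum_univ_four] at h02 h21 h03
  have h00 : H 0 0 = 0 := by linear_combination h02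
  have h01 : H 0 1 = 0 := by linear_combination h21
  refine ⟨h00, h01, ?_⟩
  have : ((u : ℂ) + 1) * H 0 2 = 0 := by linear_combination h03 - u * h00 - h01
  exact (mul_eq_zero.mp this).resolve_left hu

/-! ### Parabolic elements are peripheral -/

lemma slRep_mul_mulVec (γ δ : KnotGroup) (v : Fin 2 → ℂ) :
    (slRep (γ * δ)).1 *ᵥ v = (slRep γ).1 *ᵥ ((slRep δ).1 *ᵥ v) := by
  rw [map_mul, mulVec_mulVec]
  rfl

/-- The cusp is unique: every Eisenstein point of the Riemann sphere is equivalent to infinity. -/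
lemma exists_mulVec_second_eq_zero (v : Fin 2 → ℂ) (h0 : v 0 ∈ eisenstein)
    (h1 : v 1 ∈ eisenstein) : ∃ δ, ((slRep δ).1 *ᵥ v) 1 = 0 ∧
      ((slRep δ).1 *ᵥ v) 0 ∈ eisenstein := by
  obtain ⟨k, hk⟩ := normSq_quadRing star_omega h1
  induction k using Nat.strong_induction_on generalizing v with
  | _ k ih =>
    by_cases hv : v 1 = 0
    · exact ⟨1, by simpa using hv, by simpa using h0⟩
    -- Euclidean descent: the new second coordinate is `(c z + d) v₁` with `|c z + d|² ≤ 7/16`, so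
    -- its integral norm drops strictly.
    · obtain ⟨δ, -, hδ⟩ := exists_isometricSphere (v 0 / v 1)
      have e0 : ((slRep δ).1 *ᵥ v) 0 ∈ eisenstein := by
        simp only [mulVec, dotProduct, Fin.sum_univ_two]
        exact add_mem (mul_mem (slRep_mem_eisenstein δ 0 0) h0)
          (mul_mem (slRep_mem_eisenstein δ 0 1) h1)
      have e1 : ((slRep δ).1 *ᵥ v) 1 ∈ eisenstein := by
        simp only [mulVec, dotProduct, Fin.sum_univ_two]
        exact add_mem (mul_mem (slRep_mem_eisenstein δ 1 0) h0)
          (mul_mem (slRep_mem_eisenstein δ 1 1) h1)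
      obtain ⟨l, hl⟩ := normSq_quadRing star_omega e1
      have hlt : l < k := by
        have e : ((slRep δ).1 *ᵥ v) 1 =
            ((slRep δ).1 1 0 * (v 0 / v 1) + (slRep δ).1 1 1) * v 1 := by
          simp only [mulVec, dotProduct, Fin.sum_univ_two]
          field_simp
        rw [e, norm_mul, mul_pow, hk] at hl
        have hkpos : (0 : ℝ) < k := by
          rw [← hk]
          positivity
        have : (l : ℝ) < k := by
          rw [← hl]
          nlinarith
        exact_mod_cast this
      obtain ⟨δ', h, h'⟩ := ih l hlt _ e0 e1 hl
      refine ⟨δ' * δ, ?_, ?_⟩ <;> rwa [slRep_mul_mulVec]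

/-- The double eigenvalue is `±1`, so the eigenvector can be read off the first row of `g - ε` with
Eisenstein entries, as the descent requires. -/
lemma exists_eigenvector_of_trace {γ : KnotGroup} {ε : ℂ} (hε : ε * ε = 1)
    (hεm : ε ∈ eisenstein) (htr : (slRep γ).1 0 0 + (slRep γ).1 1 1 = 2 * ε) :
    ∃ v : Fin 2 → ℂ, v ≠ 0 ∧ v 0 ∈ eisenstein ∧ v 1 ∈ eisenstein ∧
      (slRep γ).1 *ᵥ v = ε • v := by
  have hdet : (slRep γ).1.det = 1 := (slRep γ).2
  rw [det_fin_two] at hdet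
  by_cases h : (slRep γ).1 0 1 = 0 ∧ (slRep γ).1 0 0 = ε
  · refine ⟨![0, 1], fun h0 => one_ne_zero (congrFun h0 1), zero_mem _, one_mem _, ?_⟩
    ext i
    fin_cases i
    · simp [mulVec, dotProduct, h.1]
    · simp [mulVec, dotProduct]
      linear_combination htr - h.2
  · refine ⟨![(slRep γ).1 0 1, ε - (slRep γ).1 0 0], fun h0 => h ⟨congrFun h0 0, ?_⟩,
      slRep_mem_eisenstein γ 0 1, sub_mem hεm (slRep_mem_eisenstein γ 0 0), ?_⟩
    · exact (sub_eq_zero.mp (congrFun h0 1)).symm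
    · ext i
      fin_cases i
      · simp [mulVec, dotProduct]
        ring
      · simp [mulVec, dotProduct]
        linear_combination -hdet + ε * htr + hε

/-- A nontrivial element with trace `± 2` is peripheral, up to conjugation and passing to a
power. -/
lemma exists_conj_peripheral {γ : KnotGroup} (hγ : γ ≠ 1)
    (htr : ((slRep γ).1 0 0 + (slRep γ).1 1 1) ^ 2 = 4) :
    ∃ (δ : KnotGroup) (a b : ℤ), (a ≠ 0 ∨ b ≠ 0) ∧
      δ * γ ^ 4 * δ⁻¹ = genM ^ a * longitude ^ b := by
  have h : ∃ ε ∈ eisenstein, ε * ε = 1 ∧ (slRep γ).1 0 0 + (slRep γ).1 1 1 = 2 * ε := by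
    have : ((slRep γ).1 0 0 + (slRep γ).1 1 1 - 2) * ((slRep γ).1 0 0 + (slRep γ).1 1 1 + 2) = 0 := by
      linear_combination htr
    rcases mul_eq_zero.mp this with h | h
    · exact ⟨1, one_mem _, one_mul 1, by linear_combination h⟩
    · exact ⟨-1, neg_mem (one_mem _), by norm_num, by linear_combination h⟩
  obtain ⟨ε, hεm, hε, htr⟩ := h
  obtain ⟨v, hv, hv0, hv1, hfix⟩ := exists_eigenvector_of_trace hε hεm htr
  obtain ⟨δ, h1, h0⟩ := exists_mulVec_second_eq_zero v hv0 hv1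
  set x := ((slRep δ).1 *ᵥ v) 0 with hx
  have hw : (slRep δ).1 *ᵥ v = ![x, 0] := by
    ext i
    fin_cases i
    exacts [rfl, h1]
  have hcancel : (slRep δ⁻¹).1 *ᵥ ((slRep δ).1 *ᵥ v) = v := by
    rw [← slRep_mul_mulVec, inv_mul_cancel, map_one, Matrix.SpecialLinearGroup.coe_one, one_mulVec]
  have hx0 : x ≠ 0 := by
    intro hx0
    apply hv
    rw [← hcancel, hw, hx0]
    ext i
    fin_cases i <;> simp [mulVec, dotProduct]
  have hconj : (slRep (δ * γ * δ⁻¹)).1 *ᵥ ![x, 0] = ε • ![x, 0] := by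
    rw [slRep_mul_mulVec, slRep_mul_mulVec, ← hw, hcancel, hfix, mulVec_smul]
  set B := slRep (δ * γ * δ⁻¹) with hB
  have hB00 : B.1 0 0 = ε := by
    have := congrFun hconj 0
    simp [mulVec, dotProduct] at this
    exact this.resolve_right hx0
  have hB10 : B.1 1 0 = 0 := by
    have := congrFun hconj 1
    simp [mulVec, dotProduct] at this
    exact this.resolve_right hx0
  have hB11 : B.1 1 1 = ε := by
    have hdet : B.1.det = 1 := B.2
    rw [det_fin_two, hB00, hB10] at hdet
    linear_combination ε * hdet - B.1 1 1 * hε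
  have htrans : IsTranslation B (ε * B.1 0 1) := by
    refine ⟨ε, hε, ?_⟩
    rw [← mul_assoc, hε, one_mul, ← hB00]
    ext i j
    fin_cases i <;> fin_cases j
    exacts [rfl, rfl, hB10, hB11.trans hB00.symm]
  obtain ⟨p, q, hpq⟩ : ε * B.1 0 1 ∈ eisenstein :=
    mul_mem hεm (slRep_mem_eisenstein _ 0 1)
  have hpow := htrans.zpow 4
  rw [hB, ← map_zpow, hpq] at hpow
  -- The peripheral translations contain four times every Eisenstein integer: `4(p + q ω) = (4p -
  -- 2q) + q(2 + 4ω)`. Hence the fourth power.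
  have heq : (δ * γ * δ⁻¹) ^ (4 : ℤ) = genM ^ (4 * p - 2 * q) * longitude ^ q := by
    refine eq_of_isTranslation hpow ?_
    convert isTranslation_peripheral (4 * p - 2 * q) q using 1
    push_cast
    ring
  have hpow4 : (δ * γ * δ⁻¹) ^ (4 : ℤ) = δ * γ ^ 4 * δ⁻¹ := by
    rw [conj_zpow]
    norm_cast
  refine ⟨δ, 4 * p - 2 * q, q, ?_, hpow4 ▸ heq⟩
  by_contra hcon
  push Not at hcon
  rw [hpow4, hcon.1, hcon.2, zpow_zero, zpow_zero, mul_one, conj_eq_one_iff] at heq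
  exact hγ (knotGroup_torsionFree γ 4 (by norm_num) heq)

/-- The Lorentz form pulled back to the integral basis is some form `H` invariant under `intM`; no
uniqueness of `H` is needed. Eigenvectors of the peripheral power are `H`-orthogonal to the null
vector f₁, and signature (3,1) leaves no other nonpositive eigenline. -/
lemma isParabolic_of_trace {u : Circle} (hu : (u : ℂ) + 1 ≠ 0) {σ : KnotGroup →* SU31}
    (hσ : AreConjugate (SU31.subtype.comp σ) (rho u)) {γ : KnotGroup} (hγ : γ ≠ 1)
    (htr : ((slRep γ).1 0 0 + (slRep γ).1 1 1) ^ 2 = 4) : IsParabolic (σ γ) := by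
  obtain ⟨g, hg⟩ := hσ.trans (intRep_areConjugate_rho u).symm
  obtain ⟨δ, a, b, hab, hpow⟩ := exists_conj_peripheral hγ htr
  have hg1 : g.1 * (g⁻¹).1 = 1 := by
    rw [← Matrix.SpecialLinearGroup.coe_mul, mul_inv_cancel, Matrix.SpecialLinearGroup.coe_one]
  set H := (g⁻¹).1ᴴ * lorentz * (g⁻¹).1 with hH
  have hM : intM (Circle.toUnits u) ∈ specialIsometries H := by
    rw [← intRep_genM, hg]
    exact conjHom_mem_specialIsometries hg1 hH (σ genM).2
  obtain ⟨h00, h01, h02⟩ := invariant_form_first_row hu hM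
  have hrow : ∀ v : Fin 4 → ℂ, v 3 = 0 →
      star ((g⁻¹).1 *ᵥ Pi.single 0 1) ⬝ᵥ (lorentz *ᵥ ((g⁻¹).1 *ᵥ v)) = 0 := by
    intro v hv
    rw [pairing_mulVec hH.symm]
    simp [dotProduct, mulVec, Fin.sum_univ_four, h00, h01, h02, hv]
  set A := intRep (Circle.toUnits u) (genM ^ a * longitude ^ b) with hA
  have hAσ : σ γ ^ 4 = (σ δ)⁻¹ * σ (genM ^ a * longitude ^ b) * σ δ := by
    rw [← hpow]
    simp only [map_mul, map_inv, map_pow]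
    group
  have hAg : (SU31.subtype.comp σ) (genM ^ a * longitude ^ b) = g⁻¹ * A * g := by
    rw [hA, hg]
    group
  have hT : (σ γ ^ 4).1 = (g * (σ δ).1)⁻¹ * A * (g * (σ δ).1) := by
    rw [hAσ]
    change (σ δ).1⁻¹ * (SU31.subtype.comp σ) (genM ^ a * longitude ^ b) * (σ δ).1 = _
    rw [hAg]
    group
  set B : SL4 ℂ := g * (σ δ).1 with hBdef
  have hBinv : (B⁻¹).1 * B.1 = 1 := by
    rw [← Matrix.SpecialLinearGroup.coe_mul, inv_mul_cancel, Matrix.SpecialLinearGroup.coe_one]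
  have hBinv' : B.1 * (B⁻¹).1 = 1 := mul_eq_one_comm.mp hBinv
  have hT' : (σ γ ^ 4).1.1 = (B⁻¹).1 * A.1 * B.1 := by
    rw [hT, Matrix.SpecialLinearGroup.coe_mul, Matrix.SpecialLinearGroup.coe_mul]
  have hBsplit : ∀ v, (B⁻¹).1 *ᵥ v = ((σ δ)⁻¹).1.1 *ᵥ ((g⁻¹).1 *ᵥ v) := by
    intro v
    rw [hBdef, _root_.mul_inv_rev, Matrix.SpecialLinearGroup.coe_mul, ← mulVec_mulVec]
    rfl
  set e : Fin 4 → ℂ := Pi.single 0 1 with he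
  have hp0 : (g⁻¹).1 *ᵥ e ≠ 0 := by
    intro h0
    have : g.1 *ᵥ ((g⁻¹).1 *ᵥ e) = 0 := by rw [h0, mulVec_zero]
    rw [mulVec_mulVec, hg1, one_mulVec] at this
    simpa [he] using congrFun this 0
  have hpnull : hermSq ((g⁻¹).1 *ᵥ e) = 0 := by
    have := hrow e (by simp [he])
    rw [← hermSq_eq] at this
    exact_mod_cast this
  have hq0 : (B⁻¹).1 *ᵥ e ≠ 0 := by
    intro h0
    have : B.1 *ᵥ ((B⁻¹).1 *ᵥ e) = 0 := by rw [h0, mulVec_zero]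
    rw [mulVec_mulVec, hBinv', one_mulVec] at this
    simpa [he] using congrFun this 0
  refine isParabolic_of_pow 4 (q := (B⁻¹).1 *ᵥ e) hq0 ?_ (μ := (Circle.toUnits u : ℂ) ^ b) ?_ ?_
  · rw [hBsplit, hermSq_mulVec, hpnull]
  · rw [hT', mulVec_mulVec, mul_assoc, hBinv', mul_one, ← mulVec_mulVec, hA,
      peripheral_mulVec_first, mulVec_smul]
  · intro w c hw hwneg
    have hAw : A.1 *ᵥ (B.1 *ᵥ w) = c • (B.1 *ᵥ w) := by
      have := congrArg (fun v => B.1 *ᵥ v) hw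
      simp only [hT', mulVec_smul] at this
      rw [← this, mulVec_mulVec, mulVec_mulVec, ← mul_assoc, ← mul_assoc, hBinv', one_mul]
    have h3 := peripheral_eigenvector_last hu hab hAw
    have hgB : (g⁻¹).1 *ᵥ (B.1 *ᵥ w) = (σ δ).1.1 *ᵥ w := by
      rw [mulVec_mulVec, ← Matrix.SpecialLinearGroup.coe_mul, hBdef, inv_mul_cancel_left]
    have horth := hrow _ h3
    rw [hgB] at horth
    obtain ⟨d, hd⟩ := exists_smul_of_orthogonal hp0 hpnull horth (by rwa [hermSq_mulVec])
    refine ⟨d, ?_⟩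
    rw [hBsplit, ← mulVec_smul, ← hd, mulVec_mulVec, ← Matrix.SpecialLinearGroup.coe_mul,
      ← Subgroup.coe_mul, inv_mul_cancel, Subgroup.coe_one, Matrix.SpecialLinearGroup.coe_one,
      one_mulVec]

/-! ### Fixed points of the hyperbolic representation -/

lemma hypRep_areConjugate_rho' : AreConjugate (SU31.subtype.comp (SO31toSU31.comp hypRep)) (rho 1) :=
  hypRep_areConjugate_rho

lemma smul_hypRep_eq_self_iff (γ : KnotGroup) (p : ℙ ℂ (Fin 4 → ℂ)) :
    (SO31toSU31.comp hypRep γ : SL4 ℂ) • p = p ↔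
      ∃ c : ℂ, (slRep γ).1 * herm p.rep * (slRep γ).1ᴴ = c • herm p.rep := by
  rw [smul_eq_self_iff]
  refine exists_congr fun c => ?_
  rw [← herm_hypMat, ← herm_smul, herm_injective.eq_iff]
  rfl

lemma exists_eigenvector {A : Matrix (Fin 2) (Fin 2) ℂ} (hdet : A.det = 1) {x : ℂ}
    (hx : x * x - (A 0 0 + A 1 1) * x + 1 = 0) : ∃ v, v ≠ 0 ∧ A *ᵥ v = x • v := by
  have h : (A - x • 1).det = 0 := by
    rw [det_fin_two] at *
    simp
    linear_combination hx + hdet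
  obtain ⟨v, hv, hv'⟩ := exists_mulVec_eq_zero_iff.mpr h
  refine ⟨v, hv, ?_⟩
  rwa [sub_mulVec, smul_mulVec, one_mulVec, sub_eq_zero] at hv'

lemma exists_roots (t : ℂ) : ∃ x y : ℂ, x + y = t ∧ x * y = 1 ∧ (x - y) ^ 2 = t ^ 2 - 4 := by
  obtain ⟨s, hs⟩ := IsAlgClosed.exists_pow_nat_eq (t ^ 2 - 4) (n := 2) (by norm_num)
  refine ⟨(t + s) / 2, (t - s) / 2, by ring, ?_, ?_⟩
  · linear_combination -hs / 4
  · linear_combination hs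

lemma hermSq_of_herm_eq_vecMulVec {x : Fin 4 → ℂ} {v : Fin 2 → ℂ}
    (h : herm x = vecMulVec v (star v)) : hermSq x = 0 := by
  have h00 := congrFun (congrFun h 0) 0
  have h01 := congrFun (congrFun h 0) 1
  have h10 := congrFun (congrFun h 1) 0
  have h11 := congrFun (congrFun h 1) 1
  simp only [herm, of_apply, cons_val', cons_val_zero, cons_val_one, cons_val_fin_one,
    vecMulVec_apply, Pi.star_apply] at h00 h01 h10 h11
  have hI : Complex.I * Complex.I = -1 := Complex.I_mul_I
  have c00 := congrArg star h00
  have c01 := congrArg star h01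
  have c10 := congrArg star h10
  have c11 := congrArg star h11
  simp only [star_add, star_sub, star_mul', Complex.star_def, Complex.conj_I] at *
  have : (hermSq x : ℂ) = 0 := by
    rw [hermSq_eq]
    simp [dotProduct, Fin.sum_univ_four, mulVec_diagonal]
    grind
  exact_mod_cast this

/-- If the trace is not `±2`, there are two independent eigenvectors `v`, and the rank-one matrices
`v vᴴ` give two distinct fixed points on the boundary. -/
lemma trace_sq_of_isParabolic {γ : KnotGroup} (h : IsParabolic (SO31toSU31.comp hypRep γ)) :
    γ ≠ 1 ∧ ((slRep γ).1 0 0 + (slRep γ).1 1 1) ^ 2 = 4 := by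
  obtain ⟨hneg, huniq⟩ := h
  constructor
  · rintro rfl
    have hx : (Pi.single 3 1 : Fin 4 → ℂ) ≠ 0 := by simp
    obtain ⟨a, ha⟩ := Projectivization.exists_smul_eq_mk_rep ℂ _ hx
    refine hneg (Projectivization.mk ℂ _ hx) ?_ (by rw [map_one]; exact one_smul _ _)
    change hermSq _ < 0
    rw [← ha, Units.smul_def, hermSq_smul]
    have : 0 < ‖(a : ℂ)‖ := norm_pos_iff.mpr a.ne_zero
    simp [hermSq]
  · by_contra htr
    obtain ⟨x, y, hsum, hprod, hdiff⟩ := exists_roots ((slRep γ).1 0 0 + (slRep γ).1 1 1)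
    have hxy : x ≠ y := by
      rintro rfl
      apply htr
      linear_combination -hdiff
    have hdet : (slRep γ).1.det = 1 := (slRep γ).2
    obtain ⟨v, hv, hgv⟩ := exists_eigenvector hdet (x := x) (by rw [← hsum]; linear_combination -hprod)
    obtain ⟨w, hw, hgw⟩ := exists_eigenvector hdet (x := y) (by rw [← hsum]; linear_combination -hprod)
    have hfix : ∀ {v : Fin 2 → ℂ} {x : ℂ}, v ≠ 0 → (slRep γ).1 *ᵥ v = x • v →
        ∃ p : ℙ ℂ (Fin 4 → ℂ), (p ∈ hyperbolicBoundary ∧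
          (SO31toSU31.comp hypRep γ : SL4 ℂ) • p = p) ∧
          ∃ c : ℂ, c ≠ 0 ∧ herm p.rep = c • vecMulVec v (star v) := by
      intro v x hv hgv
      obtain ⟨z, hz⟩ := herm_surjective (vecMulVec v (star v))
      have hz0 : z ≠ 0 := by
        rintro rfl
        rw [herm_zero] at hz
        apply hv
        ext i
        have := congrFun (congrFun hz.symm i) i
        simpa [vecMulVec_apply] using this
      obtain ⟨a, ha⟩ := Projectivization.exists_smul_eq_mk_rep ℂ z hz0
      have hrep : herm (Projectivization.mk ℂ z hz0).rep = (a : ℂ) • vecMulVec v (star v) := by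
        rw [← ha, Units.smul_def, herm_smul, hz]
      refine ⟨Projectivization.mk ℂ z hz0,
        ⟨mk_mem_hyperbolicBoundary hz0 (hermSq_of_herm_eq_vecMulVec hz), ?_⟩, a, a.ne_zero, hrep⟩
      rw [smul_hypRep_eq_self_iff]
      refine ⟨x * star x, ?_⟩
      rw [hrep, Matrix.mul_smul, Matrix.smul_mul, mul_vecMulVec, vecMulVec_mul, ← star_mulVec, hgv,
        star_smul, smul_vecMulVec, vecMulVec_smul, smul_smul, smul_smul, smul_smul]
      congr 1
      ring
    obtain ⟨p, hp, c, hc, hpc⟩ := hfix hv hgv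
    obtain ⟨q, hq, d, hd, hqd⟩ := hfix hw hgw
    have hpq : p = q := huniq.unique hp hq
    rw [hpq, hqd] at hpc
    obtain ⟨j, hj⟩ := Function.ne_iff.mp hw
    have hwv : w = (c * star (v j) / (d * star (w j))) • v := by
      have hj' : star (w j) ≠ 0 := star_ne_zero.mpr hj
      ext i
      have := congrFun (congrFun hpc i) j
      simp only [Matrix.smul_apply, vecMulVec_apply, Pi.star_apply, smul_eq_mul] at this
      rw [Pi.smul_apply, smul_eq_mul]
      field_simp
      linear_combination this
    rw [hwv, mulVec_smul, hgv, smul_smul, smul_smul, ← sub_eq_zero, ← sub_smul,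
      smul_eq_zero_iff_left hv, mul_comm y, ← mul_sub] at hgw
    have hcoef := (mul_eq_zero.mp hgw).resolve_right (sub_ne_zero.mpr hxy)
    rw [hcoef, zero_smul] at hwv
    exact hw hwv

/-- Cauchy-Schwarz: a real vector orthogonal to the null vector built from `S, A, B, C` is not
timelike. -/
lemma sq_le_of_linear_eq_zero {S A B C a b c d : ℝ} (hS : 0 < S) (h : A ^ 2 + B ^ 2 + C ^ 2 = S ^ 2)
    (h0 : S * d + A * c + B * a + C * b = 0) : d ^ 2 ≤ a ^ 2 + b ^ 2 + c ^ 2 := by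
  have h1 : S ^ 2 * d ^ 2 ≤ S ^ 2 * (a ^ 2 + b ^ 2 + c ^ 2) := by
    have e : S ^ 2 * d ^ 2 = (A * c + B * a + C * b) ^ 2 := by
      linear_combination (S * d - (A * c + B * a + C * b)) * h0
    rw [e, ← h]
    nlinarith [sq_nonneg (A * a - B * c), sq_nonneg (A * b - C * c), sq_nonneg (B * b - C * a)]
  exact le_of_mul_le_mul_left h1 (by positivity)

/-- A negative vector corresponds to a definite matrix. -/
lemma herm_definite {z : Fin 4 → ℂ} (hz : hermSq z < 0) {v : Fin 2 → ℂ} (hv : v ≠ 0) :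
    star v ⬝ᵥ (herm z *ᵥ v) ≠ 0 := by
  intro h0
  -- For complex `z` the matrix need not be Hermitian. The real and imaginary parts of `z` are
  -- treated separately: each is orthogonal to the null vector of `v vᴴ`, so `hermSq z`, the sum of
  -- their norms, would be nonnegative.
  have hre := congrArg Complex.re h0
  have him := congrArg Complex.im h0
  simp [dotProduct, mulVec, herm, Fin.sum_univ_two] at hre him
  have hS : 0 < (v 0).re ^ 2 + (v 0).im ^ 2 + (v 1).re ^ 2 + (v 1).im ^ 2 := by
    have h : 0 < Complex.normSq (v 0) + Complex.normSq (v 1) := by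
      have n0 := Complex.normSq_nonneg (v 0)
      have n1 := Complex.normSq_nonneg (v 1)
      obtain ⟨i, hi⟩ := Function.ne_iff.mp hv
      have hpos := Complex.normSq_pos.mpr hi
      fin_cases i
      · exact add_pos_of_pos_of_nonneg hpos n1
      · exact add_pos_of_nonneg_of_pos n0 hpos
    rw [Complex.normSq_apply, Complex.normSq_apply] at h
    linarith
  have hid : ((v 0).re ^ 2 + (v 0).im ^ 2 - (v 1).re ^ 2 - (v 1).im ^ 2) ^ 2 +
      (2 * ((v 0).re * (v 1).re + (v 0).im * (v 1).im)) ^ 2 +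
      (-2 * ((v 0).re * (v 1).im - (v 0).im * (v 1).re)) ^ 2 =
      ((v 0).re ^ 2 + (v 0).im ^ 2 + (v 1).re ^ 2 + (v 1).im ^ 2) ^ 2 := by ring
  have k1 := sq_le_of_linear_eq_zero (a := (z 0).re) (b := (z 1).re) (c := (z 2).re)
    (d := (z 3).re) hS hid (by linear_combination hre)
  have k2 := sq_le_of_linear_eq_zero (a := (z 0).im) (b := (z 1).im) (c := (z 2).im)
    (d := (z 3).im) hS hid (by linear_combination him)
  simp only [hermSq, Complex.sq_norm, Complex.normSq_apply] at hz
  nlinarith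

/-- An element with a fixed point in complex hyperbolic space has real trace in `[-2, 2]`. -/
lemma trace_of_fixed {g : Matrix (Fin 2) (Fin 2) ℂ} (hdet : g.det = 1) {z : Fin 4 → ℂ}
    (hz : hermSq z < 0) {c : ℂ} (hfix : g * herm z * gᴴ = c • herm z) :
    ∃ r : ℝ, g 0 0 + g 1 1 = r ∧ |r| ≤ 2 := by
  obtain ⟨x, y, hsum, hprod, -⟩ := exists_roots (g 0 0 + g 1 1)
  have hdet' : gᴴ.det = 1 := by rw [det_conjTranspose, hdet, star_one]
  -- Pairing the fixed-point equation with an eigenvector of `gᴴ` gives `c = |x|²` for both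
  -- eigenvalues `x` of `g`. Their product is 1, so both lie on the unit circle and are conjugate.
  have hev : ∀ x : ℂ, x * x - (g 0 0 + g 1 1) * x + 1 = 0 → c = x * star x := by
    intro x hx
    obtain ⟨v, hv, hgv⟩ := exists_eigenvector hdet' (x := star x) (by
      have := congrArg star hx
      simpa using this)
    have h1 := pairing_mulVec (P := gᴴ) (J := herm z) rfl v v
    rw [conjTranspose_conjTranspose, hfix, hgv, star_smul, smul_dotProduct, mulVec_smul,
      dotProduct_smul, star_star, smul_mulVec, dotProduct_smul, smul_smul, smul_eq_mul,
      smul_eq_mul] at h1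
    exact (mul_right_cancel₀ (herm_definite hz hv) h1).symm
  have hx := hev x (by rw [← hsum]; linear_combination -hprod)
  have hy := hev y (by rw [← hsum]; linear_combination -hprod)
  have hnx : ‖x‖ = 1 := by
    have e : ‖x‖ ^ 2 = ‖y‖ ^ 2 := by
      have : ((‖x‖ ^ 2 : ℝ) : ℂ) = ((‖y‖ ^ 2 : ℝ) : ℂ) := by
        push_cast
        rw [← Complex.mul_conj', ← Complex.mul_conj']
        exact hx.symm.trans hy
      exact_mod_cast this
    have e' : ‖x‖ * ‖y‖ = 1 := by rw [← norm_mul, hprod, norm_one]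
    have e'' : ‖x‖ = ‖y‖ := (sq_eq_sq₀ (norm_nonneg _) (norm_nonneg _)).mp e
    rw [← e'', ← pow_two] at e'
    exact (pow_eq_one_iff_of_nonneg (norm_nonneg _) two_ne_zero).mp e'
  have hx0 : x ≠ 0 := norm_ne_zero_iff.mp (by rw [hnx]; exact one_ne_zero)
  have hyx : y = star x := by
    apply mul_left_cancel₀ hx0
    rw [hprod, Complex.star_def, Complex.mul_conj', hnx]
    norm_num
  refine ⟨2 * x.re, ?_, ?_⟩
  · rw [← hsum, hyx, Complex.star_def, Complex.add_conj]
  · rw [abs_mul, abs_two]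
    have := Complex.abs_re_le_norm x
    linarith

/-- By Cayley-Hamilton, trace 0 gives `g² = -1` and trace `±1` gives `g³ = ∓1`; the exponent 12
serves both. -/
lemma pow_twelve_eq_one {g : Matrix (Fin 2) (Fin 2) ℂ} (hdet : g.det = 1)
    (h : g 0 0 + g 1 1 = 0 ∨ (g 0 0 + g 1 1) ^ 2 = 1) : g ^ 12 = 1 := by
  have hCH : g * g = (g 0 0 + g 1 1) • g - 1 := by
    rw [det_fin_two] at hdet
    ext i j
    fin_cases i <;> fin_cases j <;> simp [mul_apply, Fin.sum_univ_two] <;> grind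
  generalize g 0 0 + g 1 1 = t at *
  rcases h with h | h
  · rw [h, zero_smul, zero_sub] at hCH
    calc g ^ 12 = (g * g) ^ 6 := by rw [← pow_two, ← pow_mul]
      _ = 1 := by rw [hCH]; norm_num
  · have h3 : g ^ 3 = -(t • (1 : Matrix (Fin 2) (Fin 2) ℂ)) := by
      rw [pow_succ, pow_two, hCH, sub_mul, smul_mul_assoc, hCH, one_mul, smul_sub, smul_smul,
        ← pow_two, h, one_smul]
      abel
    calc g ^ 12 = (g ^ 3) ^ 4 := by rw [← pow_mul]
      _ = 1 := by
        rw [h3, neg_pow, smul_pow, one_pow, show t ^ 4 = (t ^ 2) ^ 2 by ring, h]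
        norm_num

/-- A fixed point inside makes the trace real of modulus at most 2, and a real Eisenstein integer is
an integer. Traces `0, ±1` mean torsion, excluded in the knot group; traces `±2` mean parabolic,
with no interior fixed point. -/
lemma not_isBoundaryElliptic (γ : KnotGroup) :
    ¬ IsBoundaryElliptic (SO31toSU31.comp hypRep γ) := by
  rintro ⟨⟨p₀, hp₀⟩, ⟨p, hp, hfix⟩, -⟩
  have hγ : γ ≠ 1 := by
    rintro rfl
    rw [map_one] at hp₀
    exact hp₀ (one_smul _ _)
  have hdet : (slRep γ).1.det = 1 := (slRep γ).2
  obtain ⟨c, hc⟩ := (smul_hypRep_eq_self_iff γ p).mp hfix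
  obtain ⟨r, hr, hr2⟩ := trace_of_fixed hdet hp hc
  obtain ⟨a, b, hab⟩ := add_mem (slRep_mem_eisenstein γ 0 0) (slRep_mem_eisenstein γ 1 1)
  have hb : b = 0 := by
    have h3 : 0 < √3 := Real.sqrt_pos.mpr (by norm_num)
    have := congrArg Complex.im (hr.symm.trans hab)
    simp [omega] at this
    exact this
  rw [hb, Int.cast_zero, zero_mul, add_zero] at hab
  have hra : r = a := by exact_mod_cast hr.symm.trans hab
  have ha2 : |a| ≤ 2 := by
    rw [hra] at hr2
    exact_mod_cast hr2
  have hcases : a = 0 ∨ a ^ 2 = 1 ∨ a ^ 2 = 4 := by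
    obtain ⟨h1, h2⟩ := abs_le.mp ha2
    interval_cases a <;> norm_num
  have hfinite : ((slRep γ).1 0 0 + (slRep γ).1 1 1 = 0 ∨
      ((slRep γ).1 0 0 + (slRep γ).1 1 1) ^ 2 = 1) → False := by
    intro h
    have h12 := pow_twelve_eq_one hdet h
    refine hγ (knotGroup_torsionFree γ 12 (by norm_num) (eq_one_of_isTranslation_zero ?_))
    refine ⟨1, one_mul 1, ?_⟩
    rw [map_pow, Matrix.SpecialLinearGroup.coe_pow, h12, one_fin_two]
    simp
  rcases hcases with h | h | h
  · exact hfinite (Or.inl (by rw [hab, h, Int.cast_zero]))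
  · exact hfinite (Or.inr (by rw [hab]; exact_mod_cast h))
  · have hpar := isParabolic_of_trace (u := 1) (by norm_num) hypRep_areConjugate_rho' hγ
      (by rw [hab]; exact_mod_cast h)
    exact hpar.1 p hp hfix

/-- Every representation into `SU(3,1)` conjugate to some `ρ_u` is parabolic-preserving. -/
lemma isParabolicPreserving {u : Circle} (hu : (u : ℂ) + 1 ≠ 0) {σ : KnotGroup →* SU31}
    (hσ : AreConjugate (SU31.subtype.comp σ) (rho u)) :
    IsParabolicPreserving (SO31toSU31.comp hypRep) σ := by
  intro γ
  refine ⟨fun h => ?_, fun h => absurd h (not_isBoundaryElliptic γ)⟩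
  obtain ⟨hγ, htr⟩ := trace_sq_of_isParabolic h
  exact isParabolic_of_trace hu hσ hγ htr

end FigureEight

end

theorem theorem1p3 :
    ∃ (ρhyp : FigureEight.KnotGroup →* FigureEight.SO31)
      (ρ : Circle → (FigureEight.KnotGroup →* FigureEight.SL4 ℂ)),
      -- `ρhyp` is the hyperbolic representation
      FigureEight.IsHyperbolicRep ρhyp ∧
      -- explicit formulas
      (∀ u : Circle,
        (ρ u FigureEight.genM : Matrix (Fin 4) (Fin 4) ℂ) = FigureEight.matM u ∧
        (ρ u FigureEight.genN : Matrix (Fin 4) (Fin 4) ℂ) = FigureEight.matN u) ∧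
      -- `ρ` is a deformation of `ρhyp`
      (∀ γ, Continuous fun u : Circle => ρ u γ) ∧
      FigureEight.AreConjugate
        (FigureEight.complexify.comp (FigureEight.SO31.subtype.comp ρhyp)) (ρ 1) ∧
      (∀ u v : Circle, u ≠ v → ¬ FigureEight.AreConjugate (ρ u) (ρ v)) ∧
      -- representations into SU(3,1), all of them parabolic-preserving
      (∀ α : ℝ, |α| < 2 * Real.pi / 3 →
        (∃ σ : FigureEight.KnotGroup →* FigureEight.SU31,
          FigureEight.AreConjugate (FigureEight.SU31.subtype.comp σ) (ρ (Circle.exp α))) ∧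
        ∀ σ : FigureEight.KnotGroup →* FigureEight.SU31,
          FigureEight.AreConjugate (FigureEight.SU31.subtype.comp σ) (ρ (Circle.exp α)) →
            FigureEight.IsParabolicPreserving (FigureEight.SO31toSU31.comp ρhyp) σ) ∧
      -- representations into SU(2,2)
      (∀ α : ℝ, 2 * Real.pi / 3 < |α| → |α| < Real.pi →
        ∃ σ : FigureEight.KnotGroup →* FigureEight.SU22,
          FigureEight.AreConjugate (FigureEight.SU22.subtype.comp σ) (ρ (Circle.exp α))) ∧
      -- discrete images, for `u = 1, -1, ± i, e^{± iπ/3}, e^{± 2iπ/3}`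
      (∀ α ∈ ({0, Real.pi, Real.pi / 2, -(Real.pi / 2), Real.pi / 3, -(Real.pi / 3),
          2 * Real.pi / 3, -(2 * Real.pi / 3)} : Set ℝ),
        DiscreteTopology (ρ (Circle.exp α)).range) := by
  exact ⟨FigureEight.hypRep, FigureEight.rho, FigureEight.isHyperbolicRep_hypRep,
    fun u => ⟨FigureEight.rho_genM u, FigureEight.rho_genN u⟩, FigureEight.continuous_rho,
    FigureEight.hypRep_areConjugate_rho, fun u v h => FigureEight.not_areConjugate_rho h,
    fun α hα => ⟨FigureEight.exists_SU31_rep hα, fun _ hσ =>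
      FigureEight.isParabolicPreserving (FigureEight.exp_add_one_ne_zero (by
        linarith [FigureEight.cos_gt_of_abs_lt hα])) hσ⟩,
    fun α hα hα' => FigureEight.exists_SU22_rep hα hα',
    fun α hα => FigureEight.discreteTopology_range_rho_exp hα⟩
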